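/- Let $m\ge 0$ and, for $y\in\{0,1\}\times\mathbb N$, put $\bar y=(y_1,\log(1+y_2))'$. For $\theta=(d,\Gamma,A,B)\in\mathbb R^2\times\mathbb R^{2\times m}\times\mathbb R^{2\times 2}\times\mathbb R^{2\times 2}$ consider the Binary-Poisson (BIP) model $$Y_{1,t}=\mathbf 1\{U_{1,t}\ge 1-F(\lambda_{1,t})\},\quad Y_{2,t}=\inf\Big\{y\in\mathbb N:\sum_{j=0}^{y}e^{-e^{\lambda_{2,t}}}\frac{e^{j\lambda_{2,t}}}{j!}\ge U_{2,t}\Big\},\quad \lambda_t=d+B\lambda_{t-1}+A\bar Y_{t-1}+\Gamma X_{t-1},\quad t\in\mathbb Z,$$ where $F(s)=1/(1+e^{-s})$, $(X_t)_{t\in\mathbb Z}$ is a process in $\mathbb R^m$ and $(U_t)_{t\in\mathbb Z}$ is a process in $\mathbb R^2$. For $r\in(-1,1)$ let $R=\begin{pmatrix}1&r\\ r&1\end{pmatrix}$ and let $C_r$ be the Gaussian copula, i.e. the distribution on $(0,1)^2$ with density $$c_r(u)=\det(R)^{-1/2}\exp\Big(-\tfrac12\,\Phi^{-1}(u)'(R^{-1}-I)\Phi^{-1}(u)\Big),\qquad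 \Phi^{-1}(u)=(\Phi^{-1}(u_1),\Phi^{-1}(u_2))',$$ $\Phi$ being the standard Gaussian distribution function. Let $\mathcal F_t=\sigma(U_s,X_s:s\le t)$, let $\rho$ denote the spectral radius and $|M|_{vec}$ the matrix of the absolute values of the entries of $M$. Assume the following. 1. $\Theta$ is a compact set of parameters $\theta=(d,\Gamma,A,B)$ with $\rho(B)<1$ for every $\theta\in\Theta$, and $\theta_0=(d_0,\Gamma_0,A_0,B_0)\in\Theta$. (This includes the case where all the matrices $B$ are diagonal with diagonal entries in $(-1,1)$.) $G\subset(-1,1)$ is compact and $r_0\in G$. 2. $((U_t,X_t))_{t\in\mathbb Z}$ is stationary and ergodic, $U_t$ is independent of $\mathcal F_{t-1}$ for every $t$, $U_0$ has distribution $C_{r_0}$, and $\mathbb E\exp(r|X_0|_1)<\infty$ for every $r>0$. 3. Either (a) for every $v\in\mathbb R^m$, if $v'X_1$ is almost surely equal to an $\mathcal F_0\vee\sigma(U_1)$-measurable random variable then $v=0$; or (b) the processes $(U_t)$ and $(X_t)$ are independent, and whenever $\Phi_j\in\mathbb R^{2\times m}$ and $c\in\mathbb R^2$ are such that almost surely the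 series $\sum_{j\ge1}\Phi_jX_{-j}$ converges absolutely and $\sum_{j\ge1}\Phi_jX_{-j}+c=0$, then $c=0$ and $\Phi_j=0$ for all $j$. 4. For every $\theta\in\Theta$: if $B^jv=B_0^jv$ for all $j\ge1$ and all columns $v$ of $A_0$ and of $\Gamma_0$, then $B=B_0$. 5. $\rho\big(|B_0|_{vec}+|A_0|_{vec}\,\mathrm{diag}(1/4,1)\big)<1$, and every row sum of $|\bar A_0|_{vec}+|B_0|_{vec}$ is $<1$, where $\bar A_0$ is $A_0$ with its first column replaced by $0$. 6. $((Y_t,\lambda_t))_{t\in\mathbb Z}$ is a stationary, $(\mathcal F_t)$-adapted solution of the model with $\theta=\theta_0$ (the equations holding almost surely) such that $\mathbb E|\lambda_0|_1<\infty$. For $\theta\in\Theta$ let $\lambda_t(\theta)=\sum_{j\ge0}B^j(d+A\bar Y_{t-1-j}+\Gamma X_{t-1-j})$, $t\in\mathbb Z$, be the latent process defined by the recursion $\lambda_t(\theta)=d+B\lambda_{t-1}(\theta)+A\bar Y_{t-1}+\Gamma X_{t-1}$, and let $\bar\lambda_t(\theta)$, $t\ge 0$, be given by the same recursion for $t\ge1$,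 started from a fixed deterministic vector $\bar\lambda_0(\theta)=\bar\lambda_0$. Let $h_{1,y}(s)=\log(1+e^s)-ys$ and $h_{2,y}(s)=e^s-ys$. First step: for $n\ge1$ let $$\hat\theta_n\in\arg\min_{\theta\in\Theta}\frac1n\sum_{t=1}^n\sum_{i=1}^2h_{i,Y_{i,t}}(\ell_{i,t}(\theta)),$$ where $\ell_t(\theta)=\bar\lambda_t(\theta)$ for all $t,\theta$, or $\ell_t(\theta)=\lambda_t(\theta)$ for all $t,\theta$. Second step: let $$\hat r_n\in\arg\max_{r\in G}\frac1n\sum_{t=1}^n\log p_r\big(Y_t\mid\lambda_t(\hat\theta_n)\big),\qquad p_r(y\mid s)=\int_{F_{1,s_1}(y_1-1)}^{F_{1,s_1}(y_1)}\int_{F_{2,s_2}(y_2-1)}^{F_{2,s_2}(y_2)}c_r(u_1,u_2)\,du_2\,du_1,$$ where $F_{1,s}$ is the distribution function of the Bernoulli distribution with parameter $F(s)$ and $F_{2,s}$ that of the Poisson distribution with parameter $e^s$. Then, for any choice of the minimizers and maximizers, $$\lim_{n\to\infty}\hat r_n=r_0\quad\text{almost surely.}$$ -/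

import Mathlib

open MeasureTheory ProbabilityTheory Filter Topology

namespace BIP

noncomputable section

/-! ### Stationary and ergodic processes indexed by `ℤ` -/

/-- The shift on two-sided sequences. -/
def shift {S : Type*} (z : ℤ → S) : ℤ → S := fun t => z (t + 1)

/-- The law of a process on the space of two-sided sequences. -/
def pathLaw {Ω S : Type*} [MeasurableSpace Ω] [MeasurableSpace S]
    (P : Measure Ω) (Z : ℤ → Ω → S) : Measure (ℤ → S) :=
  P.map (fun ω t => Z t ω)

/-- `Z` is a (strictly) stationary process: its law is invariant under the shift. -/
def IsStationary {Ω S : Type*} [MeasurableSpace Ω] [MeasurableSpace S]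
    (P : Measure Ω) (Z : ℤ → Ω → S) : Prop :=
  (∀ t, Measurable (Z t)) ∧ MeasurePreserving shift (pathLaw P Z) (pathLaw P Z)

/-- `Z` is a stationary and ergodic process (Mathlib's `Ergodic` includes the invariance of the
measure). -/
def IsStationaryErgodic {Ω S : Type*} [MeasurableSpace Ω] [MeasurableSpace S]
    (P : Measure Ω) (Z : ℤ → Ω → S) : Prop :=
  (∀ t, Measurable (Z t)) ∧ Ergodic shift (pathLaw P Z)

/-- The sigma-field `ℱ_t` generated by `(U_s, X_s)`, `s ≤ t`. -/
@[reducible] def past {Ω : Type*} {m : ℕ} (U : ℤ → Ω → Fin 2 → ℝ) (X : ℤ → Ω → Fin m → ℝ) (t : ℤ) :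
    MeasurableSpace Ω :=
  ⨆ s : ℤ, ⨆ _ : s ≤ t,
    MeasurableSpace.comap (U s) inferInstance ⊔ MeasurableSpace.comap (X s) inferInstance

/-! ### Parameters, and matrices -/

/-- The autoregressive parameter `θ = (d, Γ, A, B)`; `m` is the dimension of the covariates. -/
abbrev Param (m : ℕ) : Type :=
  (Fin 2 → ℝ) × Matrix (Fin 2) (Fin m) ℝ × Matrix (Fin 2) (Fin 2) ℝ × Matrix (Fin 2) (Fin 2) ℝ

/-- The intercept `d`. -/
def Param.d {m : ℕ} (θ : Param m) : Fin 2 → ℝ := θ.1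

/-- The matrix `Γ` of the coefficients of the covariates. -/
def Param.Γ {m : ℕ} (θ : Param m) : Matrix (Fin 2) (Fin m) ℝ := θ.2.1

/-- The matrix `A` of the coefficients of the past observations. -/
def Param.A {m : ℕ} (θ : Param m) : Matrix (Fin 2) (Fin 2) ℝ := θ.2.2.1

/-- The matrix `B` of the coefficients of the past latent vector. -/
def Param.B {m : ℕ} (θ : Param m) : Matrix (Fin 2) (Fin 2) ℝ := θ.2.2.2

/-- The entrywise absolute value `|M|_vec`. -/
def absVec (M : Matrix (Fin 2) (Fin 2) ℝ) : Matrix (Fin 2) (Fin 2) ℝ := M.map abs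

/-- The matrix `M` with its first column replaced by the null vector. -/
def zeroFirstCol (M : Matrix (Fin 2) (Fin 2) ℝ) : Matrix (Fin 2) (Fin 2) ℝ :=
  Matrix.of fun i j => if j = 0 then 0 else M i j

/-- The spectral radius of a real matrix: the largest modulus of its complex eigenvalues. -/
def specRad (M : Matrix (Fin 2) (Fin 2) ℝ) : ENNReal :=
  spectralRadius ℂ (M.map (algebraMap ℝ ℂ))

/-! ### The marginal distributions -/

/-- The logistic distribution function. -/
def logistic (s : ℝ) : ℝ := 1 / (1 + Real.exp (-s))

/-- The mass functions of the two marginals, for the latent value `s`: for the coordinate `0` the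
Bernoulli distribution of parameter `logistic s` on `{0, 1}`, for the coordinate `1` the Poisson
distribution of parameter `exp s`. -/
def margPmf (i : Fin 2) (s : ℝ) (y : ℕ) : ℝ :=
  if i = 0 then
    if y = 1 then logistic s else if y = 0 then 1 - logistic s else 0
  else Real.exp (-Real.exp s) * Real.exp (y * s) / (y.factorial : ℝ)

/-- The marginal distribution functions `F_{i,s}(y)`, `y ∈ ℕ`. -/
def margCdf (i : Fin 2) (s : ℝ) (y : ℕ) : ℝ := ∑ j ∈ Finset.range (y + 1), margPmf i s j

/-- Their left limits `F_{i,s}(y⁻) = F_{i,s}(y - 1)`, with the value `0` at `y = 0`. -/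
def margCdfLeft (i : Fin 2) (s : ℝ) (y : ℕ) : ℝ := ∑ j ∈ Finset.range y, margPmf i s j

/-- The observation `Y = (Y₁, Y₂)` that corresponds to the latent vector `s` and to the noise `u`,
i.e. the quantile transforms `1_{u₁ ≥ 1 - F(s₁)}` and `inf {y : F_{2,s₂}(y) ≥ u₂}`. (The set in
this infimum is nonempty as soon as `u₂ < 1`.) -/
def observe (s u : Fin 2 → ℝ) : Fin 2 → ℕ :=
  ![if 1 - logistic (s 0) ≤ u 0 then 1 else 0, sInf {y : ℕ | u 1 ≤ margCdf 1 (s 1) y}]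

/-- The transformed observation `(Y₁, log (1 + Y₂))`. -/
def transf (y : Fin 2 → ℕ) : Fin 2 → ℝ := ![(y 0 : ℝ), Real.log (1 + (y 1 : ℝ))]

/-! ### The Gaussian copula -/

/-- The distribution function `Φ` of the standard Gaussian distribution. -/
def stdCdf (x : ℝ) : ℝ := cdf (gaussianReal 0 1) x

/-- The quantile function `Φ⁻¹` of the standard Gaussian distribution (used on `(0, 1)`). -/
def stdQuantile (u : ℝ) : ℝ := sInf {x : ℝ | u ≤ stdCdf x}

/-- The correlation matrix with off-diagonal entry `r`. -/
def corrMatrix (r : ℝ) : Matrix (Fin 2) (Fin 2) ℝ := !![1, r; r, 1]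

/-- The density of the Gaussian copula at a point of `(0, 1)²`. -/
def copulaDensity (r : ℝ) (u : Fin 2 → ℝ) : ℝ :=
  (Real.sqrt (corrMatrix r).det)⁻¹ *
    Real.exp (-(1 / 2) * ((fun i => stdQuantile (u i)) ⬝ᵥ
      Matrix.mulVec ((corrMatrix r)⁻¹ - 1) (fun i => stdQuantile (u i))))

/-- The Gaussian copula with correlation `r`, a measure carried by `(0, 1)²`. -/
def gaussianCopula (r : ℝ) : Measure (Fin 2 → ℝ) :=
  (volume.restrict (Set.pi Set.univ fun _ => Set.Ioo (0 : ℝ) 1)).withDensity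
    fun u => ENNReal.ofReal (copulaDensity r u)

/-- The mass `p_r(y | s)` at `y` of the distribution with marginals given by `s` and with the
Gaussian copula of correlation `r`: the integral of the copula density over the rectangle with
sides `(F_{i,s_i}(y_i⁻), F_{i,s_i}(y_i)]`. -/
def condPmf (r : ℝ) (y : Fin 2 → ℕ) (s : Fin 2 → ℝ) : ℝ :=
  ∫ u in Set.pi Set.univ
      (fun i => Set.Ioc (margCdfLeft i (s i) (y i)) (margCdf i (s i) (y i))),
    copulaDensity r u

/-! ### The model -/

/-- The autoregressive function `g_θ(l, y, x) = d + B l + A ȳ + Γ x`. -/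
def step {m : ℕ} (θ : Param m) (l : Fin 2 → ℝ) (y : Fin 2 → ℕ) (x : Fin m → ℝ) : Fin 2 → ℝ :=
  θ.d + Matrix.mulVec θ.B l + Matrix.mulVec θ.A (transf y) + Matrix.mulVec θ.Γ x

/-- `(Y, lam)` is a stationary, adapted and integrable solution of the Binary-Poisson model with
parameter `θ`, noise `U` and covariates `X`. -/
structure IsSolution {Ω : Type*} [MeasurableSpace Ω] (P : Measure Ω) {m : ℕ}
    (U : ℤ → Ω → Fin 2 → ℝ) (X : ℤ → Ω → Fin m → ℝ) (θ : Param m)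
    (Y : ℤ → Ω → Fin 2 → ℕ) (lam : ℤ → Ω → Fin 2 → ℝ) : Prop where
  observation : ∀ t, ∀ᵐ ω ∂P, Y t ω = observe (lam t ω) (U t ω)
  latent : ∀ t, ∀ᵐ ω ∂P, lam t ω = step θ (lam (t - 1) ω) (Y (t - 1) ω) (X (t - 1) ω)
  stationary : IsStationary P (fun t ω => (Y t ω, lam t ω))
  adapted_obs : ∀ t, Measurable[past U X t] (Y t)
  adapted_latent : ∀ t, Measurable[past U X t] (lam t)
  integrable : Integrable (lam 0) P

/-- The process `λ_t(θ)`, `t ∈ ℤ`, along paths `y` and `x` of the observations and of the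
covariates: the solution `λ_t(θ) = ∑_{j ≥ 0} B^j (d + A ȳ_{t-1-j} + Γ x_{t-1-j})` of the recursion
`λ_t(θ) = g_θ(λ_{t-1}(θ), y_{t-1}, x_{t-1})`. -/
def latent {m : ℕ} (θ : Param m) (y : ℤ → Fin 2 → ℕ) (x : ℤ → Fin m → ℝ) (t : ℤ) : Fin 2 → ℝ :=
  ∑' j : ℕ, Matrix.mulVec (θ.B ^ j)
    (θ.d + Matrix.mulVec θ.A (transf (y (t - 1 - j))) + Matrix.mulVec θ.Γ (x (t - 1 - j)))

/-- The computable latent process: the same recursion for `t ≥ 1`, started at time `0` from the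
deterministic vector `l₀`. -/
def latentInit {m : ℕ} (l₀ : Fin 2 → ℝ) (θ : Param m) (y : ℤ → Fin 2 → ℕ) (x : ℤ → Fin m → ℝ) :
    ℕ → Fin 2 → ℝ
  | 0 => l₀
  | t + 1 => step θ (latentInit l₀ θ y x t) (y t) (x t)

/-! ### The two-step estimator -/

/-- The contrast `h_{1,y₁}(s₁) + h_{2,y₂}(s₂)`, with `h_{1,y}(s) = log (1 + exp s) - y s` and
`h_{2,y}(s) = exp s - y s`. -/
def contrast (y : Fin 2 → ℕ) (s : Fin 2 → ℝ) : ℝ :=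
  (Real.log (1 + Real.exp (s 0)) - (y 0 : ℝ) * s 0) + (Real.exp (s 1) - (y 1 : ℝ) * s 1)

/-- The pseudo-likelihood criterion `n⁻¹ ∑_{t=1}^n ∑_i h_{i,y_{i,t}}(l_{i,t}(θ))`, for a family of
latent sequences `l`. -/
def criterion {m : ℕ} (y : ℤ → Fin 2 → ℕ) (l : Param m → ℕ → Fin 2 → ℝ) (n : ℕ)
    (θ : Param m) : ℝ :=
  (n : ℝ)⁻¹ * ∑ t ∈ Finset.Icc 1 n, contrast (y t) (l θ t)

/-- `θhat n`, `n ≥ 1`, are minimizers over `Θ` of the pseudo-likelihood criteria along the paths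
`y`, `x`. The latent process in them is `λ_t(θ)` if `init = none`, and the computable one started
from `l₀` if `init = some l₀`. -/
def IsPMLE {m : ℕ} (Θ : Set (Param m)) (init : Option (Fin 2 → ℝ)) (y : ℤ → Fin 2 → ℕ)
    (x : ℤ → Fin m → ℝ) (θhat : ℕ → Param m) : Prop :=
  ∀ n : ℕ, 1 ≤ n → θhat n ∈ Θ ∧
    IsMinOn
      (criterion y
        (fun θ t => match init with
          | none => latent θ y x t
          | some l₀ => latentInit l₀ θ y x t) n)
      Θ (θhat n)

/-- The copula log-likelihood `n⁻¹ ∑_{t=1}^n log p_r(y_t | λ_t(θ))`. -/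
def copulaLogLik {m : ℕ} (y : ℤ → Fin 2 → ℕ) (x : ℤ → Fin m → ℝ) (n : ℕ) (θ : Param m)
    (r : ℝ) : ℝ :=
  (n : ℝ)⁻¹ * ∑ t ∈ Finset.Icc 1 n, Real.log (condPmf r (y t) (latent θ y x t))

/-- `rhat n`, `n ≥ 1`, are maximizers over `G` of the copula log-likelihoods in which `θ` is
replaced by `θhat n`. -/
def IsCopulaMLE {m : ℕ} (G : Set ℝ) (y : ℤ → Fin 2 → ℕ) (x : ℤ → Fin m → ℝ)
    (θhat : ℕ → Param m) (rhat : ℕ → ℝ) : Prop :=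
  ∀ n : ℕ, 1 ≤ n → rhat n ∈ G ∧ IsMaxOn (copulaLogLik y x n (θhat n)) G (rhat n)

/-! ### The assumptions on the noise, the covariates and the parameters -/

/-- `(U_t, X_t)` is stationary and ergodic, and `U_t` is independent of `ℱ_{t-1}` for every `t`. -/
def NoiseAssumption {Ω : Type*} [MeasurableSpace Ω] (P : Measure Ω) {m : ℕ}
    (U : ℤ → Ω → Fin 2 → ℝ) (X : ℤ → Ω → Fin m → ℝ) : Prop :=
  IsStationaryErgodic P (fun t ω => (U t ω, X t ω)) ∧
    ∀ t, Indep (MeasurableSpace.comap (U t) inferInstance) (past U X (t - 1)) P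

/-- No nontrivial linear combination of the coordinates of `X_1` is (almost surely equal to a
random variable) measurable with respect to `ℱ_0 ∨ σ(U_1)`. -/
def CovariateNondegenerate {Ω : Type*} [MeasurableSpace Ω] (P : Measure Ω) {m : ℕ}
    (U : ℤ → Ω → Fin 2 → ℝ) (X : ℤ → Ω → Fin m → ℝ) : Prop :=
  ∀ v : Fin m → ℝ,
    (∃ f : Ω → ℝ, Measurable[past U X 0 ⊔ MeasurableSpace.comap (U 1) inferInstance] f ∧
      (fun ω => v ⬝ᵥ X 1 ω) =ᵐ[P] f) → v = 0

/-- The noise and the covariates are independent processes, and `∑_{j ≥ 1} Φ_j X_{-j} + c = 0`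
almost surely only if `c = 0` and `Φ_j = 0` for all `j ≥ 1`; the matrix `Φ_{j+1}` is `Φ j`. -/
def StrictlyExogenous {Ω : Type*} [MeasurableSpace Ω] (P : Measure Ω) {m : ℕ}
    (U : ℤ → Ω → Fin 2 → ℝ) (X : ℤ → Ω → Fin m → ℝ) : Prop :=
  IndepFun (fun ω t => U t ω) (fun ω t => X t ω) P ∧
    ∀ (Φ : ℕ → Matrix (Fin 2) (Fin m) ℝ) (c : Fin 2 → ℝ),
      (∀ᵐ ω ∂P, Summable (fun j : ℕ => Matrix.mulVec (Φ j) (X (-((j : ℤ) + 1)) ω)) ∧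
        ∑' j : ℕ, Matrix.mulVec (Φ j) (X (-((j : ℤ) + 1)) ω) + c = 0) →
      (∀ j, Φ j = 0) ∧ c = 0

/-- If, for a parameter in `Θ`, `B^j v = B₀^j v` for all `j ≥ 1` and all columns `v` of `A₀` and of
`Γ₀`, then `B = B₀`. -/
def LagIdentifiable {m : ℕ} (Θ : Set (Param m)) (θ₀ : Param m) : Prop :=
  ∀ θ ∈ Θ,
    (∀ j : ℕ, 1 ≤ j →
      (∀ i, Matrix.mulVec (θ.B ^ j) (θ₀.A.col i) = Matrix.mulVec (θ₀.B ^ j) (θ₀.A.col i)) ∧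
      (∀ i, Matrix.mulVec (θ.B ^ j) (θ₀.Γ.col i) = Matrix.mulVec (θ₀.B ^ j) (θ₀.Γ.col i))) →
    θ.B = θ₀.B

end

end BIP

/-! Both criteria are averages along the path of the data $(Y_t,X_t)$. The proof therefore needs
three facts: the data are ergodic with enough exponential moments, the averages converge uniformly
over compact parameter sets, and their limits identify the latent vector and then the correlation.

Ergodicity. When two latent values share the same noise, the observations they produce are Lipschitz
in mean, with constant 1/4 for the Bernoulli coordinate and 1 for log(1 + Poisson)
(`lintegral_bernoulliQuantile_sub_le`, `lintegral_log_poissonQuantile_sub_le`). So the recursion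
started from 0 in the remote past approaches the given solution at the rate of the powers of
`contractionMatrix θ₀`. The observations are then almost surely a shift-equivariant function of
noise and covariates, and they inherit ergodicity (`IsSolution.isStationaryErgodic`).

Moments. A Poisson variable of parameter $e^s$ has a k-th moment of order at most $(1+e^s)^k$, so it
costs only a constant times the k-th exponential moment of the latent vector. The row-sum condition
and the convexity of exp make this constant harmless: the exponential moments satisfy $E_{n+1}\le
E_n/2+K$ (`exists_lintegral_exp_iter_le`). The powers of $B$ decay geometrically, uniformly on the
compact set (`exists_geomBound`), so $\lambda_t(\theta)$ is dominated by a geometric moving average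
of the sizes of the data. Such an average again has exponential moments
(`lintegral_exp_geomSum_lt_top`), which gives an integrable envelope for both criteria.

Uniform convergence. Birkhoff's theorem is proved with maximal functions and made uniform by
averaging a modulus of continuity (`tendstoUniformlyOn_birkhoff`). The effect of a deterministic
initial value is summable, hence of order 1/n in the average.

Identification. Given the past, the mean of the contrast is minimal only at the true latent vector,
so every limit point θ of the first-step estimators satisfies
$\lambda_0(\theta)=\lambda_0(\theta_0)$ almost surely (`IsSolution.ae_pathLatent_eq_of_le`). The
limit of the second criterion at (θ, r) thus equals the one at (θ₀, r). There Gibbs' inequality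
forces a maximizer r to give the same conditional masses as r₀. The mass at y = (0,0) is the
Gaussian copula of a lower orthant, strictly increasing in the correlation
(`gaussianCopula_orthant_lt`), so r = r₀ (`IsSolution.eq_of_integral_pathLogPmf_le`). Compactness
concludes (`tendsto_of_two_step`). -/

namespace BIP

noncomputable section

/-! ### The pointwise ergodic theorem -/

/-- The running maximum of the Birkhoff sums, given by the recursion
`M_{n+1} = max 0 (f + M_n ∘ T)`. -/
def birkhoffMax {α : Type*} (T : α → α) (f : α → ℝ) : ℕ → α → ℝ
  | 0 => fun _ => 0
  | n + 1 => fun x => max 0 (f x + birkhoffMax T f n (T x))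

section Birkhoff

variable {α : Type*} {T : α → α} {f : α → ℝ}

lemma birkhoffMax_nonneg (n : ℕ) (x : α) : 0 ≤ birkhoffMax T f n x := by
  cases n with
  | zero => exact le_rfl
  | succ n => exact le_max_left _ _

lemma birkhoffMax_le_succ (n : ℕ) (x : α) : birkhoffMax T f n x ≤ birkhoffMax T f (n + 1) x := by
  induction n generalizing x with
  | zero => exact birkhoffMax_nonneg 1 x
  | succ n ih =>
    change max 0 (f x + birkhoffMax T f n (T x)) ≤ max 0 (f x + birkhoffMax T f (n + 1) (T x))
    gcongr
    exact ih _

lemma birkhoffSum_le_birkhoffMax (n : ℕ) (x : α) : birkhoffSum T f n x ≤ birkhoffMax T f n x := by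
  induction n generalizing x with
  | zero => simp [birkhoffMax]
  | succ n ih =>
    rw [birkhoffSum_succ']
    exact le_trans (by gcongr; exact ih _) (le_max_right _ _)

lemma birkhoffSum_sub_const (c : ℝ) (n : ℕ) (x : α) :
    birkhoffSum T (fun x => f x - c) n x = birkhoffSum T f n x - n * c := by
  simp [birkhoffSum, Finset.sum_sub_distrib]

lemma birkhoffSum_abs_sub_le {f g h : α → ℝ} {n : ℕ} {x : α}
    (hx : ∀ k, |f (T^[k] x) - g (T^[k] x)| ≤ h (T^[k] x)) :
    |birkhoffSum T f n x - birkhoffSum T g n x| ≤ birkhoffSum T h n x := by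
  simp only [birkhoffSum, ← Finset.sum_sub_distrib]
  exact (Finset.abs_sum_le_sum_abs _ _).trans (Finset.sum_le_sum fun k _ => hx k)

variable [MeasurableSpace α] {μ : Measure α}

lemma measurable_birkhoffMax (hT : Measurable T) (hf : Measurable f) (n : ℕ) :
    Measurable (birkhoffMax T f n) := by
  induction n with
  | zero => exact measurable_const
  | succ n ih => exact measurable_const.max (hf.add (ih.comp hT))

lemma integrable_birkhoffMax [IsProbabilityMeasure μ] (hT : MeasurePreserving T μ μ)
    (hf : Integrable f μ) (n : ℕ) : Integrable (birkhoffMax T f n) μ := by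
  induction n with
  | zero => exact integrable_const (0 : ℝ)
  | succ n ih =>
    exact (integrable_const (0 : ℝ)).sup (hf.add (hT.integrable_comp_of_integrable ih))

/-- If `∫ f < 0` then the Birkhoff sums of `f` are almost surely bounded above. -/
lemma ae_bddAbove_birkhoffSum [IsProbabilityMeasure μ] (hT : Ergodic T μ) (hfm : Measurable f)
    (hf : Integrable f μ) (hneg : ∫ x, f x ∂μ < 0) :
    ∀ᵐ x ∂μ, ∃ C : ℝ, ∀ n, birkhoffSum T f n x ≤ C := by
  -- The set where the running maxima are unbounded is invariant, hence null or of full measure. If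
  -- it had full measure, `birkhoffMax T f (n + 1) x - birkhoffMax T f n (T x)` would tend to `f x`.
  -- Its integral is nonnegative because the maxima increase with `n` and `T` preserves the measure,
  -- so the integral of `f` would be nonnegative too.
  set A : Set α := {x | ∀ k : ℕ, ∃ n, (k : ℝ) < birkhoffMax T f n x} with hA
  have hmM := measurable_birkhoffMax (f := f) hT.measurable hfm
  have hAm : MeasurableSet A := by
    have : A = ⋂ k : ℕ, ⋃ n, {x | (k : ℝ) < birkhoffMax T f n x} := by
      ext x; simp [hA]
    rw [this]
    exact MeasurableSet.iInter fun k => MeasurableSet.iUnion fun n =>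
      measurableSet_lt measurable_const (hmM n)
  have hinv : T ⁻¹' A = A := by
    ext x
    simp only [hA, Set.mem_preimage, Set.mem_ofPred_eq]
    constructor
    · intro h k
      obtain ⟨j, hj⟩ := exists_nat_gt ((k : ℝ) - f x)
      obtain ⟨n, hn⟩ := h j
      refine ⟨n + 1, lt_of_lt_of_le ?_ (le_max_right _ _)⟩
      linarith
    · intro h k
      obtain ⟨j, hj⟩ := exists_nat_gt (max 0 (f x + k))
      obtain ⟨n, hn⟩ := h j
      cases n with
      | zero =>
        exfalso
        have : (0 : ℝ) ≤ j := j.cast_nonneg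
        simp only [birkhoffMax] at hn
        linarith
      | succ n =>
        refine ⟨n, ?_⟩
        by_contra hcon
        push Not at hcon
        have : birkhoffMax T f (n + 1) x ≤ max 0 (f x + k) := by
          change max 0 (f x + birkhoffMax T f n (T x)) ≤ _
          gcongr
        linarith
  rcases hT.toPreErgodic.ae_mem_or_ae_notMem hAm hinv with h | h
  · exfalso
    have hlim : Tendsto (fun n => ∫ x, (birkhoffMax T f (n + 1) x - birkhoffMax T f n (T x)) ∂μ)
        atTop (𝓝 (∫ x, f x ∂μ)) := by
      refine tendsto_integral_of_dominated_convergence (fun x => |f x|) ?_ hf.abs ?_ ?_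
      · exact fun n => ((hmM _).sub ((hmM n).comp hT.measurable)).aestronglyMeasurable
      · refine fun n => Eventually.of_forall fun x => ?_
        have h0 := birkhoffMax_nonneg (T := T) (f := f) n (T x)
        -- The difference is the maximum of `f x` and of the nonpositive number `-birkhoffMax T f n
        -- (T x)`, so `|f|` dominates it.
        change |max 0 (f x + birkhoffMax T f n (T x)) - birkhoffMax T f n (T x)| ≤ |f x|
        rw [abs_le]
        constructor
        · have := le_max_right 0 (f x + birkhoffMax T f n (T x))
          have := neg_abs_le (f x)
          linarith
        · have := le_abs_self (f x)
          have := abs_nonneg (f x)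
          rw [sub_le_iff_le_add]
          apply max_le <;> linarith
      · filter_upwards [hT.quasiMeasurePreserving.ae h] with x hx
        -- As soon as the maximum at `T x` exceeds `-f x`, the truncation at 0 is inactive and the
        -- difference equals `f x` exactly.
        obtain ⟨j, hj⟩ := exists_nat_gt (-f x)
        obtain ⟨N, hN⟩ := hx j
        refine tendsto_const_nhds.congr' ?_
        filter_upwards [eventually_ge_atTop N] with n hn
        have hmono : birkhoffMax T f N (T x) ≤ birkhoffMax T f n (T x) :=
          monotone_nat_of_le_succ (f := fun n => birkhoffMax T f n (T x))
            (fun n => birkhoffMax_le_succ n _) hn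
        change f x = max 0 (f x + birkhoffMax T f n (T x)) - birkhoffMax T f n (T x)
        rw [max_eq_right (by linarith)]
        ring
    have hge : ∀ n, 0 ≤ ∫ x, (birkhoffMax T f (n + 1) x - birkhoffMax T f n (T x)) ∂μ := by
      intro n
      have hi := integrable_birkhoffMax (f := f) hT.toMeasurePreserving hf
      have hi' : Integrable (fun x => birkhoffMax T f n (T x)) μ :=
        hT.toMeasurePreserving.integrable_comp_of_integrable (hi n)
      rw [integral_sub (hi _) hi',
        show ∫ x, birkhoffMax T f n (T x) ∂μ = ∫ x, birkhoffMax T f n x ∂μ from by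
          conv_rhs => rw [← hT.map_eq]
          rw [integral_map hT.measurable.aemeasurable (hmM n).aestronglyMeasurable], sub_nonneg]
      exact integral_mono (hi n) (hi _) fun x => birkhoffMax_le_succ n x
    exact absurd (ge_of_tendsto' hlim hge) (not_le.2 hneg)
  · filter_upwards [h] with x hx
    simp only [hA, Set.mem_ofPred_eq, not_forall, not_exists, not_lt] at hx
    obtain ⟨k, hk⟩ := hx
    exact ⟨k, fun n => (birkhoffSum_le_birkhoffMax n x).trans (hk n)⟩

/-- After centering by the mean plus ε/2 the integral is negative, so the Birkhoff sums are bounded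
by some C; dividing by `n` leaves C/n, which is at most ε/2 once n ≥ 2|C|/ε. -/
lemma ae_eventually_birkhoff_le [IsProbabilityMeasure μ] (hT : Ergodic T μ) (hfm : Measurable f)
    (hf : Integrable f μ) {ε : ℝ} (hε : 0 < ε) :
    ∀ᵐ x ∂μ, ∀ᶠ n : ℕ in atTop, (n : ℝ)⁻¹ * birkhoffSum T f n x ≤ ∫ x, f x ∂μ + ε := by
  have h := ae_bddAbove_birkhoffSum (f := fun x => f x - (∫ x, f x ∂μ + ε / 2)) hT
    (hfm.sub_const _) (hf.sub (integrable_const _)) (by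
      rw [integral_sub hf (integrable_const _)]; simp; linarith)
  filter_upwards [h] with x ⟨C, hC⟩
  have hev : ∀ᶠ n : ℕ in atTop, (2 * |C| / ε : ℝ) ≤ n :=
    tendsto_natCast_atTop_atTop.eventually_ge_atTop _
  filter_upwards [hev, eventually_gt_atTop 0] with n hn hn0
  have hn0' : (0 : ℝ) < n := by exact_mod_cast hn0
  have h1 := hC n
  rw [birkhoffSum_sub_const] at h1
  rw [div_le_iff₀ hε] at hn
  rw [inv_mul_le_iff₀ hn0']
  have := le_abs_self C
  nlinarith

/-- **Birkhoff's pointwise ergodic theorem** for an ergodic map. -/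
theorem tendsto_birkhoff_of_ergodic [IsProbabilityMeasure μ] (hT : Ergodic T μ)
    (hfm : Measurable f) (hf : Integrable f μ) :
    ∀ᵐ x ∂μ, Tendsto (fun n : ℕ => (n : ℝ)⁻¹ * birkhoffSum T f n x) atTop (𝓝 (∫ x, f x ∂μ)) := by
  have h1 : ∀ᵐ x ∂μ, ∀ k : ℕ, ∀ᶠ n : ℕ in atTop,
      (n : ℝ)⁻¹ * birkhoffSum T f n x ≤ ∫ x, f x ∂μ + 1 / ((k : ℝ) + 1) :=
    ae_all_iff.2 fun k => ae_eventually_birkhoff_le hT hfm hf (by positivity)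
  have h2 : ∀ᵐ x ∂μ, ∀ k : ℕ, ∀ᶠ n : ℕ in atTop,
      (n : ℝ)⁻¹ * birkhoffSum T (fun x => -f x) n x ≤ ∫ x, -f x ∂μ + 1 / ((k : ℝ) + 1) :=
    ae_all_iff.2 fun k => ae_eventually_birkhoff_le hT hfm.neg hf.neg (by positivity)
  filter_upwards [h1, h2] with x h1 h2
  rw [Metric.tendsto_atTop']
  intro ε hε
  obtain ⟨k, hk⟩ := exists_nat_one_div_lt hε
  obtain ⟨N, hN⟩ := eventually_atTop.1 ((h1 k).and (h2 k))
  refine ⟨N, fun n hn => ?_⟩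
  obtain ⟨ha, hb⟩ := hN n hn.le
  have hneg : birkhoffSum T (fun x => -f x) n x = -birkhoffSum T f n x := by simp [birkhoffSum]
  rw [hneg, integral_neg] at hb
  rw [Real.dist_eq, abs_lt]
  constructor <;> linarith

/-- A **uniform ergodic theorem**: over a compact set of parameters, the time averages of a family
of functions that is continuous in the parameter and has an integrable envelope converge
uniformly. -/
theorem tendstoUniformlyOn_birkhoff {E : Type*} [TopologicalSpace E]
    [TopologicalSpace.PseudoMetrizableSpace E] [IsProbabilityMeasure μ] (hT : Ergodic T μ)
    {K : Set E} (hK : IsCompact K) {F : E → α → ℝ} (hF : ∀ θ ∈ K, Measurable (F θ))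
    (hc : ∀ᵐ x ∂μ, ContinuousOn (fun θ => F θ x) K) {g : α → ℝ} (hg : Integrable g μ)
    (hb : ∀ᵐ x ∂μ, ∀ θ ∈ K, |F θ x| ≤ g x) :
    ContinuousOn (fun θ => ∫ x, F θ x ∂μ) K ∧
    ∀ᵐ x ∂μ, TendstoUniformlyOn (fun (n : ℕ) θ => (n : ℝ)⁻¹ * birkhoffSum T (F θ) n x)
      (fun θ => ∫ x, F θ x ∂μ) atTop K := by
  let _ := TopologicalSpace.pseudoMetrizableSpacePseudoMetric E
  have hint : ∀ θ ∈ K, Integrable (F θ) μ := fun θ hθ =>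
    hg.mono' (hF θ hθ).aestronglyMeasurable (hb.mono fun x hx => hx θ hθ)
  have hLc : ContinuousOn (fun θ => ∫ x, F θ x ∂μ) K := by
    intro θ hθ
    refine tendsto_integral_filter_of_dominated_convergence g ?_ ?_ hg ?_
    · filter_upwards [self_mem_nhdsWithin] with θ hθ using (hF θ hθ).aestronglyMeasurable
    · filter_upwards [self_mem_nhdsWithin] with θ hθ using hb.mono fun x hx => hx θ hθ
    · filter_upwards [hc] with x hx using hx θ hθ
  refine ⟨hLc, ?_⟩
  -- `w k` is the modulus of continuity at scale 1/(k+1), taken over a countable dense subset of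
  -- parameters so as to be measurable. It tends to 0 almost surely by uniform continuity on the
  -- compact set, and in mean because it is dominated by `2 * |g|`.
  obtain ⟨D, hDK, hDc, hDd⟩ := hK.isSeparable.exists_countable_dense_subset
  let I : ℕ → Set (E × E) := fun k => {p | p ∈ D ×ˢ D ∧ dist p.1 p.2 < 1 / ((k : ℝ) + 1)}
  have hIc : ∀ k, (I k).Countable := fun k => (hDc.prod hDc).mono fun p hp => hp.1
  let w : ℕ → α → ℝ := fun k x => ⨆ p : I k, |F p.1.1 x - F p.1.2 x|
  have hwm : ∀ k, Measurable (w k) := fun k => by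
    have := (hIc k).to_subtype
    exact Measurable.iSup fun p =>
      ((hF _ (hDK p.2.1.1)).sub (hF _ (hDK p.2.1.2))).norm
  have hbd : ∀ᵐ x ∂μ, ∀ k, ∀ p : I k, |F p.1.1 x - F p.1.2 x| ≤ 2 * g x := by
    filter_upwards [hb] with x hx k p
    have h1 := hx _ (hDK p.2.1.1)
    have h2 := hx _ (hDK p.2.1.2)
    have := abs_sub (F p.1.1 x) (F p.1.2 x)
    linarith
  have hw0 : ∀ k x, 0 ≤ w k x := fun k x => Real.iSup_nonneg fun p => abs_nonneg _
  have hwle : ∀ᵐ x ∂μ, ∀ k, |w k x| ≤ 2 * |g x| := by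
    filter_upwards [hbd] with x hx k
    rw [abs_of_nonneg (hw0 k x)]
    have := le_abs_self (g x)
    exact Real.iSup_le (fun p => (hx k p).trans (by linarith)) (by positivity)
  have hwi : ∀ k, Integrable (w k) μ := fun k =>
    (hg.abs.const_mul 2).mono' (hwm k).aestronglyMeasurable (hwle.mono fun x hx => hx k)
  have hwlim : Tendsto (fun k => ∫ x, w k x ∂μ) atTop (𝓝 0) := by
    rw [show (0 : ℝ) = ∫ _, (0 : ℝ) ∂μ by simp]
    refine tendsto_integral_of_dominated_convergence (fun x => 2 * |g x|)
      (fun k => (hwm k).aestronglyMeasurable) (hg.abs.const_mul 2)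
      (fun k => hwle.mono fun x hx => hx k) ?_
    filter_upwards [hc] with x hx
    have huc := hK.uniformContinuousOn_of_continuous hx
    rw [Metric.uniformContinuousOn_iff] at huc
    rw [Metric.tendsto_atTop]
    intro ε hε
    obtain ⟨δ, hδ, hu⟩ := huc (ε / 2) (by positivity)
    obtain ⟨N, hN⟩ := exists_nat_one_div_lt hδ
    refine ⟨N, fun k hk => ?_⟩
    rw [Real.dist_eq, sub_zero, abs_of_nonneg (hw0 k x)]
    refine lt_of_le_of_lt (Real.iSup_le (fun p => ?_) (by positivity)) (half_lt_self hε)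
    refine (hu _ (hDK p.2.1.1) _ (hDK p.2.1.2) (p.2.2.trans (lt_of_le_of_lt ?_ hN))).le
    exact Nat.one_div_le_one_div hk
  -- By density and continuity, the modulus computed on `D` controls all pairs of parameters in `K`:
  -- the distance condition is open, so nearby pairs of `D` satisfy it too.
  have hmod : ∀ᵐ x ∂μ, ∀ k : ℕ, ∀ θ ∈ K, ∀ θ' ∈ K, dist θ θ' < 1 / ((k : ℝ) + 1) →
      |F θ x - F θ' x| ≤ w k x := by
    filter_upwards [hc, hbd] with x hx hbdx k θ hθ θ' hθ' hd
    have hcont : ContinuousWithinAt (fun p : E × E => |F p.1 x - F p.2 x|) (D ×ˢ D) (θ, θ') := by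
      have h1 : ContinuousWithinAt (fun p : E × E => F p.1 x) (D ×ˢ D) (θ, θ') :=
        ContinuousWithinAt.comp (t := K) (g := fun θ => F θ x) (hx θ hθ) continuousWithinAt_fst
          fun p hp => hDK hp.1
      have h2 : ContinuousWithinAt (fun p : E × E => F p.2 x) (D ×ˢ D) (θ, θ') :=
        ContinuousWithinAt.comp (t := K) (g := fun θ => F θ x) (hx θ' hθ') continuousWithinAt_snd
          fun p hp => hDK hp.2
      exact (h1.sub h2).abs
    have hne : (𝓝[D ×ˢ D] (θ, θ')).NeBot := by
      rw [← mem_closure_iff_nhdsWithin_neBot, closure_prod_eq]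
      exact ⟨hDd hθ, hDd hθ'⟩
    refine le_of_tendsto hcont ?_
    have hopen : IsOpen {p : E × E | dist p.1 p.2 < 1 / ((k : ℝ) + 1)} :=
      isOpen_lt (continuous_fst.dist continuous_snd) continuous_const
    filter_upwards [self_mem_nhdsWithin, mem_nhdsWithin_of_mem_nhds (hopen.mem_nhds hd)]
      with p hp hp'
    exact le_ciSup (f := fun p : I k => |F p.1.1 x - F p.1.2 x|)
      ⟨2 * g x, by rintro _ ⟨q, rfl⟩; exact hbdx k q⟩ ⟨p, hp, hp'⟩
  have hmodT : ∀ᵐ x ∂μ, ∀ j k : ℕ, ∀ θ ∈ K, ∀ θ' ∈ K, dist θ θ' < 1 / ((k : ℝ) + 1) →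
      |F θ (T^[j] x) - F θ' (T^[j] x)| ≤ w k (T^[j] x) :=
    ae_all_iff.2 fun j => (hT.quasiMeasurePreserving.iterate j).ae hmod
  have hDconv : ∀ᵐ x ∂μ, ∀ θ ∈ D, Tendsto (fun n : ℕ => (n : ℝ)⁻¹ * birkhoffSum T (F θ) n x)
      atTop (𝓝 (∫ x, F θ x ∂μ)) :=
    (ae_ball_iff hDc).2 fun θ hθ => tendsto_birkhoff_of_ergodic hT (hF θ (hDK hθ)) (hint θ (hDK hθ))
  have hwconv : ∀ᵐ x ∂μ, ∀ k, Tendsto (fun n : ℕ => (n : ℝ)⁻¹ * birkhoffSum T (w k) n x)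
      atTop (𝓝 (∫ x, w k x ∂μ)) :=
    ae_all_iff.2 fun k => tendsto_birkhoff_of_ergodic hT (hwm k) (hwi k)
  filter_upwards [hmodT, hDconv, hwconv] with x hx1 hx2 hx3
  rw [Metric.tendstoUniformlyOn_iff]
  intro ε hε
  have hLuc := hK.uniformContinuousOn_of_continuous hLc
  rw [Metric.uniformContinuousOn_iff] at hLuc
  obtain ⟨δ, hδ, hL⟩ := hLuc (ε / 4) (by positivity)
  obtain ⟨N, hN⟩ := exists_nat_one_div_lt hδ
  -- Three errors below ε/4 each: the averaged modulus between a parameter and its neighbour in a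
  -- finite net, the pointwise convergence at the net, and the modulus of the limit.
  obtain ⟨k, hkN, hk⟩ : ∃ k ≥ N, ∫ x, w k x ∂μ < ε / 4 := by
    have h1 := hwlim.eventually (gt_mem_nhds (show (0 : ℝ) < ε / 4 by positivity))
    obtain ⟨k, h2, h3⟩ := (h1.and (eventually_ge_atTop N)).exists
    exact ⟨k, h3, h2⟩
  have hk0 : (0 : ℝ) < 1 / ((k : ℝ) + 1) := by positivity
  obtain ⟨t, htD, htf, htK⟩ : ∃ t ⊆ D, t.Finite ∧
      K ⊆ ⋃ θ ∈ t, Metric.ball θ (1 / ((k : ℝ) + 1)) := by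
    refine hK.elim_finite_subcover_image (b := D) (fun θ _ => Metric.isOpen_ball) ?_
    intro θ hθ
    obtain ⟨θ', h1, h2⟩ := Metric.mem_closure_iff.1 (hDd hθ) _ hk0
    exact Set.mem_biUnion h1 h2
  have hev1 : ∀ᶠ n : ℕ in atTop, (n : ℝ)⁻¹ * birkhoffSum T (w k) n x < ε / 4 :=
    (hx3 k).eventually (gt_mem_nhds hk)
  have hev2 : ∀ᶠ n : ℕ in atTop, ∀ θ ∈ t,
      |(n : ℝ)⁻¹ * birkhoffSum T (F θ) n x - ∫ x, F θ x ∂μ| < ε / 4 := by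
    rw [eventually_all_finite htf]
    intro θ hθ
    exact (Metric.tendsto_nhds.1 (hx2 θ (htD hθ))) _ (by positivity)
  filter_upwards [hev1, hev2] with n hn1 hn2 θ hθ
  obtain ⟨θ', hθ't, hθ'⟩ := Set.mem_iUnion₂.1 (htK hθ)
  rw [Metric.mem_ball] at hθ'
  have hθ'K := hDK (htD hθ't)
  have e1 : |(n : ℝ)⁻¹ * birkhoffSum T (F θ) n x - (n : ℝ)⁻¹ * birkhoffSum T (F θ') n x|
      ≤ (n : ℝ)⁻¹ * birkhoffSum T (w k) n x := by
    rw [← mul_sub, abs_mul, abs_of_nonneg (by positivity : (0 : ℝ) ≤ (n : ℝ)⁻¹)]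
    gcongr
    exact birkhoffSum_abs_sub_le fun j => hx1 j k θ hθ θ' hθ'K hθ'
  have e2 := hn2 θ' hθ't
  have e3 := hL θ hθ θ' hθ'K (hθ'.trans (lt_of_le_of_lt (Nat.one_div_le_one_div hkN) hN))
  rw [Real.dist_eq] at e3 ⊢
  rw [abs_lt] at e2 e3 ⊢
  rw [abs_le] at e1
  constructor <;> linarith [e1.1, e1.2, e2.1, e2.2, e3.1, e3.2]

end Birkhoff

/-! ### Powers of matrices of spectral radius less than one -/

section MatrixPowers

variable {ι : Type*} [Fintype ι]

lemma rowSum_mul_le {P Q : Matrix ι ι ℝ} {p q : ℝ} (hp : ∀ i, ∑ k, |P i k| ≤ p)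
    (hq : ∀ i, ∑ k, |Q i k| ≤ q) (hq0 : 0 ≤ q) (i : ι) : ∑ k, |(P * Q) i k| ≤ p * q := by
  calc ∑ k, |(P * Q) i k| ≤ ∑ k, ∑ j, |P i j| * |Q j k| := by
        refine Finset.sum_le_sum fun k _ => ?_
        rw [Matrix.mul_apply]
        exact (Finset.abs_sum_le_sum_abs _ _).trans_eq (by simp [abs_mul])
    _ = ∑ j, |P i j| * ∑ k, |Q j k| := by
        rw [Finset.sum_comm]; simp [Finset.mul_sum]
    _ ≤ ∑ j, |P i j| * q := by
        gcongr with j _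
        exact hq j
    _ ≤ p * q := by
        rw [← Finset.sum_mul]
        gcongr
        exact hp i

variable [DecidableEq ι]

lemma rowSum_pow_le {P : Matrix ι ι ℝ} {p : ℝ} (hp0 : 0 ≤ p) (hp : ∀ i, ∑ k, |P i k| ≤ p)
    (n : ℕ) (i : ι) : ∑ k, |(P ^ n) i k| ≤ p ^ n := by
  induction n generalizing i with
  | zero => simp [Matrix.one_apply, apply_ite abs]
  | succ n ih =>
    rw [pow_succ, pow_succ]
    exact rowSum_mul_le ih hp hp0 i

/-- Writing n = N q + r with r < N, the factor `(P ^ N) ^ q` gives the decay, and the remaining r ≤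
N factors cost at most D each, that is D/κ relative to the rate. -/
lemma rowSum_pow_le_geometric {P : Matrix ι ι ℝ} {D κ : ℝ} {N : ℕ} (hκ : 0 < κ) (hκ1 : κ < 1)
    (hN : 0 < N) (hD1 : 1 ≤ D) (hD : ∀ i, ∑ k, |P i k| ≤ D) (hP : ∀ i, ∑ k, |(P ^ N) i k| ≤ κ ^ N)
    (n : ℕ) (i : ι) : ∑ k, |(P ^ n) i k| ≤ (D / κ) ^ N * κ ^ n := by
  have hn : P ^ n = (P ^ N) ^ (n / N) * P ^ (n % N) := by
    rw [← pow_mul, ← pow_add, Nat.div_add_mod]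
  have hmod : n % N ≤ N := (Nat.mod_lt _ hN).le
  have hDκ : 1 ≤ D / κ := by rw [le_div_iff₀ hκ]; linarith
  calc ∑ k, |(P ^ n) i k| ≤ (κ ^ N) ^ (n / N) * D ^ (n % N) := by
        rw [hn]
        exact rowSum_mul_le (rowSum_pow_le (by positivity) hP _)
          (rowSum_pow_le (by linarith) hD _) (by positivity) i
    _ = (D / κ) ^ (n % N) * κ ^ n := by
        have h : κ ^ n = (κ ^ N) ^ (n / N) * κ ^ (n % N) := by
          rw [← pow_mul, ← pow_add, Nat.div_add_mod]
        rw [div_pow, h]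
        field_simp
    _ ≤ (D / κ) ^ N * κ ^ n := by
        gcongr

end MatrixPowers

-- Gelfand's formula for the operator norm given by the maximal row sum, with κ chosen strictly
-- between the spectral radius and 1. The strict inequality at a single power N is an open condition
-- on the matrix, which the compactness argument exploits.
attribute [local instance] Matrix.linftyOpNormedRing Matrix.linftyOpNormedAlgebra in
lemma exists_rowSum_pow_lt {B : Matrix (Fin 2) (Fin 2) ℝ} (hB : specRad B < 1) :
    ∃ κ : ℝ, 0 < κ ∧ κ < 1 ∧ ∃ N : ℕ, 0 < N ∧ ∀ i, ∑ k, |(B ^ N) i k| < κ ^ N := by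
  have : CompleteSpace (Matrix (Fin 2) (Fin 2) ℂ) := FiniteDimensional.complete ℂ _
  obtain ⟨κ, hκ0, hκ1⟩ := ENNReal.lt_iff_exists_nnreal_btwn.1 hB
  have hκ1' : κ < 1 := by exact_mod_cast hκ1
  have hκ0' : 0 < κ := by
    by_contra h
    simp only [not_lt, nonpos_iff_eq_zero] at h
    simp [h] at hκ0
  set M : Matrix (Fin 2) (Fin 2) ℂ := B.map (algebraMap ℝ ℂ)
  have hg := spectrum.pow_nnnorm_pow_one_div_tendsto_nhds_spectralRadius M
  obtain ⟨N, hN, hN0⟩ := ((hg.eventually (gt_mem_nhds hκ0)).and (eventually_gt_atTop 0)).exists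
  refine ⟨κ, hκ0', hκ1', N, hN0, fun i => ?_⟩
  have h1 : ‖M ^ N‖₊ < κ ^ N := by
    have h2 : (‖M ^ N‖₊ : ENNReal) < (κ : ENNReal) ^ N := by
      have hN' : (0 : ℝ) < N := by exact_mod_cast hN0
      rw [one_div, ENNReal.rpow_inv_lt_iff hN'] at hN
      simpa using hN
    exact_mod_cast h2
  have hMN : M ^ N = (B ^ N).map (algebraMap ℝ ℂ) := by
    rw [show (B ^ N).map (algebraMap ℝ ℂ) = (algebraMap ℝ ℂ).mapMatrix (B ^ N) from rfl, map_pow]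
    rfl
  have h3 : ∑ k, ‖(M ^ N) i k‖₊ ≤ ‖M ^ N‖₊ := by
    rw [Matrix.linfty_opNNNorm_def]
    exact Finset.le_sup (f := fun i => ∑ k, ‖(M ^ N) i k‖₊) (Finset.mem_univ i)
  have h4 : ((∑ k, ‖(M ^ N) i k‖₊ : NNReal) : ℝ) = ∑ k, |(B ^ N) i k| := by
    push_cast
    simp [hMN]
  rw [← h4]
  exact_mod_cast h3.trans_lt h1

/-- Over a compact set of matrices of spectral radius less than one, the powers decay at a uniform
geometric rate. -/
lemma exists_rowSum_pow_le {K : Set (Matrix (Fin 2) (Fin 2) ℝ)} (hK : IsCompact K)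
    (hB : ∀ B ∈ K, specRad B < 1) :
    ∃ C κ : ℝ, 0 < C ∧ 0 < κ ∧ κ < 1 ∧ ∀ B ∈ K, ∀ (n : ℕ) i, ∑ k, |(B ^ n) i k| ≤ C * κ ^ n := by
  -- The property passes to subsets and to finite unions (take the larger constants), so it suffices
  -- to have it near each matrix.
  refine hK.induction_on (p := fun S => ∃ C κ : ℝ, 0 < C ∧ 0 < κ ∧ κ < 1 ∧
    ∀ B ∈ S, ∀ (n : ℕ) i, ∑ k, |(B ^ n) i k| ≤ C * κ ^ n) ?_ ?_ ?_ ?_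
  · exact ⟨1, 1 / 2, by norm_num, by norm_num, by norm_num, by simp⟩
  · rintro s t hst ⟨C, κ, h1, h2, h3, h4⟩
    exact ⟨C, κ, h1, h2, h3, fun B hB => h4 B (hst hB)⟩
  · rintro s t ⟨C, κ, h1, h2, h3, h4⟩ ⟨C', κ', h1', h2', h3', h4'⟩
    refine ⟨max C C', max κ κ', lt_max_of_lt_left h1, lt_max_of_lt_left h2, max_lt h3 h3', ?_⟩
    rintro B (hB | hB) n i
    · refine (h4 B hB n i).trans ?_
      gcongr <;> exact le_max_left _ _
    · refine (h4' B hB n i).trans ?_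
      gcongr <;> exact le_max_right _ _
  · intro B hBK
    obtain ⟨κ, hκ0, hκ1, N, hN, hκ⟩ := exists_rowSum_pow_lt (hB B hBK)
    have hc : ∀ (n : ℕ) (i : Fin 2),
        Continuous fun B : Matrix (Fin 2) (Fin 2) ℝ => ∑ k, |(B ^ n) i k| := fun n i =>
      continuous_finsetSum _ fun k _ =>
        (((continuous_pow n).matrix_elem i k).abs)
    set D : ℝ := 1 + ∑ i, ∑ k, |B i k| with hD
    have h0 : 0 ≤ ∑ i, ∑ k, |B i k| := by positivity
    -- Two strict bounds define the neighbourhood: the one on the N-th power, which gives the rate,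
    -- and the one on the first power, which controls the remainder of the division by N.
    refine ⟨{P | (∀ i, ∑ k, |(P ^ N) i k| < κ ^ N) ∧ ∀ i, ∑ k, |(P ^ 1) i k| < D},
      mem_nhdsWithin_of_mem_nhds (IsOpen.mem_nhds ?_ ⟨hκ, fun i => ?_⟩),
      (D / κ) ^ N, κ, by positivity, hκ0, hκ1, ?_⟩
    · refine IsOpen.and ?_ ?_
      · simp only [Set.ofPred_forall]
        exact isOpen_iInter_of_finite fun i => isOpen_lt (hc N i) continuous_const
      · simp only [Set.ofPred_forall]
        exact isOpen_iInter_of_finite fun i => isOpen_lt (hc 1 i) continuous_const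
    · rw [pow_one]
      have := Finset.single_le_sum (f := fun i => ∑ k, |B i k|) (fun i _ => by positivity)
        (Finset.mem_univ i)
      simp only [hD] at *
      linarith
    · rintro P ⟨h1, h2⟩ n i
      simp only [pow_one] at h2
      exact rowSum_pow_le_geometric hκ0 hκ1 hN (by linarith) (fun i => (h2 i).le)
        (fun i => (h1 i).le) n i

/-! ### The marginal distributions -/

section Marginals

/-- Lebesgue measure on `(0, 1)`. -/
def unif : Measure ℝ := volume.restrict (Set.Ioo (0 : ℝ) 1)

instance : IsProbabilityMeasure unif := ⟨by simp [unif]⟩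

lemma ae_unif_mem : ∀ᵐ u ∂unif, u ∈ Set.Ioo (0 : ℝ) 1 := ae_restrict_mem measurableSet_Ioo

lemma unif_Ioc {a b : ℝ} (ha : 0 ≤ a) (hb : b ≤ 1) :
    unif (Set.Ioc a b) = ENNReal.ofReal (b - a) := by
  rw [unif, Measure.restrict_congr_set Ioo_ae_eq_Ioc, Measure.restrict_apply measurableSet_Ioc,
    Set.inter_eq_left.2 (Set.Ioc_subset_Ioc ha hb), Real.volume_Ioc]

lemma margPmf_one (s : ℝ) (y : ℕ) :
    margPmf 1 s y = Real.exp (-Real.exp s) * Real.exp (y * s) / (y.factorial : ℝ) := by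
  simp [margPmf]

lemma margPmf_one_pos (s : ℝ) (y : ℕ) : 0 < margPmf 1 s y := by
  rw [margPmf_one]; positivity

lemma logistic_pos (s : ℝ) : 0 < logistic s := by unfold logistic; positivity

lemma logistic_eq (s : ℝ) : logistic s = Real.exp s / (1 + Real.exp s) := by
  unfold logistic
  rw [Real.exp_neg]
  field_simp
  ring

lemma one_sub_logistic (s : ℝ) : 1 - logistic s = 1 / (1 + Real.exp s) := by
  rw [logistic_eq]
  field_simp
  ring

lemma logistic_lt_one (s : ℝ) : logistic s < 1 := by
  have : 0 < 1 - logistic s := by rw [one_sub_logistic]; positivity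
  linarith

lemma margPmf_nonneg (i : Fin 2) (s : ℝ) (y : ℕ) : 0 ≤ margPmf i s y := by
  have h1 := (logistic_pos s).le
  have h2 := (logistic_lt_one s).le
  fin_cases i
  · simp only [margPmf, Fin.zero_eta, ↓reduceIte]
    split_ifs <;> linarith
  · exact (margPmf_one_pos s y).le

/-- This Poisson recursion drives everything below: it telescopes the derivative of the distribution
function and shifts the sums that define the moments. -/
lemma margPmf_succ (s : ℝ) (y : ℕ) :
    ((y : ℝ) + 1) * margPmf 1 s (y + 1) = Real.exp s * margPmf 1 s y := by
  rw [margPmf_one, margPmf_one, Nat.factorial_succ]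
  push_cast
  rw [show ((y : ℝ) + 1) * s = y * s + s by ring, Real.exp_add]
  field_simp

lemma hasSum_margPmf_one (s : ℝ) : HasSum (margPmf 1 s) 1 := by
  have h := hasSum_one_poissonMeasure ⟨Real.exp s, (Real.exp_pos s).le⟩
  rw [show margPmf 1 s = _ from funext (margPmf_one s)]
  simp only [Real.exp_nat_mul]
  exact h

lemma margCdf_sub_margCdfLeft (i : Fin 2) (s : ℝ) (y : ℕ) :
    margCdf i s y - margCdfLeft i s y = margPmf i s y := by
  rw [margCdf, margCdfLeft, Finset.sum_range_succ]; ring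

lemma margCdfLeft_succ (i : Fin 2) (s : ℝ) (y : ℕ) : margCdfLeft i s (y + 1) = margCdf i s y := rfl

lemma margCdfLeft_zero (i : Fin 2) (s : ℝ) : margCdfLeft i s 0 = 0 := rfl

lemma margCdf_zero_eq (s : ℝ) (y : ℕ) : margCdf 0 s y = if y = 0 then 1 - logistic s else 1 := by
  induction y with
  | zero => simp [margCdf, margPmf]
  | succ y ih =>
    rw [margCdf, Finset.sum_range_succ, ← margCdf, ih]
    rcases y with _ | y <;> simp [margPmf]

lemma margCdfLeft_nonneg (i : Fin 2) (s : ℝ) (y : ℕ) : 0 ≤ margCdfLeft i s y :=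
  Finset.sum_nonneg fun _ _ => margPmf_nonneg _ _ _

lemma margCdf_le_one (i : Fin 2) (s : ℝ) (y : ℕ) : margCdf i s y ≤ 1 := by
  fin_cases i
  · have := (logistic_pos s).le
    simp only [Fin.zero_eta, margCdf_zero_eq]
    split_ifs <;> linarith
  · exact sum_le_hasSum _ (fun _ _ => margPmf_nonneg _ _ _) (hasSum_margPmf_one s)

lemma margCdf_mono (i : Fin 2) (s : ℝ) : Monotone (margCdf i s) :=
  monotone_nat_of_le_succ fun y => by
    rw [margCdf, margCdf, Finset.sum_range_succ _ (y + 1)]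
    linarith [margPmf_nonneg i s (y + 1)]

lemma tendsto_margCdf_one (s : ℝ) : Tendsto (margCdf 1 s) atTop (𝓝 1) :=
  (hasSum_margPmf_one s).tendsto_sum_nat.comp (tendsto_add_atTop_nat 1)

lemma hasDerivAt_margPmf_one (y : ℕ) (s : ℝ) :
    HasDerivAt (fun s => margPmf 1 s y) ((y - Real.exp s) * margPmf 1 s y) s := by
  simp only [margPmf_one]
  have h1 : HasDerivAt (fun s => Real.exp (-Real.exp s)) _ s := (Real.hasDerivAt_exp s).neg.exp
  have h2 : HasDerivAt (fun s : ℝ => Real.exp (y * s)) _ s :=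
    ((hasDerivAt_id s).const_mul (y : ℝ)).exp
  refine ((h1.mul h2).div_const _).congr_deriv ?_
  simp only [id, Pi.neg_apply]
  ring

/-- The derivative of the j-th mass is `j p_j - (j + 1) p_{j+1}` by the Poisson recursion, so the
sum over j ≤ y telescopes. -/
lemma hasDerivAt_margCdf_one (y : ℕ) (s : ℝ) :
    HasDerivAt (fun s => margCdf 1 s y) (-(((y : ℝ) + 1) * margPmf 1 s (y + 1))) s := by
  induction y with
  | zero =>
    simp only [margCdf, zero_add, Finset.sum_range_one]
    refine (hasDerivAt_margPmf_one 0 s).congr_deriv ?_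
    have := margPmf_succ s 0
    simp only [Nat.cast_zero, zero_add] at this ⊢
    rw [this]; ring
  | succ y ih =>
    simp only [margCdf, Finset.sum_range_succ _ (y + 1)]
    refine (ih.add (hasDerivAt_margPmf_one (y + 1) s)).congr_deriv ?_
    have h2 := margPmf_succ s (y + 1)
    push_cast at h2 ⊢
    rw [h2]; ring

lemma continuous_margCdf (i : Fin 2) (y : ℕ) : Continuous fun s => margCdf i s y := by
  fin_cases i
  · simp only [Fin.zero_eta, margCdf_zero_eq]
    have : Continuous logistic := by
      unfold logistic
      exact continuous_const.div (by fun_prop) fun s => by positivity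
    split_ifs
    · exact continuous_const.sub this
    · exact continuous_const
  · exact continuous_iff_continuousAt.2 fun s => (hasDerivAt_margCdf_one y s).continuousAt

lemma continuous_margCdfLeft (i : Fin 2) (y : ℕ) : Continuous fun s => margCdfLeft i s y := by
  cases y with
  | zero => exact continuous_const
  | succ y => exact continuous_margCdf i y

lemma margCdf_one_antitone (y : ℕ) : Antitone fun s => margCdf 1 s y :=
  antitone_of_hasDerivAt_nonpos (hasDerivAt_margCdf_one y) fun s => by
    have := margPmf_one_pos s (y + 1)
    simp only [Pi.zero_apply, Left.neg_nonpos_iff]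
    positivity

/-- The quantile function of the Poisson distribution of parameter `exp s`. -/
def poissonQuantile (s u : ℝ) : ℕ := sInf {y : ℕ | u ≤ margCdf 1 s y}

/-- For u < 1 the defining set is nonempty because the distribution function tends to 1, so the
infimum is attained; u ≥ 1 would bring in the default value of `sInf`. -/
lemma poissonQuantile_le_iff {s u : ℝ} (hu : u < 1) (k : ℕ) :
    poissonQuantile s u ≤ k ↔ u ≤ margCdf 1 s k := by
  have hne : {y : ℕ | u ≤ margCdf 1 s y}.Nonempty := by
    obtain ⟨y, hy⟩ := ((tendsto_margCdf_one s).eventually (lt_mem_nhds hu)).exists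
    exact ⟨y, hy.le⟩
  constructor
  · intro h
    exact le_trans (Nat.sInf_mem hne) (margCdf_mono 1 s h)
  · intro h
    exact Nat.sInf_le h

lemma poissonQuantile_eq_iff {s u : ℝ} (hu0 : 0 < u) (hu : u < 1) (k : ℕ) :
    poissonQuantile s u = k ↔ u ∈ Set.Ioc (margCdfLeft 1 s k) (margCdf 1 s k) := by
  rw [Set.mem_Ioc, ← poissonQuantile_le_iff hu]
  cases k with
  | zero => simp [margCdfLeft_zero, hu0]
  | succ k =>
    rw [margCdfLeft_succ, ← not_le, ← poissonQuantile_le_iff hu]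
    omega

lemma measurable_poissonQuantile : Measurable fun p : ℝ × ℝ => poissonQuantile p.1 p.2 := by
  refine measurable_of_Iic fun k => ?_
  have hc : ∀ y, Measurable fun p : ℝ × ℝ => margCdf 1 p.1 y := fun y =>
    ((continuous_margCdf 1 y).comp continuous_fst).measurable
  have : (fun p : ℝ × ℝ => poissonQuantile p.1 p.2) ⁻¹' Set.Iic k =
      {p | p.2 ≤ margCdf 1 p.1 k} ∪ ⋂ y, {p | margCdf 1 p.1 y < p.2} := by
    ext p
    simp only [Set.mem_preimage, Set.mem_Iic, Set.mem_union, Set.mem_ofPred_eq, Set.mem_iInter]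
    by_cases h : {y : ℕ | p.2 ≤ margCdf 1 p.1 y}.Nonempty
    · constructor
      · exact fun h' => Or.inl (le_trans (Nat.sInf_mem h) (margCdf_mono 1 p.1 h'))
      · rintro (h' | h')
        · exact Nat.sInf_le h'
        · obtain ⟨y, hy⟩ := h
          exact absurd hy (not_le.2 (h' y))
    · have h' := Set.not_nonempty_iff_eq_empty.1 h
      -- When no `y` reaches the level, the infimum of the empty set is 0 by convention; this is the
      -- second set in the union.
      simp only [poissonQuantile, h', Nat.sInf_empty, zero_le, true_iff]
      right
      intro y
      by_contra hy
      exact h ⟨y, not_lt.1 hy⟩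
  rw [this]
  exact (measurableSet_le measurable_snd (hc k)).union
    (MeasurableSet.iInter fun y => measurableSet_lt (hc y) measurable_snd)

lemma measurable_poissonQuantile_right (s : ℝ) : Measurable (poissonQuantile s) :=
  measurable_poissonQuantile.comp (measurable_const.prodMk measurable_id)

/-! ### Moments of the Poisson quantile transform -/

lemma lintegral_poissonQuantile (s : ℝ) (φ : ℕ → ENNReal) :
    ∫⁻ u, φ (poissonQuantile s u) ∂unif = ∑' j, ENNReal.ofReal (margPmf 1 s j) * φ j := by
  have h := lintegral_map (μ := unif) (f := φ) (measurable_of_countable φ)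
    (measurable_poissonQuantile_right s)
  rw [← h, lintegral_countable']
  congr 1
  ext j
  rw [mul_comm, Measure.map_apply (measurable_poissonQuantile_right s) (MeasurableSet.singleton j)]
  congr 1
  have : (poissonQuantile s ⁻¹' {j} : Set ℝ) =ᵐ[unif]
      Set.Ioc (margCdfLeft 1 s j) (margCdf 1 s j) := by
    filter_upwards [ae_unif_mem] with u hu
    exact propext (poissonQuantile_eq_iff hu.1 hu.2 j)
  rw [measure_congr this, unif_Ioc (margCdfLeft_nonneg _ _ _) (margCdf_le_one _ _ _),
    margCdf_sub_margCdfLeft]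

/-- Split `(1 + j)^(k+1)` as `(1 + j)^k + j (1 + j)^k`. In the second part the Poisson recursion
replaces `j p_j` by `e^s p_{j-1}`, and the shift by one costs a factor `2^k` since 2 + j ≤ 2 (1 +
j). -/
lemma lintegral_poissonQuantile_moment_succ (s : ℝ) (k : ℕ) :
    ∫⁻ u, (1 + (poissonQuantile s u : ENNReal)) ^ (k + 1) ∂unif ≤
      ENNReal.ofReal (2 ^ k * (1 + Real.exp s)) *
        ∫⁻ u, (1 + (poissonQuantile s u : ENNReal)) ^ k ∂unif := by
  rw [lintegral_poissonQuantile s fun j => (1 + (j : ENNReal)) ^ (k + 1),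
    lintegral_poissonQuantile s fun j => (1 + (j : ENNReal)) ^ k]
  set p : ℕ → ENNReal := fun j => ENNReal.ofReal (margPmf 1 s j) with hp
  have hrec : ∀ j : ℕ, ((j : ENNReal) + 1) * p (j + 1) = ENNReal.ofReal (Real.exp s) * p j := by
    intro j
    rw [hp, ← ENNReal.ofReal_mul (Real.exp_pos s).le, ← margPmf_succ,
      ENNReal.ofReal_mul (by positivity), ENNReal.ofReal_add (by positivity) zero_le_one]
    simp
  have h1 : ∑' j : ℕ, p j * ((j : ENNReal) * (1 + (j : ENNReal)) ^ k) ≤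
      ENNReal.ofReal (Real.exp s) * 2 ^ k * ∑' j : ℕ, p j * (1 + (j : ENNReal)) ^ k := by
    rw [tsum_eq_zero_add' ENNReal.summable, ← ENNReal.tsum_mul_left]
    simp only [Nat.cast_zero, zero_mul, mul_zero, zero_add]
    refine ENNReal.tsum_le_tsum fun j => ?_
    push_cast
    calc p (j + 1) * (((j : ENNReal) + 1) * (1 + ((j : ENNReal) + 1)) ^ k)
        = (((j : ENNReal) + 1) * p (j + 1)) * (1 + ((j : ENNReal) + 1)) ^ k := by ring
      _ ≤ (ENNReal.ofReal (Real.exp s) * p j) * (2 * (1 + (j : ENNReal))) ^ k := by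
          rw [hrec]
          gcongr
          rw [two_mul, add_comm (j : ENNReal) 1]
          gcongr
          exact le_self_add
      _ = ENNReal.ofReal (Real.exp s) * 2 ^ k * (p j * (1 + (j : ENNReal)) ^ k) := by
          rw [mul_pow]; ring
  calc ∑' j : ℕ, p j * (1 + (j : ENNReal)) ^ (k + 1)
      = ∑' j : ℕ, p j * (1 + (j : ENNReal)) ^ k +
          ∑' j : ℕ, p j * ((j : ENNReal) * (1 + (j : ENNReal)) ^ k) := by
        rw [← ENNReal.tsum_add]
        congr 1; ext j; ring
    _ ≤ 2 ^ k * ∑' j : ℕ, p j * (1 + (j : ENNReal)) ^ k +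
          ENNReal.ofReal (Real.exp s) * 2 ^ k * ∑' j : ℕ, p j * (1 + (j : ENNReal)) ^ k := by
        gcongr
        exact le_mul_of_one_le_left zero_le (one_le_pow₀ one_le_two)
    _ = _ := by
        rw [ENNReal.ofReal_mul (by positivity), ENNReal.ofReal_add zero_le_one (Real.exp_pos s).le,
          ENNReal.ofReal_pow zero_le_two]
        simp only [ENNReal.ofReal_one, ENNReal.ofReal_ofNat]
        ring

/-- The moments of the Poisson distribution: the `k`-th one grows like the `k`-th power of the
parameter. -/
lemma lintegral_poissonQuantile_moment_le (s : ℝ) (k : ℕ) :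
    ∫⁻ u, (1 + (poissonQuantile s u : ENNReal)) ^ k ∂unif ≤
      ENNReal.ofReal ((2 ^ k * (1 + Real.exp s)) ^ k) := by
  induction k with
  | zero => simp
  | succ k ih =>
    refine (lintegral_poissonQuantile_moment_succ s k).trans ?_
    refine (mul_le_mul_right ih _).trans ?_
    rw [← ENNReal.ofReal_mul (by positivity), ← pow_succ']
    refine ENNReal.ofReal_le_ofReal ?_
    gcongr
    · norm_num
    · omega

lemma lintegral_poissonQuantile_id (s : ℝ) :
    ∫⁻ u, (poissonQuantile s u : ENNReal) ∂unif = ENNReal.ofReal (Real.exp s) := by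
  rw [lintegral_poissonQuantile s fun j => (j : ENNReal), tsum_eq_zero_add' ENNReal.summable]
  simp only [Nat.cast_zero, mul_zero, zero_add]
  have : ∀ j : ℕ, ENNReal.ofReal (margPmf 1 s (j + 1)) * ((j + 1 : ℕ) : ENNReal) =
      ENNReal.ofReal (Real.exp s) * ENNReal.ofReal (margPmf 1 s j) := by
    intro j
    rw [← ENNReal.ofReal_mul (Real.exp_pos s).le, ← margPmf_succ,
      ENNReal.ofReal_mul (by positivity), ← Nat.cast_succ, ENNReal.ofReal_natCast, mul_comm]
  simp only [this]
  rw [ENNReal.tsum_mul_left, ← ENNReal.ofReal_tsum_of_nonneg (fun j => margPmf_nonneg _ _ _)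
    (hasSum_margPmf_one s).summable, (hasSum_margPmf_one s).tsum_eq]
  simp

lemma integrable_poissonQuantile (s : ℝ) : Integrable (fun u => (poissonQuantile s u : ℝ)) unif := by
  refine ⟨((measurable_of_countable _).comp
    (measurable_poissonQuantile_right s)).aestronglyMeasurable, ?_⟩
  rw [hasFiniteIntegral_iff_ofReal (Eventually.of_forall fun u => Nat.cast_nonneg _)]
  simp only [ENNReal.ofReal_natCast]
  rw [lintegral_poissonQuantile_id]
  exact ENNReal.ofReal_lt_top

lemma integral_poissonQuantile (s : ℝ) : ∫ u, (poissonQuantile s u : ℝ) ∂unif = Real.exp s := by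
  rw [integral_eq_lintegral_of_nonneg_ae (Eventually.of_forall fun u => Nat.cast_nonneg _)
    (integrable_poissonQuantile s).aestronglyMeasurable]
  simp only [ENNReal.ofReal_natCast]
  rw [lintegral_poissonQuantile_id, ENNReal.toReal_ofReal (Real.exp_pos s).le]

/-! ### Contraction of the quantile transforms -/

lemma log_succ_sub_log_nonneg (k : ℕ) : 0 ≤ Real.log ((k : ℝ) + 2) - Real.log ((k : ℝ) + 1) :=
  sub_nonneg.2 (Real.log_le_log (by positivity) (by linarith))

/-- The increment of the logarithm compensates exactly the factor k + 1 in the derivative of the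
Poisson distribution function. -/
lemma log_succ_sub_log_le (k : ℕ) :
    (Real.log ((k : ℝ) + 2) - Real.log ((k : ℝ) + 1)) * ((k : ℝ) + 1) ≤ 1 := by
  have hk : (0 : ℝ) < (k : ℝ) + 1 := by positivity
  rw [← Real.log_div (by positivity) hk.ne', ← le_div_iff₀ hk]
  refine (Real.log_le_sub_one_of_pos (by positivity)).trans_eq ?_
  field_simp
  ring

/-- A truncated form of the mean value inequality for the mean of log(1 + N_s). The derivative in s
of the truncated mean is a sum of terms c_k (k+1) p_{k+1}, where c_k (k+1) ≤ 1, so it is at most the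
total mass. -/
lemma sum_log_mul_margCdf_sub_le {s s' : ℝ} (h : s ≤ s') (K : ℕ) :
    ∑ k ∈ Finset.range K, (Real.log ((k : ℝ) + 2) - Real.log ((k : ℝ) + 1)) *
      (margCdf 1 s k - margCdf 1 s' k) ≤ s' - s := by
  set c : ℕ → ℝ := fun k => Real.log ((k : ℝ) + 2) - Real.log ((k : ℝ) + 1)
  have hd : ∀ v, HasDerivAt (fun v => ∑ k ∈ Finset.range K, -(c k * margCdf 1 v k))
      (∑ k ∈ Finset.range K, c k * (((k : ℝ) + 1) * margPmf 1 v (k + 1))) v := by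
    intro v
    refine HasDerivAt.fun_sum fun k _ => ?_
    refine ((hasDerivAt_margCdf_one k v).const_mul (c k)).neg.congr_deriv ?_
    ring
  have hle : ∀ v, deriv (fun v => ∑ k ∈ Finset.range K, -(c k * margCdf 1 v k)) v ≤ 1 := by
    intro v
    rw [(hd v).deriv]
    calc ∑ k ∈ Finset.range K, c k * (((k : ℝ) + 1) * margPmf 1 v (k + 1))
        ≤ ∑ k ∈ Finset.range K, margPmf 1 v (k + 1) := by
          refine Finset.sum_le_sum fun k _ => ?_
          rw [← mul_assoc]
          exact mul_le_of_le_one_left (margPmf_nonneg _ _ _) (log_succ_sub_log_le k)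
      _ ≤ margCdf 1 v K := by
          rw [margCdf, Finset.sum_range_succ']
          linarith [margPmf_nonneg 1 v 0]
      _ ≤ 1 := margCdf_le_one _ _ _
  have := image_sub_le_mul_sub_of_deriv_le (fun v => (hd v).differentiableAt) hle h
  simp only [Finset.sum_neg_distrib] at this
  simp only [mul_sub, Finset.sum_sub_distrib]
  linarith

lemma log_one_add_natCast (n : ℕ) :
    Real.log (1 + (n : ℝ)) =
      ∑ k ∈ Finset.range n, (Real.log ((k : ℝ) + 2) - Real.log ((k : ℝ) + 1)) := by
  induction n with
  | zero => simp
  | succ n ih =>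
    rw [Finset.sum_range_succ, ← ih]
    push_cast
    rw [show 1 + ((n : ℝ) + 1) = n + 2 by ring, add_comm (1 : ℝ) n]
    ring

lemma poissonQuantile_mono {s s' u : ℝ} (h : s ≤ s') (hu : u < 1) :
    poissonQuantile s u ≤ poissonQuantile s' u := by
  rw [poissonQuantile_le_iff hu]
  exact ((poissonQuantile_le_iff hu _).1 le_rfl).trans (margCdf_one_antitone _ h)

/-- With a common uniform variable the quantiles are ordered, so the absolute difference of the
logarithms is the sum of the increments over the k between them, that is over the k with F_{s'}(k) <
u ≤ F_s(k). Integrating in u turns it into the preceding weighted sum of differences of distribution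
functions. -/
lemma lintegral_log_poissonQuantile_sub_le_of_le {s s' : ℝ} (h : s ≤ s') :
    ∫⁻ u, ENNReal.ofReal |Real.log (1 + (poissonQuantile s u : ℝ)) -
      Real.log (1 + (poissonQuantile s' u : ℝ))| ∂unif ≤ ENNReal.ofReal (s' - s) := by
  set c : ℕ → ℝ := fun k => Real.log ((k : ℝ) + 2) - Real.log ((k : ℝ) + 1)
  have hpt : ∀ᵐ u ∂unif, ENNReal.ofReal |Real.log (1 + (poissonQuantile s u : ℝ)) -
      Real.log (1 + (poissonQuantile s' u : ℝ))| ≤ ∑' k : ℕ,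
        (Set.Ioc (margCdf 1 s' k) (margCdf 1 s k)).indicator (fun _ => ENNReal.ofReal (c k)) u := by
    filter_upwards [ae_unif_mem] with u hu
    have hNN := poissonQuantile_mono h hu.2
    rw [log_one_add_natCast, log_one_add_natCast, abs_sub_comm,
      ← Finset.sum_Ico_eq_sub _ hNN,
      abs_of_nonneg (Finset.sum_nonneg fun k _ => log_succ_sub_log_nonneg k),
      ENNReal.ofReal_sum_of_nonneg fun k _ => log_succ_sub_log_nonneg k]
    refine le_trans (Finset.sum_le_sum fun k hk => ?_)
      (ENNReal.sum_le_tsum (Finset.Ico (poissonQuantile s u) (poissonQuantile s' u)))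
    rw [Finset.mem_Ico, ← not_le, poissonQuantile_le_iff hu.2, poissonQuantile_le_iff hu.2,
      not_le] at hk
    rw [Set.indicator_of_mem (show u ∈ Set.Ioc _ _ from ⟨hk.2, hk.1⟩)]
  refine (lintegral_mono_ae hpt).trans ?_
  rw [lintegral_tsum fun k => (measurable_const.indicator measurableSet_Ioc).aemeasurable]
  refine ENNReal.tsum_le_of_sum_range_le fun K => ?_
  refine le_trans (le_of_eq ?_) (ENNReal.ofReal_le_ofReal (sum_log_mul_margCdf_sub_le h K))
  rw [ENNReal.ofReal_sum_of_nonneg fun k _ => mul_nonneg (log_succ_sub_log_nonneg k)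
    (sub_nonneg.2 (show margCdf 1 s' k ≤ margCdf 1 s k from margCdf_one_antitone k h))]
  refine Finset.sum_congr rfl fun k _ => ?_
  rw [lintegral_indicator_const measurableSet_Ioc,
    unif_Ioc (show 0 ≤ margCdf 1 s' k from margCdfLeft_nonneg 1 s' (k + 1)) (margCdf_le_one _ _ _),
    ENNReal.ofReal_mul (log_succ_sub_log_nonneg k)]

/-- The quantile transform `s ↦ log (1 + N_s)` of the Poisson distribution of parameter `exp s` is
nonexpansive in mean. -/
lemma lintegral_log_poissonQuantile_sub_le (s s' : ℝ) :
    ∫⁻ u, ENNReal.ofReal |Real.log (1 + (poissonQuantile s u : ℝ)) -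
      Real.log (1 + (poissonQuantile s' u : ℝ))| ∂unif ≤ ENNReal.ofReal |s - s'| := by
  rcases le_total s s' with h | h
  · rw [abs_sub_comm s, abs_of_nonneg (sub_nonneg.2 h)]
    exact lintegral_log_poissonQuantile_sub_le_of_le h
  · simp_rw [abs_sub_comm (Real.log (1 + (poissonQuantile s _ : ℝ)))]
    rw [abs_of_nonneg (sub_nonneg.2 h)]
    exact lintegral_log_poissonQuantile_sub_le_of_le h

lemma hasDerivAt_logistic (s : ℝ) :
    HasDerivAt logistic (logistic s * (1 - logistic s)) s := by
  have h1 : HasDerivAt (fun s => Real.exp s / (1 + Real.exp s)) _ s :=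
    (Real.hasDerivAt_exp s).div ((Real.hasDerivAt_exp s).const_add 1) (by positivity)
  rw [show logistic = fun s => Real.exp s / (1 + Real.exp s) from funext logistic_eq]
  refine h1.congr_deriv ?_
  field_simp

lemma logistic_mono : Monotone logistic :=
  monotone_of_hasDerivAt_nonneg hasDerivAt_logistic fun s =>
    mul_nonneg (logistic_pos s).le (sub_nonneg.2 (logistic_lt_one s).le)

/-- The derivative p (1 - p) is at most 1/4; this is the origin of the entry 1/4 in the contraction
matrix. -/
lemma logistic_sub_le {s s' : ℝ} (h : s ≤ s') : logistic s' - logistic s ≤ 1 / 4 * (s' - s) := by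
  refine image_sub_le_mul_sub_of_deriv_le (fun v => (hasDerivAt_logistic v).differentiableAt)
    (fun v => ?_) h
  rw [(hasDerivAt_logistic v).deriv]
  nlinarith [sq_nonneg (logistic v - 1 / 2)]

/-- The quantile function of the Bernoulli distribution of parameter `logistic s`. -/
def bernoulliQuantile (s u : ℝ) : ℕ := if 1 - logistic s ≤ u then 1 else 0

lemma continuous_logistic : Continuous logistic :=
  continuous_iff_continuousAt.2 fun s => (hasDerivAt_logistic s).continuousAt

lemma measurable_bernoulliQuantile : Measurable fun p : ℝ × ℝ => bernoulliQuantile p.1 p.2 :=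
  Measurable.ite (measurableSet_le
    (measurable_const.sub (continuous_logistic.measurable.comp measurable_fst)) measurable_snd)
    measurable_const measurable_const

lemma measurable_bernoulliQuantile_right (s : ℝ) : Measurable (bernoulliQuantile s) :=
  measurable_bernoulliQuantile.comp (measurable_const.prodMk measurable_id)

/-- Up to one endpoint, the two indicators differ exactly when u lies between the two thresholds, an
interval of length `logistic s' - logistic s`. -/
lemma lintegral_bernoulliQuantile_sub_le_of_le {s s' : ℝ} (h : s ≤ s') :
    ∫⁻ u, ENNReal.ofReal |(bernoulliQuantile s u : ℝ) - bernoulliQuantile s' u| ∂unif ≤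
      ENNReal.ofReal (1 / 4 * (s' - s)) := by
  have hm := logistic_mono h
  have hpt : ∀ᵐ u ∂unif, ENNReal.ofReal |(bernoulliQuantile s u : ℝ) - bernoulliQuantile s' u| ≤
      (Set.Ioc (1 - logistic s') (1 - logistic s)).indicator 1 u := by
    have hne : ∀ᵐ u ∂unif, u ≠ 1 - logistic s' := by
      refine (ae_restrict_of_ae ?_)
      simp [ae_iff]
    filter_upwards [hne] with u hu
    unfold bernoulliQuantile
    by_cases h1 : 1 - logistic s ≤ u
    · rw [if_pos h1, if_pos (by linarith)]; simp
    · by_cases h2 : 1 - logistic s' ≤ u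
      · rw [Set.indicator_of_mem
          (show u ∈ Set.Ioc _ _ from ⟨lt_of_le_of_ne h2 hu.symm, (not_le.1 h1).le⟩)]
        simp [h1, h2]
      · simp [h1, h2]
  refine (lintegral_mono_ae hpt).trans ?_
  rw [lintegral_indicator_one measurableSet_Ioc,
    unif_Ioc (sub_nonneg.2 (logistic_lt_one _).le) (by linarith [logistic_pos s])]
  refine ENNReal.ofReal_le_ofReal ?_
  have := logistic_sub_le h
  linarith

/-- The quantile transform of the Bernoulli distribution of parameter `logistic s` is a contraction
in mean. -/
lemma lintegral_bernoulliQuantile_sub_le (s s' : ℝ) :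
    ∫⁻ u, ENNReal.ofReal |(bernoulliQuantile s u : ℝ) - bernoulliQuantile s' u| ∂unif ≤
      ENNReal.ofReal (1 / 4 * |s - s'|) := by
  rcases le_total s s' with h | h
  · rw [abs_sub_comm s, abs_of_nonneg (sub_nonneg.2 h)]
    exact lintegral_bernoulliQuantile_sub_le_of_le h
  · simp_rw [abs_sub_comm (bernoulliQuantile s _ : ℝ)]
    rw [abs_of_nonneg (sub_nonneg.2 h)]
    exact lintegral_bernoulliQuantile_sub_le_of_le h

lemma bernoulliQuantile_le_one (s u : ℝ) : bernoulliQuantile s u ≤ 1 := by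
  unfold bernoulliQuantile; split_ifs <;> simp

lemma integrable_bernoulliQuantile (s : ℝ) :
    Integrable (fun u => (bernoulliQuantile s u : ℝ)) unif := by
  refine Integrable.of_bound ((measurable_of_countable _).comp
    (measurable_bernoulliQuantile_right s)).aestronglyMeasurable 1 (Eventually.of_forall fun u => ?_)
  simpa using bernoulliQuantile_le_one s u

lemma integral_bernoulliQuantile (s : ℝ) :
    ∫ u, (bernoulliQuantile s u : ℝ) ∂unif = logistic s := by
  have : (fun u => (bernoulliQuantile s u : ℝ)) =ᵐ[unif]
      (Set.Ioc (1 - logistic s) 1).indicator 1 := by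
    have hne : ∀ᵐ u ∂unif, u ≠ 1 - logistic s := by
      refine (ae_restrict_of_ae ?_)
      simp [ae_iff]
    filter_upwards [hne, ae_unif_mem] with u hu hu'
    unfold bernoulliQuantile
    by_cases h : 1 - logistic s ≤ u
    · rw [Set.indicator_of_mem
        (show u ∈ Set.Ioc _ _ from ⟨lt_of_le_of_ne h hu.symm, hu'.2.le⟩)]
      simp [h]
    · rw [Set.indicator_of_notMem (fun hh => h hh.1.le)]
      simp [h]
  rw [integral_congr_ae this, integral_indicator_one measurableSet_Ioc, Measure.real,
    unif_Ioc (sub_nonneg.2 (logistic_lt_one s).le) le_rfl, ENNReal.toReal_ofReal] <;>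
  linarith [logistic_pos s]

lemma observe_eq (s u : Fin 2 → ℝ) :
    observe s u = ![bernoulliQuantile (s 0) (u 0), poissonQuantile (s 1) (u 1)] := rfl

lemma measurable_observe :
    Measurable fun p : (Fin 2 → ℝ) × (Fin 2 → ℝ) => observe p.1 p.2 := by
  rw [measurable_pi_iff]
  intro i
  fin_cases i
  · exact measurable_bernoulliQuantile.comp
      (f := fun p : (Fin 2 → ℝ) × (Fin 2 → ℝ) => (p.1 0, p.2 0)) (by fun_prop)
  · exact measurable_poissonQuantile.comp
      (f := fun p : (Fin 2 → ℝ) × (Fin 2 → ℝ) => (p.1 1, p.2 1)) (by fun_prop)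

end Marginals

/-! ### The standard Gaussian distribution and its quantile function -/

section Gaussian

lemma stdCdf_eq (x : ℝ) : stdCdf x = (gaussianReal 0 1).real (Set.Iic x) := cdf_eq_real _ _

lemma stdCdf_mono : Monotone stdCdf := monotone_cdf _

lemma measure_Ioc_gaussianReal (a b : ℝ) (hab : a ≤ b) :
    (gaussianReal 0 1).real (Set.Ioc a b) = stdCdf b - stdCdf a := by
  rw [stdCdf_eq, stdCdf_eq, ← Set.Iic_sdiff_Iic, measureReal_sdiff (Set.Iic_subset_Iic.2 hab)
    measurableSet_Iic]

lemma gaussianReal_pos_of_isOpen {s : Set ℝ} (hs : IsOpen s) (hne : s.Nonempty) :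
    0 < (gaussianReal 0 1).real s := by
  rw [measureReal_def, ENNReal.toReal_pos_iff]
  refine ⟨?_, measure_lt_top _ _⟩
  rw [pos_iff_ne_zero]
  intro h
  exact (hs.measure_pos volume hne).ne' (gaussianReal_absolutelyContinuous' 0 one_ne_zero h)

lemma stdCdf_strictMono : StrictMono stdCdf := fun a b hab => by
  rw [← sub_pos, ← measure_Ioc_gaussianReal a b hab.le]
  exact (gaussianReal_pos_of_isOpen isOpen_Ioo (Set.nonempty_Ioo.2 hab)).trans_le
    (measureReal_mono Set.Ioo_subset_Ioc_self)

lemma stdCdf_pos (x : ℝ) : 0 < stdCdf x :=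
  (cdf_nonneg _ (x - 1)).trans_lt (stdCdf_strictMono (by linarith))

lemma stdCdf_lt_one (x : ℝ) : stdCdf x < 1 :=
  (stdCdf_strictMono (show x < x + 1 by linarith)).trans_le (cdf_le_one _ _)

/-- A distribution function is right continuous, and its jump at a point is the mass of that point,
which vanishes here. -/
lemma continuous_stdCdf : Continuous stdCdf := by
  have := nullSingletonClass_gaussianReal (μ := 0) (v := 1) one_ne_zero
  refine continuous_iff_continuousAt.2 fun x => ?_
  rw [continuousAt_iff_continuous_left'_right']
  refine ⟨?_, ((cdf (gaussianReal 0 1)).right_continuous x).mono Set.Ioi_subset_Ici_self⟩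
  rw [stdCdf_mono.continuousWithinAt_Iio_iff_leftLim_eq]
  refine le_antisymm (stdCdf_mono.leftLim_le le_rfl) ?_
  have h := (cdf (gaussianReal 0 1)).measure_singleton x
  rw [measure_cdf, measure_singleton, eq_comm, ENNReal.ofReal_eq_zero, sub_nonpos] at h
  exact h

lemma stdQuantile_le_iff {u : ℝ} (hu : u ∈ Set.Ioo (0 : ℝ) 1) (x : ℝ) :
    stdQuantile u ≤ x ↔ u ≤ stdCdf x := by
  have hne : {x : ℝ | u ≤ stdCdf x}.Nonempty := by
    obtain ⟨y, hy⟩ := ((tendsto_cdf_atTop (gaussianReal 0 1)).eventually (lt_mem_nhds hu.2)).exists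
    exact ⟨y, hy.le⟩
  have hbdd : BddBelow {x : ℝ | u ≤ stdCdf x} := by
    obtain ⟨y, hy⟩ := ((tendsto_cdf_atBot (gaussianReal 0 1)).eventually (gt_mem_nhds hu.1)).exists
    refine ⟨y, fun z hz => ?_⟩
    by_contra hlt
    exact absurd (hz.trans (stdCdf_mono (not_le.1 hlt).le)) (not_le.2 hy)
  have hcl : IsClosed {x : ℝ | u ≤ stdCdf x} := isClosed_le continuous_const continuous_stdCdf
  exact ⟨fun h => le_trans (hcl.csInf_mem hne hbdd) (stdCdf_mono h), fun h => csInf_le hbdd h⟩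

lemma stdCdf_stdQuantile {u : ℝ} (hu : u ∈ Set.Ioo (0 : ℝ) 1) : stdCdf (stdQuantile u) = u := by
  refine le_antisymm ?_ ((stdQuantile_le_iff hu _).1 le_rfl)
  have h1 : Tendsto stdCdf (𝓝[<] (stdQuantile u)) (𝓝 (stdCdf (stdQuantile u))) :=
    continuous_stdCdf.continuousAt.mono_left nhdsWithin_le_nhds
  refine le_of_tendsto h1 ?_
  filter_upwards [self_mem_nhdsWithin] with x hx
  by_contra h
  exact absurd ((stdQuantile_le_iff hu x).2 (not_le.1 h).le) (not_le.2 hx)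

/-- For u ≤ 0 the set in the infimum is the whole line and for u ≥ 1 it is empty; `sInf` is 0 by
convention in both cases. Measurability on the whole line needs these values. -/
lemma stdQuantile_of_notMem {u : ℝ} (hu : u ∉ Set.Ioo (0 : ℝ) 1) : stdQuantile u = 0 := by
  rw [Set.mem_Ioo, not_and_or, not_lt, not_lt] at hu
  rw [stdQuantile]
  rcases hu with h | h
  · rw [show {x : ℝ | u ≤ stdCdf x} = Set.univ from
      Set.eq_univ_of_forall fun x => h.trans (stdCdf_pos x).le, Real.sInf_univ]
  · rw [show {x : ℝ | u ≤ stdCdf x} = ∅ from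
      Set.eq_empty_of_forall_notMem fun x hx => absurd (h.trans hx) (not_le.2 (stdCdf_lt_one x)),
      Real.sInf_empty]

lemma measurable_stdQuantile : Measurable stdQuantile := by
  refine measurable_of_Iic fun x => ?_
  have : stdQuantile ⁻¹' Set.Iic x =
      (Set.Ioo 0 1 ∩ Set.Iic (stdCdf x)) ∪ ((Set.Ioo 0 1)ᶜ ∩ {_u : ℝ | 0 ≤ x}) := by
    ext u
    by_cases hu : u ∈ Set.Ioo (0 : ℝ) 1
    · simp only [Set.mem_preimage, Set.mem_Iic, Set.mem_union, Set.mem_inter_iff, hu, true_and,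
        Set.mem_compl_iff, not_true, false_and, or_false]
      exact stdQuantile_le_iff hu x
    · simp only [Set.mem_preimage, Set.mem_Iic, Set.mem_union, Set.mem_inter_iff, hu, false_and,
        Set.mem_compl_iff, not_false_eq_true, true_and, false_or, Set.mem_ofPred_eq,
        stdQuantile_of_notMem hu]
  rw [this]
  exact (measurableSet_Ioo.inter measurableSet_Iic).union
    (measurableSet_Ioo.compl.inter (MeasurableSet.const _))

lemma unif_map_stdQuantile : unif.map stdQuantile = gaussianReal 0 1 := by
  have := Measure.isProbabilityMeasure_map (μ := unif) measurable_stdQuantile.aemeasurable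
  refine Measure.ext_of_Iic _ _ fun x => ?_
  rw [Measure.map_apply measurable_stdQuantile measurableSet_Iic]
  have : (stdQuantile ⁻¹' Set.Iic x : Set ℝ) =ᵐ[unif] Set.Ioc 0 (stdCdf x) := by
    filter_upwards [ae_unif_mem] with u hu
    refine propext ((stdQuantile_le_iff hu x).trans ⟨fun h => ⟨hu.1, h⟩, fun h => h.2⟩)
  rw [measure_congr this, unif_Ioc le_rfl (stdCdf_lt_one x).le, sub_zero, stdCdf, ofReal_cdf]

lemma measurePreserving_stdQuantile : MeasurePreserving stdQuantile unif (gaussianReal 0 1) :=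
  ⟨measurable_stdQuantile, unif_map_stdQuantile⟩

lemma gaussianReal_Iic (m : ℝ) {v : ℝ} (hv : 0 < v) (y : ℝ) :
    gaussianReal m v.toNNReal (Set.Iic y) = ENNReal.ofReal (stdCdf ((y - m) / Real.sqrt v)) := by
  set σ := Real.sqrt v with hσv
  have hσ : 0 < σ := Real.sqrt_pos.2 hv
  have h : (gaussianReal 0 1).map (fun x => m + σ * x) = gaussianReal m v.toNNReal := by
    rw [← Function.comp_def (fun x => m + x) (fun x => σ * x),
      ← Measure.map_map (measurable_const_add m) (measurable_const_mul σ),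
      gaussianReal_map_const_mul, gaussianReal_map_const_add]
    congr 1
    · simp
    · ext
      rw [Real.coe_toNNReal _ hv.le, mul_one]
      exact Real.sq_sqrt hv.le
  rw [← h, Measure.map_apply (by fun_prop) measurableSet_Iic, stdCdf, ofReal_cdf]
  congr 1
  ext x
  simp only [Set.mem_preimage, Set.mem_Iic]
  rw [le_div_iff₀ hσ]
  constructor <;> intro h <;> linarith

/-- Chernoff's bound with the exponential parameter z. -/
lemma gaussianReal_Ici_le {z : ℝ} (hz : 0 ≤ z) :
    (gaussianReal 0 1).real (Set.Ici z) ≤ Real.exp (-(z ^ 2 / 2)) := by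
  have h := measure_ge_le_exp_mul_mgf (μ := gaussianReal 0 1) (X := id) z hz
    (integrable_exp_mul_gaussianReal z)
  rw [mgf_id_gaussianReal, ← Real.exp_add] at h
  refine (h.trans_eq' ?_).trans_eq ?_
  · rfl
  · congr 1
    simp
    ring

lemma stdCdf_neg_le {z : ℝ} (hz : 0 ≤ z) : stdCdf (-z) ≤ Real.exp (-(z ^ 2 / 2)) := by
  refine le_trans (le_of_eq ?_) (gaussianReal_Ici_le hz)
  have h := gaussianReal_map_neg (μ := 0) (v := 1)
  rw [neg_zero] at h
  rw [stdCdf_eq, measureReal_def, measureReal_def]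
  conv_lhs => rw [← h]
  rw [Measure.map_apply measurable_neg measurableSet_Iic]
  congr 2
  ext x
  simp

lemma le_stdCdf {z : ℝ} (hz : 0 ≤ z) : 1 - Real.exp (-(z ^ 2 / 2)) ≤ stdCdf z := by
  have h := gaussianReal_Ici_le hz
  have h1 : (gaussianReal 0 1).real (Set.Ioi z) ≤ (gaussianReal 0 1).real (Set.Ici z) :=
    measureReal_mono Set.Ioi_subset_Ici_self
  rw [← Set.compl_Iic, probReal_compl_eq_one_sub measurableSet_Iic, ← stdCdf_eq] at h1
  linarith

/-- The number z with `exp (-z²/2) = c` satisfies Φ(-z) ≤ c and Φ(z) ≥ 1 - c by the Gaussian tail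
bound, so the quantile lies in [-z, z]. -/
lemma stdQuantile_sq_le {u c : ℝ} (hc : 0 < c) (h1 : c ≤ u) (h2 : u ≤ 1 - c) :
    stdQuantile u ^ 2 ≤ 2 * Real.log (1 / c) := by
  have hu : u ∈ Set.Ioo (0 : ℝ) 1 := ⟨by linarith, by linarith⟩
  have hlog : 0 ≤ Real.log (1 / c) :=
    Real.log_nonneg (by rw [le_div_iff₀ hc]; linarith)
  set z := Real.sqrt (2 * Real.log (1 / c)) with hz
  have hz0 : 0 ≤ z := Real.sqrt_nonneg _
  have hz2 : z ^ 2 = 2 * Real.log (1 / c) := Real.sq_sqrt (by positivity)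
  have hexp : Real.exp (-(z ^ 2 / 2)) = c := by
    rw [hz2, show -(2 * Real.log (1 / c) / 2) = -Real.log (1 / c) by ring, one_div, Real.log_inv,
      neg_neg, Real.exp_log hc]
  have hup : stdQuantile u ≤ z := by
    rw [stdQuantile_le_iff hu]
    have := le_stdCdf hz0
    linarith
  have hlo : -z ≤ stdQuantile u := by
    refine le_of_forall_lt fun w hw => ?_
    rw [← not_le, stdQuantile_le_iff hu, not_le]
    have := stdCdf_strictMono hw
    have := stdCdf_neg_le hz0
    linarith
  rw [← hz2]
  exact sq_le_sq' hlo hup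

end Gaussian

/-! ### The Gaussian copula -/

section Copula

lemma one_sub_sq_pos {r : ℝ} (hr : r ∈ Set.Ioo (-1 : ℝ) 1) : 0 < 1 - r ^ 2 := by
  nlinarith [hr.1, hr.2]

/-- The explicit inverse of the 2 × 2 correlation matrix turns the exponent into a rational
expression on which all later estimates rely. -/
lemma copulaDensity_eq {r : ℝ} (hr : r ∈ Set.Ioo (-1 : ℝ) 1) (u : Fin 2 → ℝ) :
    copulaDensity r u = (Real.sqrt (1 - r ^ 2))⁻¹ * Real.exp
      (-(r ^ 2 * stdQuantile (u 0) ^ 2 - 2 * r * stdQuantile (u 0) * stdQuantile (u 1) +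
        r ^ 2 * stdQuantile (u 1) ^ 2) / (2 * (1 - r ^ 2))) := by
  have h := (one_sub_sq_pos hr).ne'
  have hdet : (corrMatrix r).det = 1 - r ^ 2 := by
    rw [corrMatrix, Matrix.det_fin_two_of]; ring
  rw [copulaDensity, hdet]
  congr 2
  have hdet' : (!![1, r; r, 1] : Matrix (Fin 2) (Fin 2) ℝ).det = 1 - r ^ 2 := hdet
  rw [Matrix.inv_def, Ring.inverse_eq_inv', hdet, corrMatrix, Matrix.adjugate_fin_two_of]
  simp only [Matrix.mulVec, dotProduct, Fin.sum_univ_two, Matrix.sub_apply, Matrix.smul_apply,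
    Matrix.of_apply, Matrix.cons_val_zero, Matrix.cons_val_one, Matrix.one_apply, smul_eq_mul,
    Matrix.cons_val', Matrix.cons_val_fin_one, Fin.isValue, ↓reduceIte, zero_ne_one, one_ne_zero]
  field_simp
  ring

lemma copulaDensity_nonneg (r : ℝ) (u : Fin 2 → ℝ) : 0 ≤ copulaDensity r u := by
  unfold copulaDensity; positivity

lemma measurable_copulaDensity {r : ℝ} (hr : r ∈ Set.Ioo (-1 : ℝ) 1) :
    Measurable (copulaDensity r) := by
  rw [show copulaDensity r = _ from funext (copulaDensity_eq hr)]
  have h : ∀ i : Fin 2, Measurable fun u : Fin 2 → ℝ => stdQuantile (u i) := fun i =>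
    measurable_stdQuantile.comp (measurable_pi_apply i)
  have h0 := h 0
  have h1 := h 1
  fun_prop

lemma gaussianCopula_eq (r : ℝ) : gaussianCopula r =
    (Measure.pi fun _ : Fin 2 => unif).withDensity fun u => ENNReal.ofReal (copulaDensity r u) := by
  rw [gaussianCopula, volume_pi, Measure.restrict_pi_pi]
  rfl

lemma lintegral_pi_unif {F : (Fin 2 → ℝ) → ENNReal} (hF : Measurable F) :
    ∫⁻ u, F u ∂(Measure.pi fun _ : Fin 2 => unif) = ∫⁻ a, ∫⁻ b, F ![a, b] ∂unif ∂unif := by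
  have h := (measurePreserving_finTwoArrow unif).symm
  rw [← h.lintegral_comp hF, lintegral_prod]
  · rfl
  · exact (hF.comp (MeasurableEquiv.measurable _)).aemeasurable

lemma lintegral_gaussianCopula {r : ℝ} (hr : r ∈ Set.Ioo (-1 : ℝ) 1)
    {F : (Fin 2 → ℝ) → ENNReal} (hF : Measurable F) :
    ∫⁻ u, F u ∂(gaussianCopula r) =
      ∫⁻ a, ∫⁻ b, ENNReal.ofReal (copulaDensity r ![a, b]) * F ![a, b] ∂unif ∂unif := by
  have hm := (measurable_copulaDensity hr).ennreal_ofReal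
  rw [gaussianCopula_eq, lintegral_withDensity_eq_lintegral_mul _ hm hF,
    lintegral_pi_unif (hm.mul hF)]
  rfl

lemma copulaDensity_swap {r : ℝ} (hr : r ∈ Set.Ioo (-1 : ℝ) 1) (a b : ℝ) :
    copulaDensity r ![a, b] = copulaDensity r ![b, a] := by
  rw [copulaDensity_eq hr, copulaDensity_eq hr]
  simp only [Matrix.cons_val_zero, Matrix.cons_val_one]
  congr 3
  ring

/-- The conditional distribution of the second coordinate given the first one, on the Gaussian
scale. -/
lemma setLIntegral_copulaDensity {r : ℝ} (hr : r ∈ Set.Ioo (-1 : ℝ) 1) (a : ℝ) {S : Set ℝ}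
    (hS : MeasurableSet S) :
    ∫⁻ b in stdQuantile ⁻¹' S, ENNReal.ofReal (copulaDensity r ![a, b]) ∂unif =
      gaussianReal (r * stdQuantile a) (1 - r ^ 2).toNNReal S := by
  have hr' := one_sub_sq_pos hr
  have hv : (1 - r ^ 2).toNNReal ≠ 0 := (Real.toNNReal_pos.2 hr').ne'
  set x := stdQuantile a with hx
  let f : ℝ → ENNReal := fun z => ENNReal.ofReal ((Real.sqrt (1 - r ^ 2))⁻¹ * Real.exp
      (-(r ^ 2 * x ^ 2 - 2 * r * x * z + r ^ 2 * z ^ 2) / (2 * (1 - r ^ 2))))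
  have hf : Measurable f := by fun_prop
  calc ∫⁻ b in stdQuantile ⁻¹' S, ENNReal.ofReal (copulaDensity r ![a, b]) ∂unif
      = ∫⁻ b in stdQuantile ⁻¹' S, f (stdQuantile b) ∂unif := by
        simp only [copulaDensity_eq hr, Matrix.cons_val_zero, Matrix.cons_val_one, f, ← hx]
    _ = ∫⁻ z in S, f z ∂(gaussianReal 0 1) :=
        measurePreserving_stdQuantile.setLIntegral_comp_preimage hS hf
    _ = ∫⁻ z in S, gaussianPDF 0 1 z * f z := by
        rw [gaussianReal_of_var_ne_zero _ one_ne_zero, restrict_withDensity hS,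
          lintegral_withDensity_eq_lintegral_mul _ (measurable_gaussianPDF _ _) hf]
        rfl
    -- Completing the square: the standard Gaussian density times the copula density is the density
    -- of the conditional law N(r x, 1 - r²).
    _ = ∫⁻ z in S, gaussianPDF (r * x) (1 - r ^ 2).toNNReal z := by
        refine lintegral_congr fun z => ?_
        rw [gaussianPDF_def, gaussianPDF_def, ← ENNReal.ofReal_mul (gaussianPDFReal_nonneg _ _ _)]
        congr 1
        simp only [gaussianPDFReal, NNReal.coe_one, Real.coe_toNNReal _ hr'.le]
        rw [mul_one, Real.sqrt_mul (show (0 : ℝ) ≤ 2 * Real.pi by positivity) (1 - r ^ 2),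
          show ∀ a b c d : ℝ, a * b * (c * d) = (a * c) * (b * d) by intros; ring,
          ← Real.exp_add, ← mul_inv]
        congr 2
        field_simp
        ring
    _ = _ := (gaussianReal_apply _ hv S).symm

lemma lintegral_copulaDensity {r : ℝ} (hr : r ∈ Set.Ioo (-1 : ℝ) 1) (a : ℝ) :
    ∫⁻ b, ENNReal.ofReal (copulaDensity r ![a, b]) ∂unif = 1 := by
  have h := setLIntegral_copulaDensity hr a MeasurableSet.univ
  rw [Set.preimage_univ, Measure.restrict_univ] at h
  rw [h, measure_univ]

lemma measurable_copulaDensity_pair {r : ℝ} (hr : r ∈ Set.Ioo (-1 : ℝ) 1) :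
    Measurable fun p : ℝ × ℝ => ENNReal.ofReal (copulaDensity r ![p.1, p.2]) :=
  (measurable_copulaDensity hr).ennreal_ofReal.comp
    (MeasurableEquiv.finTwoArrow (α := ℝ)).symm.measurable

lemma lintegral_copulaDensity_mul_left {r : ℝ} (hr : r ∈ Set.Ioo (-1 : ℝ) 1) (g : ℝ → ENNReal) :
    ∫⁻ a, ∫⁻ b, ENNReal.ofReal (copulaDensity r ![a, b]) * g a ∂unif ∂unif =
      ∫⁻ a, g a ∂unif := by
  refine lintegral_congr fun a => ?_
  have hm := (measurable_copulaDensity_pair hr).comp (measurable_prodMk_left (x := a))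
  exact (lintegral_mul_const _ hm).trans (by
    simp only [Function.comp_def, lintegral_copulaDensity hr, one_mul])

lemma lintegral_copulaDensity_mul_right {r : ℝ} (hr : r ∈ Set.Ioo (-1 : ℝ) 1) {g : ℝ → ENNReal}
    (hg : Measurable g) :
    ∫⁻ a, ∫⁻ b, ENNReal.ofReal (copulaDensity r ![a, b]) * g b ∂unif ∂unif =
      ∫⁻ b, g b ∂unif := by
  have hm : Measurable fun p : ℝ × ℝ => ENNReal.ofReal (copulaDensity r ![p.1, p.2]) * g p.2 :=
    (measurable_copulaDensity_pair hr).mul (hg.comp measurable_snd)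
  rw [lintegral_lintegral_swap hm.aemeasurable, ← lintegral_copulaDensity_mul_left hr g]
  simp_rw [copulaDensity_swap hr]

/-- For fixed first coordinate the density integrates to 1 in the second one, since it represents a
conditional law; the symmetry of the density handles the other margin. -/
lemma measurePreserving_eval_gaussianCopula {r : ℝ} (hr : r ∈ Set.Ioo (-1 : ℝ) 1) (i : Fin 2) :
    MeasurePreserving (fun u => u i) (gaussianCopula r) unif := by
  refine ⟨measurable_pi_apply i, Measure.ext fun S hS => ?_⟩
  have hSm : Measurable (S.indicator (1 : ℝ → ENNReal)) := measurable_one.indicator hS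
  rw [← lintegral_indicator_one hS, lintegral_map hSm (measurable_pi_apply i),
    lintegral_gaussianCopula hr (F := fun u => S.indicator 1 (u i))
      (hSm.comp (measurable_pi_apply i)), ← lintegral_indicator_one hS]
  match i with
  | 0 => exact lintegral_copulaDensity_mul_left hr _
  | 1 => exact lintegral_copulaDensity_mul_right hr hSm

lemma isProbabilityMeasure_gaussianCopula {r : ℝ} (hr : r ∈ Set.Ioo (-1 : ℝ) 1) :
    IsProbabilityMeasure (gaussianCopula r) := by
  have h := measurePreserving_eval_gaussianCopula hr 0
  exact ⟨by rw [← Set.preimage_univ (f := fun u : Fin 2 → ℝ => u 0),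
    h.measure_preimage MeasurableSet.univ.nullMeasurableSet, measure_univ]⟩

/-- The Gaussian copula of a lower orthant. -/
lemma gaussianCopula_orthant {r : ℝ} (hr : r ∈ Set.Ioo (-1 : ℝ) 1) {a b : ℝ}
    (ha : a ∈ Set.Ioo (0 : ℝ) 1) (hb : b ∈ Set.Ioo (0 : ℝ) 1) :
    gaussianCopula r {u | u 0 ≤ a ∧ u 1 ≤ b} =
      ∫⁻ x in Set.Iic (stdQuantile a),
        ENNReal.ofReal (stdCdf ((stdQuantile b - r * x) / Real.sqrt (1 - r ^ 2)))
          ∂(gaussianReal 0 1) := by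
  have hS : MeasurableSet {u : Fin 2 → ℝ | u 0 ≤ a ∧ u 1 ≤ b} :=
    (measurableSet_le (measurable_pi_apply 0) measurable_const).inter
      (measurableSet_le (measurable_pi_apply 1) measurable_const)
  have hq : ∀ {c : ℝ}, c ∈ Set.Ioo (0 : ℝ) 1 → ∀ᵐ v ∂unif, (v ≤ c ↔ stdQuantile v ≤ stdQuantile c) := by
    intro c hc
    filter_upwards [ae_unif_mem] with v hv
    rw [stdQuantile_le_iff hv, stdCdf_stdQuantile hc]
  have hf : Measurable fun x => ENNReal.ofReal
      (stdCdf ((stdQuantile b - r * x) / Real.sqrt (1 - r ^ 2))) :=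
    (continuous_stdCdf.measurable.comp (by fun_prop)).ennreal_ofReal
  rw [← lintegral_indicator_one hS, lintegral_gaussianCopula hr (measurable_one.indicator hS),
    ← measurePreserving_stdQuantile.setLIntegral_comp_preimage measurableSet_Iic hf,
    ← lintegral_indicator (measurable_stdQuantile measurableSet_Iic)]
  refine lintegral_congr_ae ?_
  filter_upwards [hq ha] with v hv
  by_cases h : v ≤ a
  · rw [Set.indicator_of_mem (show v ∈ stdQuantile ⁻¹' Set.Iic (stdQuantile a) from hv.1 h),
      ← gaussianReal_Iic _ (one_sub_sq_pos hr),
      ← setLIntegral_copulaDensity hr v measurableSet_Iic,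
      ← lintegral_indicator (measurable_stdQuantile measurableSet_Iic)]
    refine lintegral_congr_ae ?_
    filter_upwards [hq hb] with w hw
    by_cases h' : w ≤ b
    · rw [Set.indicator_of_mem (show w ∈ stdQuantile ⁻¹' Set.Iic (stdQuantile b) from hw.1 h')]
      simp [h, h']
    · rw [Set.indicator_of_notMem
        (show w ∉ stdQuantile ⁻¹' Set.Iic (stdQuantile b) from fun hh => h' (hw.2 hh))]
      simp [h']
  · rw [Set.indicator_of_notMem
      (show v ∉ stdQuantile ⁻¹' Set.Iic (stdQuantile a) from fun hh => h (hv.2 hh))]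
    simp [h]

end Copula

/-! ### Strict monotonicity of the Gaussian copula in its correlation -/

section CopulaOrthant

lemma integrable_stdCdf_affine (a b : ℝ) :
    Integrable (fun x => stdCdf (a + b * x)) (gaussianReal 0 1) :=
  Integrable.of_bound (continuous_stdCdf.comp (by fun_prop)).aestronglyMeasurable 1
    (Eventually.of_forall fun x => by
      rw [Real.norm_eq_abs, abs_of_nonneg (stdCdf_pos _).le]
      exact (stdCdf_lt_one _).le)

/-- The law of total probability: the integrand is the conditional probability that the second
Gaussian coordinate is at most y given the first, and the second margin is standard Gaussian for
every r. -/
lemma integral_stdCdf_conditional {r : ℝ} (hr : r ∈ Set.Ioo (-1 : ℝ) 1) (y : ℝ) :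
    ∫ x, stdCdf ((y - r * x) / Real.sqrt (1 - r ^ 2)) ∂(gaussianReal 0 1) = stdCdf y := by
  have hr' := one_sub_sq_pos hr
  have hf : Measurable fun x => ENNReal.ofReal
      (stdCdf ((y - r * x) / Real.sqrt (1 - r ^ 2))) :=
    (continuous_stdCdf.measurable.comp (by fun_prop)).ennreal_ofReal
  have hS := measurable_stdQuantile (measurableSet_Iic (a := y))
  rw [integral_eq_lintegral_of_nonneg_ae (Eventually.of_forall fun x => (stdCdf_pos _).le)
    (continuous_stdCdf.comp (by fun_prop)).aestronglyMeasurable,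
    ← measurePreserving_stdQuantile.lintegral_comp hf]
  simp_rw [← gaussianReal_Iic _ hr', ← setLIntegral_copulaDensity hr _ measurableSet_Iic,
    ← lintegral_indicator hS]
  have h := lintegral_copulaDensity_mul_right hr (measurable_one.indicator hS)
  have h2 : ∀ a b, ENNReal.ofReal (copulaDensity r ![a, b]) *
      (stdQuantile ⁻¹' Set.Iic y).indicator 1 b = (stdQuantile ⁻¹' Set.Iic y).indicator
        (fun b => ENNReal.ofReal (copulaDensity r ![a, b])) b := by
    intro a b
    by_cases hb : b ∈ stdQuantile ⁻¹' Set.Iic y <;> simp [hb]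
  simp_rw [h2] at h
  rw [h, lintegral_indicator_one hS, ← Measure.map_apply measurable_stdQuantile measurableSet_Iic,
    unif_map_stdQuantile, stdCdf_eq]
  rfl

/-- To the left of the crossing the integral only collects negative values. To the right of it,
since the total is 0, the integral is minus that of the positive values beyond x. -/
lemma setIntegral_neg_of_single_crossing {D : ℝ → ℝ} (hD : Integrable D (gaussianReal 0 1))
    (h0 : ∫ x, D x ∂(gaussianReal 0 1) = 0) {t : ℝ} (hneg : ∀ x < t, D x < 0)
    (hpos : ∀ x, t < x → 0 < D x) (x : ℝ) : ∫ z in Set.Iic x, D z ∂(gaussianReal 0 1) < 0 := by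
  have := nullSingletonClass_gaussianReal (μ := 0) (v := 1) one_ne_zero
  have key : ∀ {f : ℝ → ℝ} {S : Set ℝ}, Integrable f (gaussianReal 0 1) → IsOpen S → S.Nonempty →
      (∀ x ∈ S, 0 < f x) → 0 < ∫ z in S, f z ∂(gaussianReal 0 1) := by
    intro f S hf hS hne hfS
    rw [setIntegral_pos_iff_support_of_nonneg_ae _ hf.integrableOn]
    · rw [Set.inter_eq_right.2 (show S ⊆ Function.support f from fun z hz => (hfS z hz).ne')]
      have := gaussianReal_pos_of_isOpen hS hne
      rw [measureReal_def, ENNReal.toReal_pos_iff] at this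
      exact this.1
    · exact (ae_restrict_iff' hS.measurableSet).2 (Eventually.of_forall fun z hz => (hfS z hz).le)
  rcases le_or_gt x t with h | h
  · have := key hD.neg isOpen_Iio (Set.nonempty_Iio (a := x))
      fun z hz => neg_pos.2 (hneg z (lt_of_lt_of_le hz h))
    simp only [Pi.neg_apply, integral_neg] at this
    rw [integral_Iic_eq_integral_Iio]
    linarith
  · have h1 := key hD isOpen_Ioi (Set.nonempty_Ioi (a := x)) fun z hz => hpos z (h.trans hz)
    have h2 := integral_add_compl (measurableSet_Iic (a := x)) hD
    rw [Set.compl_Iic] at h2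
    linarith

lemma div_sqrt_one_sub_sq_lt {r s : ℝ} (hr : r ∈ Set.Ioo (-1 : ℝ) 1) (hs : s ∈ Set.Ioo (-1 : ℝ) 1)
    (hrs : r < s) : r / Real.sqrt (1 - r ^ 2) < s / Real.sqrt (1 - s ^ 2) := by
  have hr' := Real.sqrt_pos.2 (one_sub_sq_pos hr)
  have hs' := Real.sqrt_pos.2 (one_sub_sq_pos hs)
  rw [div_lt_div_iff₀ hr' hs']
  rcases le_or_gt 0 r with h | h
  · have : Real.sqrt (1 - s ^ 2) ≤ Real.sqrt (1 - r ^ 2) := Real.sqrt_le_sqrt (by nlinarith)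
    nlinarith
  · rcases le_or_gt 0 s with h' | h'
    · nlinarith
    · have : Real.sqrt (1 - r ^ 2) ≤ Real.sqrt (1 - s ^ 2) := Real.sqrt_le_sqrt (by nlinarith)
      nlinarith

/-- The Gaussian copula of a lower orthant is strictly increasing in the correlation. -/
lemma gaussianCopula_orthant_lt {r s : ℝ} (hr : r ∈ Set.Ioo (-1 : ℝ) 1)
    (hs : s ∈ Set.Ioo (-1 : ℝ) 1) (hrs : r < s) {a b : ℝ}
    (ha : a ∈ Set.Ioo (0 : ℝ) 1) (hb : b ∈ Set.Ioo (0 : ℝ) 1) :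
    (gaussianCopula r).real {u | u 0 ≤ a ∧ u 1 ≤ b} <
      (gaussianCopula s).real {u | u 0 ≤ a ∧ u 1 ≤ b} := by
  set y := stdQuantile b
  have haff : ∀ r x : ℝ, (y - r * x) / Real.sqrt (1 - r ^ 2) =
      y / Real.sqrt (1 - r ^ 2) + (-(r / Real.sqrt (1 - r ^ 2))) * x := fun r x => by ring
  have hint : ∀ r : ℝ, Integrable (fun x => stdCdf ((y - r * x) / Real.sqrt (1 - r ^ 2)))
      (gaussianReal 0 1) := fun r => by
    simp_rw [haff]
    exact integrable_stdCdf_affine _ _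
  have hreal : ∀ {r : ℝ}, r ∈ Set.Ioo (-1 : ℝ) 1 →
      (gaussianCopula r).real {u | u 0 ≤ a ∧ u 1 ≤ b} =
        ∫ x in Set.Iic (stdQuantile a), stdCdf ((y - r * x) / Real.sqrt (1 - r ^ 2))
          ∂(gaussianReal 0 1) := fun {r} hr => by
    rw [measureReal_def, gaussianCopula_orthant hr ha hb,
      integral_eq_lintegral_of_nonneg_ae (Eventually.of_forall fun x => (stdCdf_pos _).le)
        (hint r).integrableOn.aestronglyMeasurable]
  rw [hreal hr, hreal hs, ← sub_neg, ← integral_sub (hint r).integrableOn (hint s).integrableOn]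
  set α := r / Real.sqrt (1 - r ^ 2) with hα
  set β := s / Real.sqrt (1 - s ^ 2) with hβ
  set γ := y / Real.sqrt (1 - s ^ 2) - y / Real.sqrt (1 - r ^ 2) with hγ
  have hlt : 0 < β - α := sub_pos.2 (div_sqrt_one_sub_sq_lt hr hs hrs)
  -- The conditional probabilities for the two correlations compose Φ with affine functions of
  -- slopes -α > -β. Their difference therefore changes sign once, where the two lines meet, at γ /
  -- (β - α).
  refine setIntegral_neg_of_single_crossing (D := fun x =>
    stdCdf ((y - r * x) / Real.sqrt (1 - r ^ 2)) - stdCdf ((y - s * x) / Real.sqrt (1 - s ^ 2))) (t := γ / (β - α)) ((hint r).sub (hint s)) ?_ ?_ ?_ _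
  · rw [integral_sub (hint r) (hint s), integral_stdCdf_conditional hr,
      integral_stdCdf_conditional hs, sub_self]
  · intro x hx
    rw [sub_neg]
    refine stdCdf_strictMono ?_
    rw [lt_div_iff₀ hlt] at hx
    rw [haff, haff, ← hα, ← hβ]
    linarith
  · intro x hx
    rw [sub_pos]
    refine stdCdf_strictMono ?_
    rw [div_lt_iff₀ hlt] at hx
    rw [haff, haff, ← hα, ← hβ]
    linarith

end CopulaOrthant

/-! ### The conditional mass function -/

section CondPmf

/-- The rectangle of the noise values that give the observation `y` when the latent vector is
`s`. -/
def rect (y : Fin 2 → ℕ) (s : Fin 2 → ℝ) : Set (Fin 2 → ℝ) :=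
  Set.pi Set.univ fun i => Set.Ioc (margCdfLeft i (s i) (y i)) (margCdf i (s i) (y i))

lemma measurableSet_rect (y : Fin 2 → ℕ) (s : Fin 2 → ℝ) : MeasurableSet (rect y s) :=
  MeasurableSet.univ_pi fun _ => measurableSet_Ioc

/-- The rectangle lies in the closed unit square, and its sides on the boundary are null, so
Lebesgue measure and the product of uniform laws agree on it. -/
lemma restrict_rect (y : Fin 2 → ℕ) (s : Fin 2 → ℝ) :
    (volume : Measure (Fin 2 → ℝ)).restrict (rect y s) =
      (Measure.pi fun _ : Fin 2 => unif).restrict (rect y s) := by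
  rw [rect, Measure.restrict_pi_pi, volume_pi, Measure.restrict_pi_pi]
  congr 1
  ext1 i
  rw [unif, Measure.restrict_congr_set Ioo_ae_eq_Ioc, Measure.restrict_restrict measurableSet_Ioc,
    Set.inter_eq_left.2 (Set.Ioc_subset_Ioc (margCdfLeft_nonneg _ _ _) (margCdf_le_one _ _ _))]

lemma condPmf_eq_setIntegral (r : ℝ) (y : Fin 2 → ℕ) (s : Fin 2 → ℝ) :
    condPmf r y s = ∫ u in rect y s, copulaDensity r u ∂(Measure.pi fun _ : Fin 2 => unif) := by
  rw [← restrict_rect]; rfl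

lemma condPmf_eq_rect {r : ℝ} (hr : r ∈ Set.Ioo (-1 : ℝ) 1) (y : Fin 2 → ℕ) (s : Fin 2 → ℝ) :
    condPmf r y s = (gaussianCopula r).real (rect y s) := by
  rw [condPmf_eq_setIntegral, integral_eq_lintegral_of_nonneg_ae
    (Eventually.of_forall fun u => copulaDensity_nonneg r u)
    (measurable_copulaDensity hr).aestronglyMeasurable, measureReal_def, gaussianCopula_eq,
    withDensity_apply _ (measurableSet_rect y s)]

lemma ae_gaussianCopula_of_unif {r : ℝ} (hr : r ∈ Set.Ioo (-1 : ℝ) 1) {p : ℝ → Prop} (i : Fin 2)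
    (hp : ∀ᵐ v ∂unif, p v) : ∀ᵐ u ∂(gaussianCopula r), p (u i) :=
  (measurePreserving_eval_gaussianCopula hr i).quasiMeasurePreserving.ae hp

lemma ae_unif_ne (c : ℝ) : ∀ᵐ v ∂unif, v ≠ c := by
  refine ae_restrict_of_ae ?_
  simp [ae_iff]

/-- The observation rule uses a closed condition at the threshold `1 - logistic s` whereas the
rectangle has half-open sides; the threshold itself, a null value, has to be excluded. -/
lemma bernoulliQuantile_eq_iff {s u : ℝ} (hu : u ∈ Set.Ioo (0 : ℝ) 1) (hne : u ≠ 1 - logistic s)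
    (k : ℕ) :
    bernoulliQuantile s u = k ↔ u ∈ Set.Ioc (margCdfLeft 0 s k) (margCdf 0 s k) := by
  have hl := logistic_pos s
  have hl1 := logistic_lt_one s
  unfold bernoulliQuantile
  rcases k with _ | k
  · rw [margCdfLeft_zero, margCdf_zero_eq, if_pos rfl, Set.mem_Ioc]
    split_ifs with h
    · simp only [false_iff, not_and, not_le]
      exact fun _ => lt_of_le_of_ne h hne.symm
    · simp only [true_iff]
      exact ⟨hu.1, (not_le.1 h).le⟩
  · rw [margCdfLeft_succ, margCdf_zero_eq, margCdf_zero_eq, if_neg k.succ_ne_zero, Set.mem_Ioc]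
    rcases k with _ | k
    · rw [if_pos rfl]
      split_ifs with h
      · simp only [zero_add, true_iff]
        exact ⟨lt_of_le_of_ne h hne.symm, hu.2.le⟩
      · simp only [false_iff, not_and]
        exact fun h' => absurd h'.le h
    · rw [if_neg k.succ_ne_zero]
      constructor
      · split_ifs <;> intro h <;> simp at h
      · rintro ⟨h1, h2⟩
        linarith

lemma ae_observe_eq_iff {r : ℝ} (hr : r ∈ Set.Ioo (-1 : ℝ) 1) (s : Fin 2 → ℝ) :
    ∀ᵐ u ∂(gaussianCopula r), ∀ y, observe s u = y ↔ u ∈ rect y s := by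
  filter_upwards [ae_gaussianCopula_of_unif hr 0 ae_unif_mem,
    ae_gaussianCopula_of_unif hr 1 ae_unif_mem,
    ae_gaussianCopula_of_unif hr 0 (ae_unif_ne (1 - logistic (s 0)))] with u h0 h1 hne y
  rw [observe_eq, rect, Set.mem_univ_pi, Fin.forall_fin_two, ← bernoulliQuantile_eq_iff h0 hne,
    ← poissonQuantile_eq_iff h1.1 h1.2]
  constructor
  · rintro rfl; exact ⟨rfl, rfl⟩
  · rintro ⟨h, h'⟩
    ext i
    fin_cases i
    · exact h
    · exact h'

lemma measurable_observe_right (s : Fin 2 → ℝ) : Measurable (observe s) := by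
  have h := measurable_observe.comp (measurable_prodMk_left (x := s))
  simpa only [Function.comp_def] using h

lemma gaussianCopula_observe {r : ℝ} (hr : r ∈ Set.Ioo (-1 : ℝ) 1) (y : Fin 2 → ℕ)
    (s : Fin 2 → ℝ) : (gaussianCopula r).map (observe s) {y} = ENNReal.ofReal (condPmf r y s) := by
  have := isProbabilityMeasure_gaussianCopula hr
  rw [condPmf_eq_rect hr, ofReal_measureReal,
    Measure.map_apply (measurable_observe_right s) (MeasurableSet.singleton y)]
  refine measure_congr ?_
  filter_upwards [ae_observe_eq_iff hr s] with u hu using propext (hu y)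

lemma lintegral_observe {r : ℝ} (hr : r ∈ Set.Ioo (-1 : ℝ) 1) (s : Fin 2 → ℝ)
    (φ : (Fin 2 → ℕ) → ENNReal) :
    ∫⁻ u, φ (observe s u) ∂(gaussianCopula r) = ∑' y, ENNReal.ofReal (condPmf r y s) * φ y := by
  have h := lintegral_map (μ := gaussianCopula r) (f := φ) (measurable_of_countable φ)
    (measurable_observe_right s)
  rw [← h, lintegral_countable']
  congr 1
  ext y
  rw [mul_comm, gaussianCopula_observe hr]

lemma tsum_condPmf {r : ℝ} (hr : r ∈ Set.Ioo (-1 : ℝ) 1) (s : Fin 2 → ℝ) :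
    ∑' y, ENNReal.ofReal (condPmf r y s) = 1 := by
  have := isProbabilityMeasure_gaussianCopula hr
  have h := lintegral_observe hr s fun _ => 1
  simpa using h.symm

/-- At y = (0,0) both left limits vanish, so the rectangle is a lower orthant up to null sets. Its
corner is interior to the unit square whatever s, hence the copula is strictly monotone there. -/
lemma condPmf_zero_lt {r r' : ℝ} (hr : r ∈ Set.Ioo (-1 : ℝ) 1) (hr' : r' ∈ Set.Ioo (-1 : ℝ) 1)
    (h : r < r') (s : Fin 2 → ℝ) : condPmf r 0 s < condPmf r' 0 s := by
  have ha : margCdf 0 (s 0) 0 ∈ Set.Ioo (0 : ℝ) 1 := by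
    rw [margCdf_zero_eq, if_pos rfl]
    exact ⟨sub_pos.2 (logistic_lt_one _), by linarith [logistic_pos (s 0)]⟩
  have hb : margCdf 1 (s 1) 0 ∈ Set.Ioo (0 : ℝ) 1 := by
    have h1 := margCdf_le_one 1 (s 1) 1
    have h2 := margPmf_one_pos (s 1) 1
    have h3 := margPmf_one_pos (s 1) 0
    rw [margCdf, Finset.sum_range_succ] at h1
    rw [margCdf]
    simp only [zero_add, Finset.sum_range_one] at h1 ⊢
    exact ⟨h3, by linarith⟩
  have heq : ∀ {r : ℝ}, r ∈ Set.Ioo (-1 : ℝ) 1 → condPmf r 0 s =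
      (gaussianCopula r).real {u | u 0 ≤ margCdf 0 (s 0) 0 ∧ u 1 ≤ margCdf 1 (s 1) 0} := by
    intro r hr
    rw [condPmf_eq_rect hr]
    refine measureReal_congr ?_
    filter_upwards [ae_gaussianCopula_of_unif hr 0 ae_unif_mem,
      ae_gaussianCopula_of_unif hr 1 ae_unif_mem] with u h0 h1
    refine propext ?_
    change u ∈ rect 0 s ↔ _
    rw [rect, Set.mem_univ_pi, Fin.forall_fin_two]
    simp only [Pi.zero_apply, margCdfLeft_zero, Set.mem_Ioc, h0.1, h1.1, true_and]
    rfl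
  rw [heq hr, heq hr']
  exact gaussianCopula_orthant_lt hr hr' h ha hb

lemma condPmf_zero_injOn (s : Fin 2 → ℝ) :
    Set.InjOn (fun r => condPmf r 0 s) (Set.Ioo (-1 : ℝ) 1) :=
  StrictMonoOn.injOn fun _ hr _ hr' h => condPmf_zero_lt hr hr' h s

lemma condPmf_nonneg (r : ℝ) (y : Fin 2 → ℕ) (s : Fin 2 → ℝ) : 0 ≤ condPmf r y s :=
  integral_nonneg fun u => copulaDensity_nonneg r u

lemma condPmf_le_one {r : ℝ} (hr : r ∈ Set.Ioo (-1 : ℝ) 1) (y : Fin 2 → ℕ) (s : Fin 2 → ℝ) :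
    condPmf r y s ≤ 1 := by
  have := isProbabilityMeasure_gaussianCopula hr
  rw [condPmf_eq_rect hr]
  exact measureReal_le_one

/-! ### A lower bound on the conditional mass function -/

lemma copulaDensity_ge {r : ℝ} (hr : r ∈ Set.Ioo (-1 : ℝ) 1) (u : Fin 2 → ℝ) :
    Real.exp (-(stdQuantile (u 0) ^ 2 + stdQuantile (u 1) ^ 2) / (1 - r ^ 2)) ≤
      copulaDensity r u := by
  have hr' := one_sub_sq_pos hr
  rw [copulaDensity_eq hr]
  have h1 : 1 ≤ (Real.sqrt (1 - r ^ 2))⁻¹ := by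
    rw [one_le_inv₀ (Real.sqrt_pos.2 hr')]
    exact Real.sqrt_le_one.2 (by nlinarith)
  refine le_trans ?_ (le_mul_of_one_le_left (Real.exp_pos _).le h1)
  rw [Real.exp_le_exp, ← div_div, div_le_div_iff_of_pos_right hr']
  set x := stdQuantile (u 0)
  set z := stdQuantile (u 1)
  nlinarith [sq_nonneg (r * x - z), sq_nonneg (r * z - x), sq_nonneg (x + r * z),
    sq_nonneg (z + r * x), sq_nonneg (x - z), sq_nonneg (x + z), sq_nonneg x, sq_nonneg z,
    mul_nonneg hr'.le (sq_nonneg x), mul_nonneg hr'.le (sq_nonneg z)]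

/-- Remove a quarter of the length `p i` at both ends of each side. On what remains, of volume ∏
p_i/2, each coordinate is at distance at least p_i/4 from 0 and 1, so the Gaussian quantiles, and
with them the density, are controlled by log(4/p_i). -/
lemma condPmf_ge {r : ℝ} (hr : r ∈ Set.Ioo (-1 : ℝ) 1) {y : Fin 2 → ℕ} {s : Fin 2 → ℝ}
    (hp : ∀ i, 0 < margPmf i (s i) (y i)) :
    Real.exp (-(2 * ∑ i, Real.log (4 / margPmf i (s i) (y i))) / (1 - r ^ 2)) *
      ∏ i, (margPmf i (s i) (y i) / 2) ≤ condPmf r y s := by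
  have hr' := one_sub_sq_pos hr
  have := isProbabilityMeasure_gaussianCopula hr
  set p : Fin 2 → ℝ := fun i => margPmf i (s i) (y i) with hpdef
  have hgap : ∀ i, margCdf i (s i) (y i) - margCdfLeft i (s i) (y i) = p i :=
    fun i => margCdf_sub_margCdfLeft _ _ _
  set S : Set (Fin 2 → ℝ) := Set.pi Set.univ fun i =>
    Set.Ioc (margCdfLeft i (s i) (y i) + p i / 4) (margCdf i (s i) (y i) - p i / 4) with hS
  have hSm : MeasurableSet S := MeasurableSet.univ_pi fun _ => measurableSet_Ioc
  have hSr : S ⊆ rect y s := Set.pi_mono fun i _ =>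
    Set.Ioc_subset_Ioc (by linarith [hp i]) (by linarith [hp i])
  rw [condPmf_eq_rect hr]
  refine le_trans ?_ (measureReal_mono hSr)
  rw [measureReal_def, ← ENNReal.ofReal_le_iff_le_toReal (measure_ne_top _ _), gaussianCopula_eq,
    withDensity_apply _ hSm, ENNReal.ofReal_mul (Real.exp_pos _).le]
  have hvol : ENNReal.ofReal (∏ i, (p i / 2)) = (Measure.pi fun _ : Fin 2 => unif) S := by
    rw [hS, Measure.pi_pi, ENNReal.ofReal_prod_of_nonneg fun i _ => by linarith [hp i]]
    refine Finset.prod_congr rfl fun i _ => ?_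
    have := margCdfLeft_nonneg i (s i) (y i)
    have := margCdf_le_one i (s i) (y i)
    rw [unif_Ioc (by linarith [hp i]) (by linarith [hp i])]
    congr 1
    linarith [hgap i]
  rw [hvol, ← setLIntegral_const]
  refine setLIntegral_mono' hSm fun u hu => ENNReal.ofReal_le_ofReal ?_
  refine le_trans ?_ (copulaDensity_ge hr u)
  rw [Real.exp_le_exp, div_le_div_iff_of_pos_right hr', neg_le_neg_iff, Fin.sum_univ_two, mul_add]
  have hq : ∀ i, stdQuantile (u i) ^ 2 ≤ 2 * Real.log (4 / p i) := by
    intro i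
    have hui := Set.mem_univ_pi.1 hu i
    have := margCdfLeft_nonneg i (s i) (y i)
    have := margCdf_le_one i (s i) (y i)
    have h := stdQuantile_sq_le (u := u i) (c := p i / 4) (by linarith [hp i])
      (by linarith [hui.1]) (by linarith [hui.2])
    rwa [one_div_div] at h
  exact add_le_add (hq 0) (hq 1)

lemma condPmf_pos {r : ℝ} (hr : r ∈ Set.Ioo (-1 : ℝ) 1) {y : Fin 2 → ℕ} {s : Fin 2 → ℝ}
    (hp : ∀ i, 0 < margPmf i (s i) (y i)) : 0 < condPmf r y s :=
  lt_of_lt_of_le (mul_pos (Real.exp_pos _) (Finset.prod_pos fun i _ => half_pos (hp i)))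
    (condPmf_ge hr hp)

lemma abs_log_condPmf_le {r : ℝ} (hr : r ∈ Set.Ioo (-1 : ℝ) 1) {y : Fin 2 → ℕ} {s : Fin 2 → ℝ}
    (hp : ∀ i, 0 < margPmf i (s i) (y i)) :
    |Real.log (condPmf r y s)| ≤
      (1 + 2 / (1 - r ^ 2)) * ∑ i, Real.log (4 / margPmf i (s i) (y i)) := by
  have hr' := one_sub_sq_pos hr
  rw [abs_of_nonpos (Real.log_nonpos (condPmf_nonneg _ _ _) (condPmf_le_one hr _ _)), neg_le]
  have h := Real.log_le_log
    (mul_pos (Real.exp_pos _) (Finset.prod_pos fun i _ => half_pos (hp i))) (condPmf_ge hr hp)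
  rw [Real.log_mul (Real.exp_pos _).ne' (Finset.prod_pos fun i _ => half_pos (hp i)).ne',
    Real.log_exp, Real.log_prod fun i _ => (half_pos (hp i)).ne'] at h
  refine le_trans ?_ h
  have h2 : ∀ i, -Real.log (4 / margPmf i (s i) (y i)) ≤ Real.log (margPmf i (s i) (y i) / 2) := by
    intro i
    rw [← Real.log_inv, inv_div]
    exact Real.log_le_log (by linarith [hp i]) (by linarith [hp i])
  have h3 := Finset.sum_le_sum fun i (_ : i ∈ Finset.univ) => h2 i
  rw [Finset.sum_neg_distrib] at h3
  calc _ = -(2 * ∑ i, Real.log (4 / margPmf i (s i) (y i))) / (1 - r ^ 2) +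
        -∑ i, Real.log (4 / margPmf i (s i) (y i)) := by field_simp; ring
    _ ≤ _ := by gcongr

/-! ### Continuity of the conditional mass function -/

/-- The exponent bound reduces to 4 r x z ≤ (1 + r²)(x² + z²). Only the prefactor of the resulting
bound depends on r, so it serves as a dominating function locally uniformly in r. -/
lemma copulaDensity_le {r : ℝ} (hr : r ∈ Set.Ioo (-1 : ℝ) 1) (u : Fin 2 → ℝ) :
    copulaDensity r u ≤ (Real.sqrt (1 - r ^ 2))⁻¹ *
      (Real.exp (stdQuantile (u 0) ^ 2 / 4) * Real.exp (stdQuantile (u 1) ^ 2 / 4)) := by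
  have hr' := one_sub_sq_pos hr
  rw [copulaDensity_eq hr, ← Real.exp_add]
  gcongr
  rw [div_le_iff₀ (by positivity)]
  set x := stdQuantile (u 0)
  set z := stdQuantile (u 1)
  have h1 : 0 ≤ 1 + r := by linarith [hr.1]
  have h2 : 0 ≤ 1 - r := by linarith [hr.2]
  nlinarith [mul_nonneg (sq_nonneg (1 + r)) (sq_nonneg (x - z)),
    mul_nonneg (sq_nonneg (1 - r)) (sq_nonneg (x + z))]

/-- On the Gaussian scale this is the integral of exp(z²/4 - z²/2), which converges. -/
lemma integrable_exp_sq_stdQuantile :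
    Integrable (fun u => Real.exp (stdQuantile u ^ 2 / 4)) unif := by
  have hm : Measurable fun x : ℝ => Real.exp (x ^ 2 / 4) := by fun_prop
  refine (measurePreserving_stdQuantile.integrable_comp hm.aestronglyMeasurable).2 ?_
  rw [gaussianReal_of_var_ne_zero _ one_ne_zero,
    integrable_withDensity_iff (measurable_gaussianPDF _ _)
      (Eventually.of_forall fun x => gaussianPDF_lt_top)]
  have h := (integrable_exp_neg_mul_sq (b := 1 / 4) (by norm_num)).const_mul
    (Real.sqrt (2 * Real.pi * 1))⁻¹
  refine h.congr (Eventually.of_forall fun x => ?_)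
  simp only [toReal_gaussianPDF, gaussianPDFReal, NNReal.coe_one]
  rw [mul_left_comm, ← Real.exp_add]
  congr 2
  ring

lemma continuousAt_copulaDensity {r : ℝ} (hr : r ∈ Set.Ioo (-1 : ℝ) 1) (u : Fin 2 → ℝ) :
    ContinuousAt (fun r => copulaDensity r u) r := by
  have hev : (fun r => copulaDensity r u) =ᶠ[𝓝 r] fun r => (Real.sqrt (1 - r ^ 2))⁻¹ * Real.exp
      (-(r ^ 2 * stdQuantile (u 0) ^ 2 - 2 * r * stdQuantile (u 0) * stdQuantile (u 1) +
        r ^ 2 * stdQuantile (u 1) ^ 2) / (2 * (1 - r ^ 2))) := by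
    filter_upwards [isOpen_Ioo.mem_nhds hr] with r hr using copulaDensity_eq hr u
  refine ContinuousAt.congr ?_ hev.symm
  have h := one_sub_sq_pos hr
  have h1 := (Real.sqrt_pos.2 h).ne'
  refine ContinuousAt.mul (ContinuousAt.inv₀ (by fun_prop) h1)
    (Real.continuous_exp.continuousAt.comp (ContinuousAt.div (by fun_prop) (by fun_prop) ?_))
  positivity

/-- The edges move continuously with s, so for a point that is on none of the edge lines membership
is locally constant. -/
lemma eventually_mem_rect_iff (y : Fin 2 → ℕ) (s u : Fin 2 → ℝ)
    (hu : ∀ i, u i ≠ margCdfLeft i (s i) (y i) ∧ u i ≠ margCdf i (s i) (y i)) :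
    ∀ᶠ s' in 𝓝 s, (u ∈ rect y s' ↔ u ∈ rect y s) := by
  have key : ∀ {f : ℝ → ℝ} (_ : Continuous f) (i : Fin 2), u i ≠ f (s i) →
      ∀ᶠ s' : Fin 2 → ℝ in 𝓝 s, (f (s' i) < u i ↔ f (s i) < u i) ∧
        (u i ≤ f (s' i) ↔ u i ≤ f (s i)) := by
    intro f hf i hne
    have hc : Tendsto (fun s' : Fin 2 → ℝ => f (s' i)) (𝓝 s) (𝓝 (f (s i))) :=
      (hf.comp (continuous_apply i)).tendsto s
    rcases lt_or_gt_of_ne hne with h | h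
    · filter_upwards [hc.eventually (lt_mem_nhds h)] with s' hs'
      simp only [h.not_gt, hs'.not_gt, h.le, hs'.le, and_self]
    · filter_upwards [hc.eventually (gt_mem_nhds h)] with s' hs'
      simp only [h, hs', h.not_ge, hs'.not_ge, and_self]
  have hall : ∀ᶠ s' in 𝓝 s, ∀ i, (u i ∈ Set.Ioc (margCdfLeft i (s' i) (y i))
      (margCdf i (s' i) (y i)) ↔ u i ∈ Set.Ioc (margCdfLeft i (s i) (y i))
      (margCdf i (s i) (y i))) := by
    rw [eventually_all]
    intro i
    filter_upwards [key (continuous_margCdfLeft i (y i)) i (hu i).1,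
      key (continuous_margCdf i (y i)) i (hu i).2] with s' h1 h2
    rw [Set.mem_Ioc, Set.mem_Ioc, h1.1, h2.2]
  filter_upwards [hall] with s' hs'
  simp only [rect, Set.mem_univ_pi, hs']

lemma ae_pi_unif_ne (i : Fin 2) (c : ℝ) : ∀ᵐ u ∂(Measure.pi fun _ : Fin 2 => unif), u i ≠ c :=
  (measurePreserving_eval (fun _ : Fin 2 => unif) i).quasiMeasurePreserving.ae (ae_unif_ne c)

/-- Dominated convergence: off the null set of the edge lines, the indicator of the rectangle is
locally constant in s and the density is continuous in r. -/
lemma continuousAt_condPmf {r : ℝ} (hr : r ∈ Set.Ioo (-1 : ℝ) 1) (y : Fin 2 → ℕ) (s : Fin 2 → ℝ) :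
    ContinuousAt (fun p : ℝ × (Fin 2 → ℝ) => condPmf p.1 y p.2) (r, s) := by
  have hr' := one_sub_sq_pos hr
  have hrs : ∀ p : ℝ × (Fin 2 → ℝ), condPmf p.1 y p.2 =
      ∫ u, (rect y p.2).indicator (copulaDensity p.1) u ∂(Measure.pi fun _ : Fin 2 => unif) :=
    fun p => by rw [condPmf_eq_setIntegral, integral_indicator (measurableSet_rect _ _)]
  rw [ContinuousAt, hrs (r, s)]
  simp_rw [hrs]
  have hfst : Tendsto (fun p : ℝ × (Fin 2 → ℝ) => p.1) (𝓝 (r, s)) (𝓝 r) := continuous_fst.tendsto _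
  have hmem : ∀ᶠ p : ℝ × (Fin 2 → ℝ) in 𝓝 (r, s), p.1 ∈ Set.Ioo (-1 : ℝ) 1 :=
    hfst.eventually (isOpen_Ioo.mem_nhds hr)
  have hbd : ∀ᶠ p : ℝ × (Fin 2 → ℝ) in 𝓝 (r, s),
      (Real.sqrt (1 - p.1 ^ 2))⁻¹ < (Real.sqrt (1 - r ^ 2))⁻¹ + 1 := by
    have hc : ContinuousAt (fun r : ℝ => (Real.sqrt (1 - r ^ 2))⁻¹) r :=
      ContinuousAt.inv₀ (by fun_prop) (Real.sqrt_pos.2 hr').ne'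
    exact (hc.tendsto.comp hfst).eventually (gt_mem_nhds (lt_add_one _))
  refine tendsto_integral_filter_of_dominated_convergence (l := 𝓝 (r, s))
    (F := fun p u => (rect y p.2).indicator (copulaDensity p.1) u)
    (fun u : Fin 2 → ℝ => ((Real.sqrt (1 - r ^ 2))⁻¹ + 1) *
      (Real.exp (stdQuantile (u 0) ^ 2 / 4) * Real.exp (stdQuantile (u 1) ^ 2 / 4))) ?_ ?_ ?_ ?_
  · filter_upwards [hmem] with p hp
    exact ((measurable_copulaDensity hp).indicator (measurableSet_rect _ _)).aestronglyMeasurable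
  · filter_upwards [hmem, hbd] with p hp hp'
    refine Eventually.of_forall fun u => ?_
    refine (norm_indicator_le_norm_self _ _).trans ?_
    rw [Real.norm_eq_abs, abs_of_nonneg (copulaDensity_nonneg _ _)]
    refine (copulaDensity_le hp u).trans ?_
    gcongr
  · refine Integrable.const_mul ?_ _
    have h := Integrable.fintype_prod (μ := fun _ : Fin 2 => unif)
      (f := fun _ : Fin 2 => fun u => Real.exp (stdQuantile u ^ 2 / 4))
      fun _ => integrable_exp_sq_stdQuantile
    simpa [Fin.prod_univ_two] using h
  · have hne : ∀ᵐ u ∂(Measure.pi fun _ : Fin 2 => unif), ∀ i,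
        u i ≠ margCdfLeft i (s i) (y i) ∧ u i ≠ margCdf i (s i) (y i) :=
      ae_all_iff.2 fun i => (ae_pi_unif_ne i _).and (ae_pi_unif_ne i _)
    filter_upwards [hne] with u hu
    have h1 : ∀ᶠ p : ℝ × (Fin 2 → ℝ) in 𝓝 (r, s), (u ∈ rect y p.2 ↔ u ∈ rect y s) :=
      (continuous_snd.tendsto (r, s)).eventually (eventually_mem_rect_iff y s u hu)
    have h2 : Tendsto (fun p : ℝ × (Fin 2 → ℝ) => copulaDensity p.1 u) (𝓝 (r, s))
        (𝓝 (copulaDensity r u)) := (continuousAt_copulaDensity hr u).tendsto.comp hfst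
    by_cases hus : u ∈ rect y s
    · rw [Set.indicator_of_mem hus]
      refine h2.congr' ?_
      filter_upwards [h1] with p hp
      rw [Set.indicator_of_mem (hp.2 hus)]
    · rw [Set.indicator_of_notMem hus]
      refine tendsto_const_nhds.congr' ?_
      filter_upwards [h1] with p hp
      rw [Set.indicator_of_notMem fun h => hus (hp.1 h)]

end CondPmf

/-! ### Stationary processes -/

section Stationary


lemma shift_iterate {S : Type*} (n : ℕ) (z : ℤ → S) (t : ℤ) : shift^[n] z t = z (t + n) := by
  induction n generalizing z with
  | zero => simp
  | succ n ih =>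
    rw [Function.iterate_succ_apply, ih, shift]
    congr 1
    push_cast
    ring

variable {Ω S : Type*} [MeasurableSpace Ω] [MeasurableSpace S] {P : Measure Ω} {Z : ℤ → Ω → S}

lemma measurable_shift : Measurable (shift (S := S)) :=
  measurable_pi_lambda _ fun t => measurable_pi_apply (t + 1)

lemma IsStationaryErgodic.isStationary (h : IsStationaryErgodic P Z) : IsStationary P Z :=
  ⟨h.1, h.2.toMeasurePreserving⟩

lemma IsStationary.map_succ (h : IsStationary P Z) (t : ℤ) : P.map (Z (t + 1)) = P.map (Z t) := by
  have hm : Measurable fun ω t => Z t ω := measurable_pi_lambda _ h.1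
  have h1 : ∀ s, P.map (Z s) = (pathLaw P Z).map fun z => z s := fun s => by
    rw [pathLaw, Measure.map_map (measurable_pi_apply s) hm]; rfl
  rw [h1, h1]
  conv_rhs => rw [← h.2.map_eq]
  rw [Measure.map_map (measurable_pi_apply t) measurable_shift]
  rfl

/-- The one-dimensional marginals of a stationary process coincide. -/
lemma IsStationary.map_eq (h : IsStationary P Z) (t : ℤ) : P.map (Z t) = P.map (Z 0) := by
  induction t using Int.induction_on with
  | zero => rfl
  | succ n ih => rw [h.map_succ, ih]
  | pred n ih => rw [← ih, ← h.map_succ, sub_add_cancel]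

lemma IsStationary.lintegral_eq (h : IsStationary P Z) {φ : S → ENNReal} (hφ : Measurable φ)
    (t : ℤ) : ∫⁻ ω, φ (Z t ω) ∂P = ∫⁻ ω, φ (Z 0 ω) ∂P := by
  rw [← lintegral_map hφ (h.1 t), h.map_eq, lintegral_map hφ (h.1 0)]

/-- An instantaneous function of a stationary process is stationary, at the level of the
one-dimensional marginals. -/
lemma IsStationary.map_comp_eq (h : IsStationary P Z) {S' : Type*} [MeasurableSpace S'] {φ : S → S'}
    (hφ : Measurable φ) (t : ℤ) :
    P.map (fun ω => φ (Z t ω)) = P.map (fun ω => φ (Z 0 ω)) := by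
  rw [← Function.comp_def, ← Measure.map_map hφ (h.1 t), h.map_eq, Measure.map_map hφ (h.1 0)]
  rfl

/-- A process that is almost surely an equivariant function of a stationary ergodic process is
stationary and ergodic. -/
lemma IsStationaryErgodic.of_factor (h : IsStationaryErgodic P Z) {S' : Type*} [MeasurableSpace S']
    {V : ℤ → Ω → S'} (hV : ∀ t, Measurable (V t)) {ψ : (ℤ → S) → ℤ → S'} (hψ : Measurable ψ)
    (hcomm : ∀ z, ψ (shift z) = shift (ψ z)) (hVψ : ∀ t, ∀ᵐ ω ∂P, V t ω = ψ (fun t => Z t ω) t) :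
    IsStationaryErgodic P V := by
  refine ⟨hV, ?_⟩
  have hm : Measurable fun ω t => Z t ω := measurable_pi_lambda _ h.1
  have hae : (fun ω t => V t ω) =ᵐ[P] ψ ∘ fun ω t => Z t ω := by
    filter_upwards [ae_all_iff.2 hVψ] with ω hω
    exact funext hω
  have hlaw : pathLaw P V = (pathLaw P Z).map ψ := by
    rw [pathLaw, pathLaw, Measure.map_map hψ hm, Measure.map_congr hae]
  have hmp : MeasurePreserving ψ (pathLaw P Z) (pathLaw P V) := ⟨hψ, hlaw.symm⟩
  exact hmp.ergodic_of_ergodic_semiconj h.2 measurable_shift hcomm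

/-- Nonnegative random variables with geometrically decaying means are almost surely summable. -/
lemma ae_tsum_lt_top_of_lintegral_le {f : ℕ → Ω → ENNReal} (hf : ∀ n, AEMeasurable (f n) P)
    {C κ : ℝ} (hκ0 : 0 ≤ κ) (hκ1 : κ < 1) (hC : 0 ≤ C)
    (h : ∀ n, ∫⁻ ω, f n ω ∂P ≤ ENNReal.ofReal (C * κ ^ n)) : ∀ᵐ ω ∂P, ∑' n, f n ω < ⊤ := by
  refine ae_lt_top' (AEMeasurable.tsum hf) ?_
  rw [lintegral_tsum hf]
  refine ne_top_of_le_ne_top ?_ (ENNReal.tsum_le_tsum h)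
  rw [← ENNReal.ofReal_tsum_of_nonneg (fun n => by positivity)
    ((summable_geometric_of_lt_one hκ0 hκ1).mul_left C)]
  exact ENNReal.ofReal_ne_top

lemma ae_summable_of_lintegral_le {f : ℕ → Ω → ℝ} (hf : ∀ n, AEMeasurable (f n) P)
    {C κ : ℝ} (hκ0 : 0 ≤ κ) (hκ1 : κ < 1) (hC : 0 ≤ C)
    (h : ∀ n, ∫⁻ ω, ENNReal.ofReal |f n ω| ∂P ≤ ENNReal.ofReal (C * κ ^ n)) :
    ∀ᵐ ω ∂P, Summable fun n => f n ω := by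
  filter_upwards [ae_tsum_lt_top_of_lintegral_le (fun n => (hf n).abs.ennreal_ofReal)
    hκ0 hκ1 hC h] with ω hω
  have h1 := ENNReal.summable_toReal hω.ne
  simp only [ENNReal.toReal_ofReal (abs_nonneg _)] at h1
  exact h1.of_abs

end Stationary

/-! ### The past of the noise and of the covariates -/

section Past

variable {Ω : Type*} {m : ℕ} {U : ℤ → Ω → Fin 2 → ℝ} {X : ℤ → Ω → Fin m → ℝ}

lemma past_mono {s t : ℤ} (h : s ≤ t) : past U X s ≤ past U X t :=
  iSup_mono fun _ => iSup_mono' fun hr => ⟨hr.trans h, le_rfl⟩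

lemma measurable_past_noise {s t : ℤ} (h : s ≤ t) : Measurable[past U X t] (U s) := by
  refine Measurable.mono (comap_measurable (U s)) ?_ le_rfl
  exact le_sup_left.trans (le_iSup₂_of_le s h le_rfl)

lemma measurable_past_covariate {s t : ℤ} (h : s ≤ t) : Measurable[past U X t] (X s) := by
  refine Measurable.mono (comap_measurable (X s)) ?_ le_rfl
  exact le_sup_right.trans (le_iSup₂_of_le s h le_rfl)

variable [MeasurableSpace Ω] {P : Measure Ω}

lemma past_le (hU : ∀ t, Measurable (U t)) (hX : ∀ t, Measurable (X t)) (t : ℤ) :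
    past U X t ≤ ‹MeasurableSpace Ω› :=
  iSup₂_le fun s _ => sup_le (hU s).comap_le (hX s).comap_le

lemma NoiseAssumption.measurable_noise (h : NoiseAssumption P U X) (t : ℤ) : Measurable (U t) :=
  (h.1.1 t).fst

lemma NoiseAssumption.measurable_covariate (h : NoiseAssumption P U X) (t : ℤ) :
    Measurable (X t) :=
  (h.1.1 t).snd

lemma NoiseAssumption.map_noise (h : NoiseAssumption P U X) (t : ℤ) :
    P.map (U t) = P.map (U 0) :=
  h.1.isStationary.map_comp_eq measurable_fst t

lemma NoiseAssumption.indepFun (h : NoiseAssumption P U X) {E : Type*} [MeasurableSpace E]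
    {V : Ω → E} {t : ℤ} (hV : Measurable[past U X (t - 1)] V) : IndepFun V (U t) P := by
  rw [IndepFun_iff_Indep]
  exact (indep_of_indep_of_le_right (h.2 t) hV.comap_le).symm

/-- Integration of a function of the noise at time `t` and of a past variable. -/
lemma NoiseAssumption.map_prod [IsProbabilityMeasure P] (h : NoiseAssumption P U X) {r : ℝ}
    (hU : P.map (U 0) = gaussianCopula r) {E : Type*} [MeasurableSpace E] {V : Ω → E} {t : ℤ}
    (hV : Measurable[past U X (t - 1)] V) :
    P.map (fun ω => (V ω, U t ω)) = (P.map V).prod (gaussianCopula r) := by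
  have hVm : Measurable V := hV.mono (past_le h.measurable_noise h.measurable_covariate _) le_rfl
  rw [(indepFun_iff_map_prod_eq_prod_map_map hVm.aemeasurable
    (h.measurable_noise t).aemeasurable).1 (h.indepFun hV), h.map_noise, hU]

lemma NoiseAssumption.lintegral_eq [IsProbabilityMeasure P] (h : NoiseAssumption P U X) {r : ℝ}
    (hr : r ∈ Set.Ioo (-1 : ℝ) 1) (hU : P.map (U 0) = gaussianCopula r) {E : Type*}
    [MeasurableSpace E] {V : Ω → E} {t : ℤ} (hV : Measurable[past U X (t - 1)] V)
    {φ : E × (Fin 2 → ℝ) → ENNReal} (hφ : Measurable φ) :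
    ∫⁻ ω, φ (V ω, U t ω) ∂P = ∫⁻ ω, ∫⁻ u, φ (V ω, u) ∂(gaussianCopula r) ∂P := by
  have := isProbabilityMeasure_gaussianCopula hr
  have hVm : Measurable V := hV.mono (past_le h.measurable_noise h.measurable_covariate _) le_rfl
  rw [← lintegral_map hφ (hVm.prodMk (h.measurable_noise t)), h.map_prod hU hV,
    lintegral_prod _ hφ.aemeasurable, lintegral_map hφ.lintegral_prod_right' hVm]

end Past

/-! ### The model as a random recursion -/

section Recursion

variable {m : ℕ}

lemma measurable_transf : Measurable transf := measurable_of_countable _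

lemma measurable_step (θ : Param m) :
    Measurable fun p : (Fin 2 → ℝ) × (Fin 2 → ℕ) × (Fin m → ℝ) => step θ p.1 p.2.1 p.2.2 := by
  have h1 : Measurable fun p : (Fin 2 → ℝ) × (Fin 2 → ℕ) × (Fin m → ℝ) => θ.B.mulVec p.1 :=
    (Continuous.matrix_mulVec continuous_const continuous_fst).measurable
  have h2 : Measurable fun p : (Fin 2 → ℝ) × (Fin 2 → ℕ) × (Fin m → ℝ) =>
      θ.A.mulVec (transf p.2.1) := by
    have : Measurable fun v : Fin 2 → ℝ => θ.A.mulVec v :=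
      (Continuous.matrix_mulVec continuous_const continuous_id).measurable
    exact this.comp (measurable_transf.comp (measurable_fst.comp measurable_snd))
  have h3 : Measurable fun p : (Fin 2 → ℝ) × (Fin 2 → ℕ) × (Fin m → ℝ) => θ.Γ.mulVec p.2.2 :=
    (Continuous.matrix_mulVec continuous_const (continuous_snd.comp continuous_snd)).measurable
  exact ((measurable_const.add h1).add h2).add h3

lemma measurable_step_comp (θ : Param m) {α : Type*} {mα : MeasurableSpace α} {l : α → Fin 2 → ℝ}
    {y : α → Fin 2 → ℕ} {x : α → Fin m → ℝ} (hl : Measurable l) (hy : Measurable y)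
    (hx : Measurable x) : Measurable fun a => step θ (l a) (y a) (x a) := by
  have h := (measurable_step θ).comp (hl.prodMk (hy.prodMk hx))
  simpa only [Function.comp_def] using h

lemma measurable_observe_comp {α : Type*} {mα : MeasurableSpace α} {l u : α → Fin 2 → ℝ}
    (hl : Measurable l) (hu : Measurable u) : Measurable fun a => observe (l a) (u a) := by
  have h := measurable_observe.comp (hl.prodMk hu)
  simpa only [Function.comp_def] using h

/-- The latent vector at time `t` when the recursion is started from `0` at time `t - n`, as a
function of the path `z` of the noise and of the covariates. -/
def iter (θ : Param m) : ℕ → (ℤ → (Fin 2 → ℝ) × (Fin m → ℝ)) → ℤ → Fin 2 → ℝ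
  | 0, _, _ => 0
  | n + 1, z, t =>
    step θ (iter θ n z (t - 1)) (observe (iter θ n z (t - 1)) (z (t - 1)).1) (z (t - 1)).2

lemma iter_shift (θ : Param m) (n : ℕ) (z : ℤ → (Fin 2 → ℝ) × (Fin m → ℝ)) (t : ℤ) :
    iter θ n (shift z) t = iter θ n z (t + 1) := by
  induction n generalizing t with
  | zero => rfl
  | succ n ih =>
    simp only [iter, ih, shift]
    rw [sub_add_cancel, add_sub_cancel_right]

lemma measurable_iter (θ : Param m) (n : ℕ) (t : ℤ) : Measurable fun z => iter θ n z t := by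
  induction n generalizing t with
  | zero => exact measurable_const
  | succ n ih =>
    have h1 : Measurable fun z : ℤ → (Fin 2 → ℝ) × (Fin m → ℝ) => (z (t - 1)).1 :=
      (measurable_pi_apply (t - 1)).fst
    have h2 : Measurable fun z : ℤ → (Fin 2 → ℝ) × (Fin m → ℝ) => (z (t - 1)).2 :=
      (measurable_pi_apply (t - 1)).snd
    simp only [iter]
    exact measurable_step_comp θ (ih _) (measurable_observe_comp (ih _) h1) h2

/-- The iterate at time t uses the noise and the covariates only up to t - 1, hence it is
independent of the noise at time t. -/
lemma measurable_past_iter {Ω : Type*} {U : ℤ → Ω → Fin 2 → ℝ} {X : ℤ → Ω → Fin m → ℝ} (θ : Param m) (n : ℕ) (t : ℤ) :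
    Measurable[past U X (t - 1)] fun ω => iter θ n (fun t => (U t ω, X t ω)) t := by
  induction n generalizing t with
  | zero => exact measurable_const
  | succ n ih =>
    have h0 : Measurable[past U X (t - 1)] fun ω => iter θ n (fun t => (U t ω, X t ω)) (t - 1) :=
      (ih (t - 1)).mono (past_mono (by omega)) le_rfl
    simp only [iter]
    exact measurable_step_comp θ h0 (measurable_observe_comp h0 (measurable_past_noise le_rfl))
      (measurable_past_covariate le_rfl)

/-- The matrix that governs the contraction of the model in mean. -/
def contractionMatrix (θ : Param m) : Matrix (Fin 2) (Fin 2) ℝ :=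
  absVec θ.B + absVec θ.A * Matrix.diagonal ![1 / 4, 1]

lemma contractionMatrix_apply (θ : Param m) (i j : Fin 2) :
    contractionMatrix θ i j = |θ.B i j| + |θ.A i j| * (![1 / 4, 1] : Fin 2 → ℝ) j := by
  simp [contractionMatrix, absVec, Matrix.mul_diagonal]

lemma contractionMatrix_nonneg (θ : Param m) (i j : Fin 2) : 0 ≤ contractionMatrix θ i j := by
  rw [contractionMatrix_apply]
  fin_cases j <;> simp <;> positivity

lemma abs_step_sub_step_le (θ : Param m) (l l' : Fin 2 → ℝ) (y y' : Fin 2 → ℕ) (x : Fin m → ℝ)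
    (i : Fin 2) : |step θ l y x i - step θ l' y' x i| ≤
      ∑ j, (|θ.B i j| * |l j - l' j| + |θ.A i j| * |transf y j - transf y' j|) := by
  have : step θ l y x i - step θ l' y' x i =
      ∑ j, (θ.B i j * (l j - l' j) + θ.A i j * (transf y j - transf y' j)) := by
    simp only [step, Pi.add_apply, Matrix.mulVec, dotProduct, Fin.sum_univ_two]
    ring
  rw [this]
  refine (Finset.abs_sum_le_sum_abs _ _).trans (Finset.sum_le_sum fun j _ => ?_)
  rw [← abs_mul, ← abs_mul]
  exact abs_add_le _ _

/-- The distance of the `j`-th transformed observations of two latent vectors with the same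
noise. -/
def transfDist (j : Fin 2) (l l' u : Fin 2 → ℝ) : ENNReal :=
  ENNReal.ofReal |transf (observe l u) j - transf (observe l' u) j|

lemma measurable_transfDist (j : Fin 2) {α : Type*} {mα : MeasurableSpace α}
    {l l' u : α → Fin 2 → ℝ} (hl : Measurable l) (hl' : Measurable l') (hu : Measurable u) :
    Measurable fun a => transfDist j (l a) (l' a) (u a) := by
  have h : Measurable fun y => transf y j := measurable_of_countable _
  have h1 := h.comp (measurable_observe_comp hl hu)
  have h2 := h.comp (measurable_observe_comp hl' hu)
  exact (h1.sub h2).norm.ennreal_ofReal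

lemma lintegral_transfDist_le {r : ℝ} (hr : r ∈ Set.Ioo (-1 : ℝ) 1) (l l' : Fin 2 → ℝ)
    (j : Fin 2) :
    ∫⁻ u, transfDist j l l' u ∂(gaussianCopula r) ≤
      ENNReal.ofReal ((![1 / 4, 1] : Fin 2 → ℝ) j * |l j - l' j|) := by
  match j with
  | 0 =>
    have hm : Measurable fun v : ℝ => ENNReal.ofReal
        |(bernoulliQuantile (l 0) v : ℝ) - bernoulliQuantile (l' 0) v| :=
      ((((measurable_of_countable (fun n : ℕ => (n : ℝ))).comp
        (measurable_bernoulliQuantile_right (l 0))).sub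
        ((measurable_of_countable (fun n : ℕ => (n : ℝ))).comp
        (measurable_bernoulliQuantile_right (l' 0)))).norm).ennreal_ofReal
    have h := (measurePreserving_eval_gaussianCopula hr 0).lintegral_comp hm
    exact h.trans_le (lintegral_bernoulliQuantile_sub_le (l 0) (l' 0))
  | 1 =>
    have hm : Measurable fun v : ℝ => ENNReal.ofReal
        |Real.log (1 + (poissonQuantile (l 1) v : ℝ)) -
          Real.log (1 + (poissonQuantile (l' 1) v : ℝ))| :=
      ((((measurable_of_countable (fun n : ℕ => Real.log (1 + (n : ℝ)))).comp
        (measurable_poissonQuantile_right (l 1))).sub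
        ((measurable_of_countable (fun n : ℕ => Real.log (1 + (n : ℝ)))).comp
        (measurable_poissonQuantile_right (l' 1)))).norm).ennreal_ofReal
    have h := (measurePreserving_eval_gaussianCopula hr 1).lintegral_comp hm
    refine h.trans_le ((lintegral_log_poissonQuantile_sub_le (l 1) (l' 1)).trans_eq ?_)
    simp

end Recursion

/-! ### The solution as a function of the noise and of the covariates -/

section Solution

lemma mulVec_nonneg {M : Matrix (Fin 2) (Fin 2) ℝ} (hM : ∀ i j, 0 ≤ M i j) {v : Fin 2 → ℝ}
    (hv : ∀ i, 0 ≤ v i) (i : Fin 2) : 0 ≤ M.mulVec v i := by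
  rw [Matrix.mulVec, dotProduct]
  exact Finset.sum_nonneg fun j _ => mul_nonneg (hM i j) (hv j)

lemma pow_mulVec_nonneg {M : Matrix (Fin 2) (Fin 2) ℝ} (hM : ∀ i j, 0 ≤ M i j) {v : Fin 2 → ℝ}
    (hv : ∀ i, 0 ≤ v i) (n : ℕ) (i : Fin 2) : 0 ≤ (M ^ n).mulVec v i := by
  induction n generalizing i with
  | zero => simpa using hv i
  | succ n ih =>
    rw [pow_succ', ← Matrix.mulVec_mulVec]
    exact mulVec_nonneg hM ih i

variable {Ω : Type*} [MeasurableSpace Ω] {P : Measure Ω} {m : ℕ}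
  {U : ℤ → Ω → Fin 2 → ℝ} {X : ℤ → Ω → Fin m → ℝ} {Y : ℤ → Ω → Fin 2 → ℕ}
  {lam : ℤ → Ω → Fin 2 → ℝ} {θ₀ : Param m} {r₀ : ℝ}

lemma IsSolution.measurable_past_step (hY : IsSolution P U X θ₀ Y lam) (t : ℤ) :
    Measurable[past U X (t - 1)] fun ω => step θ₀ (lam (t - 1) ω) (Y (t - 1) ω) (X (t - 1) ω) :=
  measurable_step_comp θ₀ (hY.adapted_latent (t - 1)) (hY.adapted_obs (t - 1))
    (measurable_past_covariate le_rfl)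

lemma IsSolution.measurable_obs (hY : IsSolution P U X θ₀ Y lam) (t : ℤ) : Measurable (Y t) :=
  (hY.stationary.1 t).fst

lemma IsSolution.measurable_latent (hY : IsSolution P U X θ₀ Y lam) (t : ℤ) :
    Measurable (lam t) :=
  (hY.stationary.1 t).snd

variable [IsProbabilityMeasure P]

/-- One step of the contraction: the mean distance between the solution and the iterates. -/
lemma IsSolution.lintegral_sub_iter_succ_le (hUX : NoiseAssumption P U X)
    (hr : r₀ ∈ Set.Ioo (-1 : ℝ) 1) (hU : P.map (U 0) = gaussianCopula r₀)
    (hY : IsSolution P U X θ₀ Y lam) (n : ℕ) (t : ℤ) (i : Fin 2) :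
    ∫⁻ ω, ENNReal.ofReal |lam t ω i - iter θ₀ (n + 1) (fun t => (U t ω, X t ω)) t i| ∂P ≤
      ∑ j, ENNReal.ofReal (contractionMatrix θ₀ i j) * ∫⁻ ω, ENNReal.ofReal
        |lam (t - 1) ω j - iter θ₀ n (fun t => (U t ω, X t ω)) (t - 1) j| ∂P := by
  set Z : Ω → ℤ → (Fin 2 → ℝ) × (Fin m → ℝ) := fun ω t => (U t ω, X t ω) with hZ
  -- `lam (t - 1)` is only known to be measurable at time t - 1. Its expression through the
  -- recursion is an almost surely equal version that is measurable at time t - 2, hence independent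
  -- of `U (t - 1)`.
  set l : Ω → Fin 2 → ℝ := fun ω =>
    step θ₀ (lam (t - 1 - 1) ω) (Y (t - 1 - 1) ω) (X (t - 1 - 1) ω) with hl
  set l' : Ω → Fin 2 → ℝ := fun ω => iter θ₀ n (Z ω) (t - 1) with hl'
  have hlm : Measurable[past U X (t - 1 - 1)] l := hY.measurable_past_step (t - 1)
  have hlm' : Measurable[past U X (t - 1 - 1)] l' := measurable_past_iter θ₀ n (t - 1)
  have hV : Measurable[past U X (t - 1 - 1)] fun ω => (l ω, l' ω) := hlm.prodMk hlm'
  have hle := past_le (U := U) (X := X) hUX.measurable_noise hUX.measurable_covariate (t - 1 - 1)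
  have hm1 : Measurable l := hlm.mono hle le_rfl
  have hm1' : Measurable l' := hlm'.mono hle le_rfl
  have hpt : ∀ᵐ ω ∂P, ENNReal.ofReal |lam t ω i - iter θ₀ (n + 1) (Z ω) t i| ≤
      ∑ j, (ENNReal.ofReal |θ₀.B i j| * ENNReal.ofReal |l ω j - l' ω j| +
        ENNReal.ofReal |θ₀.A i j| * transfDist j (l ω) (l' ω) (U (t - 1) ω)) := by
    filter_upwards [hY.latent t, hY.latent (t - 1), hY.observation (t - 1)] with ω h1 h2 h3
    rw [h1, h3]
    have h2' : lam (t - 1) ω = l ω := h2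
    rw [h2']
    refine (ENNReal.ofReal_le_ofReal (abs_step_sub_step_le θ₀ (l ω) (l' ω)
      (observe (l ω) (U (t - 1) ω)) (observe (l' ω) (U (t - 1) ω)) (X (t - 1) ω) i)).trans_eq ?_
    rw [ENNReal.ofReal_sum_of_nonneg fun j _ => by positivity]
    refine Finset.sum_congr rfl fun j _ => ?_
    rw [ENNReal.ofReal_add (by positivity) (by positivity), ENNReal.ofReal_mul (abs_nonneg _),
      ENNReal.ofReal_mul (abs_nonneg _), transfDist]
  have hmd : ∀ j, Measurable fun ω => ENNReal.ofReal |l ω j - l' ω j| := fun j =>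
    ((((measurable_pi_apply j).comp hm1).sub ((measurable_pi_apply j).comp hm1')).norm).ennreal_ofReal
  have hφ : ∀ j, Measurable fun p : ((Fin 2 → ℝ) × (Fin 2 → ℝ)) × (Fin 2 → ℝ) =>
      transfDist j p.1.1 p.1.2 p.2 := fun j =>
    measurable_transfDist j measurable_fst.fst measurable_fst.snd measurable_snd
  have hmφ : ∀ j, Measurable fun ω => transfDist j (l ω) (l' ω) (U (t - 1) ω) := fun j =>
    measurable_transfDist j hm1 hm1' (hUX.measurable_noise (t - 1))
  refine (lintegral_mono_ae hpt).trans ?_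
  have hms : ∀ j, Measurable fun ω => ENNReal.ofReal |θ₀.B i j| * ENNReal.ofReal |l ω j - l' ω j| +
      ENNReal.ofReal |θ₀.A i j| * transfDist j (l ω) (l' ω) (U (t - 1) ω) := fun j =>
    ((hmd j).const_mul _).add ((hmφ j).const_mul _)
  rw [lintegral_finsetSum _ fun j _ => hms j]
  refine Finset.sum_le_sum fun j _ => ?_
  rw [lintegral_add_left ((hmd j).const_mul _), lintegral_const_mul _ (hmd j),
    lintegral_const_mul _ (hmφ j)]
  have hd : ∫⁻ ω, ENNReal.ofReal |lam (t - 1) ω j - iter θ₀ n (Z ω) (t - 1) j| ∂P =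
      ∫⁻ ω, ENNReal.ofReal |l ω j - l' ω j| ∂P := by
    refine lintegral_congr_ae ?_
    filter_upwards [hY.latent (t - 1)] with ω h2
    have h2' : lam (t - 1) ω = l ω := h2
    rw [h2']
  have hc0 : 0 ≤ (![1 / 4, 1] : Fin 2 → ℝ) j := by fin_cases j <;> simp
  -- Given the past, only the noise is integrated, and the quantile transforms contract in mean.
  have hA : ∫⁻ ω, transfDist j (l ω) (l' ω) (U (t - 1) ω) ∂P ≤
      ENNReal.ofReal ((![1 / 4, 1] : Fin 2 → ℝ) j) * ∫⁻ ω, ENNReal.ofReal |l ω j - l' ω j| ∂P := by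
    rw [hUX.lintegral_eq (t := t - 1) hr hU hV (hφ j), ← lintegral_const_mul _ (hmd j)]
    refine lintegral_mono fun ω => ?_
    rw [← ENNReal.ofReal_mul hc0]
    exact lintegral_transfDist_le hr (l ω) (l' ω) j
  rw [hd, contractionMatrix_apply, ENNReal.ofReal_add (abs_nonneg _) (by positivity),
    ENNReal.ofReal_mul (abs_nonneg _), add_mul, mul_assoc]
  gcongr

/-- The one-step inequality is iterated as a matrix inequality between nonnegative vectors. The
iterates start from 0, so the initial distance is the mean of |λ|, the same at all times by
stationarity. -/
lemma IsSolution.lintegral_sub_iter_le (hUX : NoiseAssumption P U X)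
    (hr : r₀ ∈ Set.Ioo (-1 : ℝ) 1) (hU : P.map (U 0) = gaussianCopula r₀)
    (hY : IsSolution P U X θ₀ Y lam) (n : ℕ) (t : ℤ) (i : Fin 2) :
    ∫⁻ ω, ENNReal.ofReal |lam t ω i - iter θ₀ n (fun t => (U t ω, X t ω)) t i| ∂P ≤
      ENNReal.ofReal (((contractionMatrix θ₀ ^ n).mulVec fun i => ∫ ω, |lam 0 ω i| ∂P) i) := by
  have hv : ∀ i, 0 ≤ ∫ ω, |lam 0 ω i| ∂P := fun i => integral_nonneg fun ω => abs_nonneg _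
  induction n generalizing t i with
  | zero =>
    simp only [iter, Pi.zero_apply, sub_zero, pow_zero, Matrix.one_mulVec]
    have hφ : Measurable fun p : (Fin 2 → ℕ) × (Fin 2 → ℝ) => ENNReal.ofReal |p.2 i| :=
      ((measurable_pi_apply i).comp measurable_snd).norm.ennreal_ofReal
    have h1 := hY.stationary.lintegral_eq hφ t
    simp only at h1
    have hi : Integrable (fun ω => |lam 0 ω i|) P := (Integrable.eval hY.integrable i).abs
    rw [h1, ofReal_integral_eq_lintegral_ofReal hi (Eventually.of_forall fun ω => abs_nonneg _)]
  | succ n ih =>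
    refine (hY.lintegral_sub_iter_succ_le hUX hr hU n t i).trans ?_
    rw [pow_succ', ← Matrix.mulVec_mulVec]
    conv_rhs => rw [Matrix.mulVec, dotProduct]
    rw [ENNReal.ofReal_sum_of_nonneg fun j _ => mul_nonneg (contractionMatrix_nonneg θ₀ i j)
      (pow_mulVec_nonneg (contractionMatrix_nonneg θ₀) hv n j)]
    refine Finset.sum_le_sum fun j _ => ?_
    rw [ENNReal.ofReal_mul (contractionMatrix_nonneg θ₀ i j)]
    gcongr
    exact ih (t - 1) j

/-- The mean distances decay geometrically, so their sum has finite expectation; hence the distances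
are almost surely summable and tend to 0. -/
lemma IsSolution.ae_tendsto_iter (hUX : NoiseAssumption P U X)
    (hr : r₀ ∈ Set.Ioo (-1 : ℝ) 1) (hU : P.map (U 0) = gaussianCopula r₀)
    (hρ : specRad (contractionMatrix θ₀) < 1) (hY : IsSolution P U X θ₀ Y lam) (t : ℤ) :
    ∀ᵐ ω ∂P, Tendsto (fun n => iter θ₀ n (fun t => (U t ω, X t ω)) t) atTop (𝓝 (lam t ω)) := by
  obtain ⟨C, κ, hC, hκ0, hκ1, h⟩ := exists_rowSum_pow_le (K := {contractionMatrix θ₀})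
    isCompact_singleton (by simpa using hρ)
  set v : Fin 2 → ℝ := fun i => ∫ ω, |lam 0 ω i| ∂P
  have hv : ∀ i, 0 ≤ v i := fun i => integral_nonneg fun ω => abs_nonneg _
  have hbd : ∀ n i, ((contractionMatrix θ₀ ^ n).mulVec v) i ≤ (C * ∑ j, v j) * κ ^ n := by
    intro n i
    calc ((contractionMatrix θ₀ ^ n).mulVec v) i
        ≤ ∑ k, |(contractionMatrix θ₀ ^ n) i k| * ∑ j, v j := by
          rw [Matrix.mulVec, dotProduct]
          refine Finset.sum_le_sum fun k _ => ?_
          refine mul_le_mul (le_abs_self _)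
            (Finset.single_le_sum (fun j _ => hv j) (Finset.mem_univ k)) (hv k) (abs_nonneg _)
      _ ≤ (C * κ ^ n) * ∑ j, v j := by
          rw [← Finset.sum_mul]
          have := Finset.sum_nonneg fun j (_ : j ∈ Finset.univ) => hv j
          gcongr
          exact h _ rfl n i
      _ = _ := by ring
  have hm : ∀ n, Measurable fun ω => iter θ₀ n (fun t => (U t ω, X t ω)) t := fun n =>
    (measurable_past_iter θ₀ n t).mono
      (past_le hUX.measurable_noise hUX.measurable_covariate _) le_rfl
  have hsum : ∀ i, ∀ᵐ ω ∂P, Summable fun n =>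
      lam t ω i - iter θ₀ n (fun t => (U t ω, X t ω)) t i := fun i => by
    refine ae_summable_of_lintegral_le (fun n => ?_) hκ0.le hκ1
      (mul_nonneg hC.le (Finset.sum_nonneg fun j _ => hv j))
      fun n => (hY.lintegral_sub_iter_le hUX hr hU n t i).trans (ENNReal.ofReal_le_ofReal (hbd n i))
    exact (((measurable_pi_apply i).comp (hY.measurable_latent t)).sub
      ((measurable_pi_apply i).comp (hm n))).aemeasurable
  filter_upwards [ae_all_iff.2 hsum] with ω hω
  rw [tendsto_pi_nhds]
  intro i
  have h1 := (hω i).tendsto_atTop_zero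
  have h2 := (tendsto_const_nhds (x := lam t ω i)).sub h1
  simpa using h2

/-- The observations and the covariates as a function of the path of the noise and of the
covariates. -/
def obsFactor (θ : Param m) (z : ℤ → (Fin 2 → ℝ) × (Fin m → ℝ)) (t : ℤ) :
    (Fin 2 → ℕ) × (Fin m → ℝ) :=
  (observe (fun i => limsup (fun n => iter θ n z t i) atTop) (z t).1, (z t).2)

lemma obsFactor_shift (θ : Param m) (z : ℤ → (Fin 2 → ℝ) × (Fin m → ℝ)) :
    obsFactor θ (shift z) = shift (obsFactor θ z) := by
  funext t
  simp only [obsFactor, iter_shift, shift]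

lemma measurable_obsFactor (θ : Param m) : Measurable (obsFactor θ) := by
  refine measurable_pi_lambda _ fun t => ?_
  have h1 : Measurable fun z : ℤ → (Fin 2 → ℝ) × (Fin m → ℝ) => (z t).1 :=
    (measurable_pi_apply t).fst
  have h2 : Measurable fun z : ℤ → (Fin 2 → ℝ) × (Fin m → ℝ) => (z t).2 :=
    (measurable_pi_apply t).snd
  have h3 : Measurable fun z : ℤ → (Fin 2 → ℝ) × (Fin m → ℝ) =>
      fun i => limsup (fun n => iter θ n z t i) atTop :=
    measurable_pi_lambda _ fun i =>
      Measurable.limsup fun n => (measurable_pi_apply i).comp (measurable_iter θ n t)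
  exact (measurable_observe_comp h3 h1).prodMk h2

/-- The observations and the covariates form a stationary ergodic process. -/
theorem IsSolution.isStationaryErgodic (hUX : NoiseAssumption P U X)
    (hr : r₀ ∈ Set.Ioo (-1 : ℝ) 1) (hU : P.map (U 0) = gaussianCopula r₀)
    (hρ : specRad (contractionMatrix θ₀) < 1) (hY : IsSolution P U X θ₀ Y lam) :
    IsStationaryErgodic P (fun t ω => (Y t ω, X t ω)) := by
  refine hUX.1.of_factor (fun t => (hY.measurable_obs t).prodMk (hUX.measurable_covariate t))
    (measurable_obsFactor θ₀) (obsFactor_shift θ₀) fun t => ?_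
  filter_upwards [hY.ae_tendsto_iter hUX hr hU hρ t, hY.observation t] with ω h1 h2
  -- `obsFactor` uses a limsup so as to be defined and measurable on every path; almost surely it is
  -- a limit and equals the latent vector of the solution.
  have h3 : (fun i => limsup (fun n => iter θ₀ n (fun t => (U t ω, X t ω)) t i) atTop) =
      lam t ω := funext fun i => ((tendsto_pi_nhds.1 h1) i).limsup_eq
  rw [obsFactor, h3, h2]

end Solution

/-! ### Exponential moments -/

section Moments

/-- Fatou's lemma, used to carry moment bounds from iterates and partial sums to their limits. -/
lemma lintegral_le_of_ae_tendsto {Ω : Type*} [MeasurableSpace Ω] {P : Measure Ω}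
    {f : ℕ → Ω → ENNReal} {g : Ω → ENNReal} (hf : ∀ n, AEMeasurable (f n) P)
    (h : ∀ᵐ ω ∂P, Tendsto (fun n => f n ω) atTop (𝓝 (g ω))) {C : ENNReal}
    (hC : ∀ n, ∫⁻ ω, f n ω ∂P ≤ C) : ∫⁻ ω, g ω ∂P ≤ C := by
  calc ∫⁻ ω, g ω ∂P = ∫⁻ ω, liminf (fun n => f n ω) atTop ∂P := by
        refine lintegral_congr_ae ?_
        filter_upwards [h] with ω hω using hω.liminf_eq.symm
    _ ≤ liminf (fun n => ∫⁻ ω, f n ω ∂P) atTop := lintegral_liminf_le' hf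
    _ ≤ C := by
        refine (liminf_le_liminf (Eventually.of_forall hC)).trans_eq ?_
        simp

variable {Ω : Type*} [MeasurableSpace Ω] {P : Measure Ω} {m : ℕ}
  {U : ℤ → Ω → Fin 2 → ℝ} {X : ℤ → Ω → Fin m → ℝ} {Y : ℤ → Ω → Fin 2 → ℕ}
  {lam : ℤ → Ω → Fin 2 → ℝ} {θ₀ : Param m} {r₀ : ℝ}

lemma lintegral_covariate_lt_top (hUX : NoiseAssumption P U X)
    (hX : ∀ r : ℝ, 0 < r → Integrable (fun ω => Real.exp (r * ∑ i, |X 0 ω i|)) P) (t : ℤ)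
    {r : ℝ} (hr : 0 < r) (c : ℝ) :
    ∫⁻ ω, ENNReal.ofReal (Real.exp (r * ∑ i, |X t ω i| + c)) ∂P < ⊤ := by
  have hm : Measurable fun z : (Fin 2 → ℝ) × (Fin m → ℝ) =>
      ENNReal.ofReal (Real.exp (r * ∑ i, |z.2 i| + c)) := by fun_prop
  have h := hUX.1.isStationary.lintegral_eq hm t
  simp only at h
  rw [h]
  simp_rw [Real.exp_add]
  exact ((hX r hr).mul_const (Real.exp c)).lintegral_lt_top

variable [IsProbabilityMeasure P]

lemma one_add_exp_le (l : Fin 2 → ℝ) : 1 + Real.exp (l 1) ≤ 2 * Real.exp ‖l‖ := by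
  have h1 : Real.exp (l 1) ≤ Real.exp ‖l‖ :=
    Real.exp_le_exp.2 ((le_abs_self _).trans (norm_le_pi_norm l 1))
  have h2 : 1 ≤ Real.exp ‖l‖ := Real.one_le_exp (norm_nonneg _)
  linarith

/-- The moments of the second observation are controlled by the exponential moments of the latent
vector. -/
lemma NoiseAssumption.lintegral_observe_pow_le (hUX : NoiseAssumption P U X)
    (hr : r₀ ∈ Set.Ioo (-1 : ℝ) 1) (hU : P.map (U 0) = gaussianCopula r₀) {t : ℤ}
    {l : Ω → Fin 2 → ℝ} (hl : Measurable[past U X (t - 1)] l) (k : ℕ) :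
    ∫⁻ ω, ENNReal.ofReal ((1 + (observe (l ω) (U t ω) 1 : ℝ)) ^ k) ∂P ≤
      ENNReal.ofReal ((2 ^ k * 2) ^ k) * ∫⁻ ω, ENNReal.ofReal (Real.exp (k * ‖l ω‖)) ∂P := by
  have hm : Measurable fun p : (Fin 2 → ℝ) × (Fin 2 → ℝ) =>
      ENNReal.ofReal ((1 + (observe p.1 p.2 1 : ℝ)) ^ k) := by
    have h : Measurable fun y : Fin 2 → ℕ => ENNReal.ofReal ((1 + (y 1 : ℝ)) ^ k) :=
      measurable_of_countable _
    exact h.comp measurable_observe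
  rw [hUX.lintegral_eq (t := t) hr hU hl hm, ← lintegral_const_mul' _ _ ENNReal.ofReal_ne_top]
  refine lintegral_mono fun ω => ?_
  have hm2 : Measurable fun v => ENNReal.ofReal ((1 + (poissonQuantile (l ω 1) v : ℝ)) ^ k) :=
    (measurable_of_countable fun n : ℕ => ENNReal.ofReal ((1 + (n : ℝ)) ^ k)).comp
      (measurable_poissonQuantile_right (l ω 1))
  have h := (measurePreserving_eval_gaussianCopula hr 1).lintegral_comp hm2
  refine (h.le.trans ?_)
  have h2 := lintegral_poissonQuantile_moment_le (l ω 1) k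
  have h3 : ∀ n : ℕ, ENNReal.ofReal ((1 + (n : ℝ)) ^ k) = (1 + (n : ENNReal)) ^ k := fun n => by
    rw [ENNReal.ofReal_pow (by positivity), ENNReal.ofReal_add zero_le_one (by positivity)]
    simp
  simp only [h3]
  refine h2.trans ?_
  rw [← ENNReal.ofReal_mul (by positivity), Real.exp_nat_mul, ← mul_pow]
  refine ENNReal.ofReal_le_ofReal ?_
  refine pow_le_pow_left₀ (by positivity) ?_ k
  rw [mul_assoc]
  exact mul_le_mul_of_nonneg_left (one_add_exp_le (l ω)) (by positivity)

/-- A bound on one step of the recursion. -/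
lemma abs_step_le (θ : Param m) (l : Fin 2 → ℝ) {y : Fin 2 → ℕ} (hy : y 0 ≤ 1) (x : Fin m → ℝ)
    (i : Fin 2) : |step θ l y x i| ≤
      (∑ j, |(absVec (zeroFirstCol θ.A) + absVec θ.B) i j|) * max ‖l‖ (Real.log (1 + y 1)) +
        (∑ i, (|θ.d i| + |θ.A i 0|)) + (∑ i, ∑ j, |θ.Γ i j|) * ∑ j, |x j| := by
  set M := max ‖l‖ (Real.log (1 + y 1)) with hM
  have hl : ∀ j, |l j| ≤ M := fun j => (norm_le_pi_norm l j).trans (le_max_left _ _)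
  have hlog : |Real.log (1 + (y 1 : ℝ))| ≤ M := by
    rw [abs_of_nonneg (Real.log_nonneg (by linarith [(y 1).cast_nonneg (α := ℝ)]))]
    exact le_max_right _ _
  have hy' : |(y 0 : ℝ)| ≤ 1 := by
    rw [abs_of_nonneg (Nat.cast_nonneg _)]; exact_mod_cast hy
  have h1 : |θ.d i| + |θ.A i 0| ≤ ∑ i, (|θ.d i| + |θ.A i 0|) :=
    Finset.single_le_sum (f := fun i => |θ.d i| + |θ.A i 0|) (fun i _ => by positivity)
      (Finset.mem_univ i)
  have h2 : |∑ j, θ.Γ i j * x j| ≤ (∑ i, ∑ j, |θ.Γ i j|) * ∑ j, |x j| := by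
    calc |∑ j, θ.Γ i j * x j| ≤ ∑ j, |θ.Γ i j| * |x j| :=
          (Finset.abs_sum_le_sum_abs _ _).trans_eq (by simp only [abs_mul])
      _ ≤ ∑ j, |θ.Γ i j| * ∑ j, |x j| := by
          gcongr with j _
          exact Finset.single_le_sum (f := fun j => |x j|) (fun j _ => abs_nonneg _)
            (Finset.mem_univ j)
      _ ≤ _ := by
          rw [← Finset.sum_mul]
          gcongr
          exact Finset.single_le_sum (f := fun i => ∑ j, |θ.Γ i j|) (fun i _ => by positivity)
            (Finset.mem_univ i)
  have h3 : step θ l y x i = θ.d i + θ.A i 0 * y 0 + (θ.B i 0 * l 0 + θ.B i 1 * l 1 +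
      θ.A i 1 * Real.log (1 + y 1)) + ∑ j, θ.Γ i j * x j := by
    simp only [step, transf, Pi.add_apply, Matrix.mulVec, dotProduct, Fin.sum_univ_two,
      Matrix.cons_val_zero, Matrix.cons_val_one]
    ring
  have h4 : ∑ j, |(absVec (zeroFirstCol θ.A) + absVec θ.B) i j| =
      |θ.B i 0| + (|θ.A i 1| + |θ.B i 1|) := by
    simp only [Fin.sum_univ_two, Matrix.add_apply, absVec, zeroFirstCol, Matrix.map_apply,
      Matrix.of_apply, ↓reduceIte, abs_zero, zero_add, abs_abs, one_ne_zero]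
    rw [abs_of_nonneg (a := |θ.A i 1| + |θ.B i 1|) (by positivity)]
  rw [h3, h4]
  have e1 := abs_add_le (θ.d i + θ.A i 0 * y 0 + (θ.B i 0 * l 0 + θ.B i 1 * l 1 +
      θ.A i 1 * Real.log (1 + y 1))) (∑ j, θ.Γ i j * x j)
  have e2 := abs_add_le (θ.d i + θ.A i 0 * y 0) (θ.B i 0 * l 0 + θ.B i 1 * l 1 +
      θ.A i 1 * Real.log (1 + y 1))
  have e3 := abs_add_le (θ.d i) (θ.A i 0 * y 0)
  have e4 := abs_add_three (θ.B i 0 * l 0) (θ.B i 1 * l 1) (θ.A i 1 * Real.log (1 + y 1))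
  simp only [abs_mul] at e3 e4
  have e5 := mul_le_mul_of_nonneg_left hy' (abs_nonneg (θ.A i 0))
  have e6 := mul_le_mul_of_nonneg_left (hl 0) (abs_nonneg (θ.B i 0))
  have e7 := mul_le_mul_of_nonneg_left (hl 1) (abs_nonneg (θ.B i 1))
  have e8 := mul_le_mul_of_nonneg_left hlog (abs_nonneg (θ.A i 1))
  linarith

/-- Convexity of exp with weights w and 1 - w at the points p - c and (q + w c)/(1 - w). Since w <
1, the coefficient of exp p can be made as small as desired by enlarging the exponent of the term
that does not involve p. -/
lemma exp_convex_le {w p q c : ℝ} (hw0 : 0 ≤ w) (hw1 : w < 1) (hc : 0 ≤ c) :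
    Real.exp (w * p + q) ≤ Real.exp (-c) * Real.exp p + Real.exp ((q + c) / (1 - w)) := by
  have hw : 0 < 1 - w := by linarith
  have hcx := convexOn_exp.2 (Set.mem_univ (p - c)) (Set.mem_univ ((q + w * c) / (1 - w)))
    hw0 hw.le (by ring)
  simp only [smul_eq_mul] at hcx
  rw [mul_div_cancel₀ _ hw.ne', show w * (p - c) + (q + w * c) = w * p + q by ring] at hcx
  refine hcx.trans (add_le_add ?_ ?_)
  · rw [← Real.exp_add, show -c + p = p - c by ring]
    exact mul_le_of_le_one_left (Real.exp_pos _).le hw1.le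
  · refine (mul_le_of_le_one_left (Real.exp_pos _).le (by linarith)).trans (Real.exp_le_exp.2 ?_)
    gcongr
    nlinarith

lemma exp_mul_max_log_le (k : ℕ) (a : ℝ) {b : ℝ} (hb : 0 ≤ b) :
    Real.exp (k * max a (Real.log (1 + b))) ≤ Real.exp (k * a) + (1 + b) ^ k := by
  have h1 := Real.exp_pos (k * a)
  have h2 : 0 < (1 + b) ^ k := by positivity
  rcases max_cases a (Real.log (1 + b)) with ⟨h, _⟩ | ⟨h, _⟩ <;> rw [h]
  · linarith
  · rw [Real.exp_nat_mul, Real.exp_log (by linarith)]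
    linarith

lemma observe_zero_le (l u : Fin 2 → ℝ) : observe l u 0 ≤ 1 := bernoulliQuantile_le_one _ _

/-- The exponential moments of the iterates are bounded. -/
lemma exists_lintegral_exp_iter_le (hUX : NoiseAssumption P U X)
    (hr : r₀ ∈ Set.Ioo (-1 : ℝ) 1) (hU : P.map (U 0) = gaussianCopula r₀)
    (hX : ∀ r : ℝ, 0 < r → Integrable (fun ω => Real.exp (r * ∑ i, |X 0 ω i|)) P)
    (hnorm : ∀ i, ∑ j, |(absVec (zeroFirstCol θ₀.A) + absVec θ₀.B) i j| < 1) (k : ℕ) :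
    ∃ C : ENNReal, C < ⊤ ∧ ∀ n t,
      ∫⁻ ω, ENNReal.ofReal (Real.exp (k * ‖iter θ₀ n (fun t => (U t ω, X t ω)) t‖)) ∂P ≤ C := by
  obtain ⟨w, hw0, hw1, hw⟩ : ∃ w : ℝ, 0 ≤ w ∧ w < 1 ∧
      ∀ i, ∑ j, |(absVec (zeroFirstCol θ₀.A) + absVec θ₀.B) i j| ≤ w := by
    refine ⟨max (∑ j, |(absVec (zeroFirstCol θ₀.A) + absVec θ₀.B) 0 j|)
      (∑ j, |(absVec (zeroFirstCol θ₀.A) + absVec θ₀.B) 1 j|), ?_, max_lt (hnorm 0) (hnorm 1), ?_⟩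
    · exact le_max_of_le_left (by positivity)
    · rw [Fin.forall_fin_two]
      exact ⟨le_max_left _ _, le_max_right _ _⟩
  have hw1' : 0 < 1 - w := by linarith
  set D : ℝ := ∑ i, (|θ₀.d i| + |θ₀.A i 0|) with hD
  set γ : ℝ := ∑ i, ∑ j, |θ₀.Γ i j| with hγ
  have hD0 : 0 ≤ D := by positivity
  have hγ0 : 0 ≤ γ := by positivity
  -- R is the total cost of one step: 1 for the latent vector and the rest for the Poisson moment.
  -- The shift c = log(2R) then makes the recursion for the exponential moment contract with factor
  -- 1/2.
  set R : ℝ := 1 + (2 ^ k * 2) ^ k with hR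
  have hR0 : 0 < R := by positivity
  have hR1 : 1 ≤ R := by rw [hR]; linarith [show (0 : ℝ) ≤ (2 ^ k * 2) ^ k by positivity]
  set c : ℝ := Real.log (2 * R) with hc
  have hc0 : 0 ≤ c := Real.log_nonneg (by linarith)
  have hcR : Real.exp (-c) * R = 1 / 2 := by
    rw [Real.exp_neg, hc, Real.exp_log (by positivity)]
    field_simp
  -- The summand 1 makes ρ positive even when kγ = 0, as the exponential moment assumption requires.
  set ρ : ℝ := (k * γ + 1) / (1 - w) with hρ
  have hρ0 : 0 < ρ := by positivity
  set K : ENNReal := ∫⁻ ω, ENNReal.ofReal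
    (Real.exp (ρ * ∑ i, |X 0 ω i| + (k * D + c) / (1 - w))) ∂P with hK
  have hKtop : K < ⊤ := lintegral_covariate_lt_top hUX hX 0 hρ0 _
  have hKt : ∀ t, ∫⁻ ω, ENNReal.ofReal
      (Real.exp (ρ * ∑ i, |X t ω i| + (k * D + c) / (1 - w))) ∂P = K := fun t => by
    have hm : Measurable fun z : (Fin 2 → ℝ) × (Fin m → ℝ) =>
      ENNReal.ofReal (Real.exp (ρ * ∑ i, |z.2 i| + (k * D + c) / (1 - w))) := by fun_prop
    exact hUX.1.isStationary.lintegral_eq hm t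
  -- The recursion E' ≤ E/2 + K preserves the bound 1 + 2K, which holds initially because the
  -- iterate 0 has exponential moment 1.
  refine ⟨1 + 2 * K, ENNReal.add_lt_top.2 ⟨ENNReal.one_lt_top, ENNReal.mul_lt_top
    ENNReal.ofNat_lt_top hKtop⟩, fun n => ?_⟩
  induction n with
  | zero => intro t; simp [iter]
  | succ n ih =>
    intro t
    set l : Ω → Fin 2 → ℝ := fun ω => iter θ₀ n (fun t => (U t ω, X t ω)) (t - 1) with hl
    have hlm : Measurable[past U X (t - 1 - 1)] l := measurable_past_iter θ₀ n (t - 1)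
    have hlm' : Measurable l :=
      hlm.mono (past_le hUX.measurable_noise hUX.measurable_covariate _) le_rfl
    have hpt : ∀ ω, ENNReal.ofReal
        (Real.exp (k * ‖iter θ₀ (n + 1) (fun t => (U t ω, X t ω)) t‖)) ≤
        ENNReal.ofReal (Real.exp (-c)) * (ENNReal.ofReal (Real.exp (k * ‖l ω‖)) +
          ENNReal.ofReal ((1 + (observe (l ω) (U (t - 1) ω) 1 : ℝ)) ^ k)) +
        ENNReal.ofReal (Real.exp (ρ * ∑ i, |X (t - 1) ω i| + (k * D + c) / (1 - w))) := by
      intro ω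
      have hM0 : 0 ≤ max ‖l ω‖ (Real.log (1 + observe (l ω) (U (t - 1) ω) 1)) :=
        le_max_of_le_left (norm_nonneg _)
      have hx0 : 0 ≤ ∑ j, |X (t - 1) ω j| := by positivity
      have hle : ‖iter θ₀ (n + 1) (fun t => (U t ω, X t ω)) t‖ ≤
          w * max ‖l ω‖ (Real.log (1 + observe (l ω) (U (t - 1) ω) 1)) +
            (D + γ * ∑ j, |X (t - 1) ω j|) := by
        rw [pi_norm_le_iff_of_nonneg (by positivity)]
        intro i
        rw [Real.norm_eq_abs]
        refine (abs_step_le θ₀ (l ω) (observe_zero_le _ _) (X (t - 1) ω) i).trans ?_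
        rw [add_assoc]
        gcongr
        exact hw i
      rw [← ENNReal.ofReal_add (Real.exp_pos _).le (by positivity),
        ← ENNReal.ofReal_mul (Real.exp_pos _).le, ← ENNReal.ofReal_add (by positivity)
        (Real.exp_pos _).le]
      refine ENNReal.ofReal_le_ofReal ?_
      calc Real.exp (k * ‖iter θ₀ (n + 1) (fun t => (U t ω, X t ω)) t‖)
          ≤ Real.exp (w * (k * max ‖l ω‖ (Real.log (1 + observe (l ω) (U (t - 1) ω) 1))) +
              (k * (D + γ * ∑ j, |X (t - 1) ω j|))) := by
            rw [Real.exp_le_exp]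
            refine (mul_le_mul_of_nonneg_left hle k.cast_nonneg).trans_eq ?_
            ring
        _ ≤ _ := exp_convex_le hw0 hw1 hc0
        _ ≤ _ := by
            refine add_le_add (mul_le_mul_of_nonneg_left
              (exp_mul_max_log_le k _ (Nat.cast_nonneg _)) (Real.exp_pos _).le)
              (Real.exp_le_exp.2 ?_)
            rw [hρ, div_mul_eq_mul_div, ← add_div]
            refine div_le_div_of_nonneg_right ?_ hw1'.le
            have hS : 0 ≤ ∑ j, |X (t - 1) ω j| := by positivity
            nlinarith
    have hm1 : Measurable fun ω => ENNReal.ofReal (Real.exp (k * ‖l ω‖)) := by fun_prop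
    have hm2 : Measurable fun ω =>
        ENNReal.ofReal ((1 + (observe (l ω) (U (t - 1) ω) 1 : ℝ)) ^ k) :=
      (measurable_of_countable fun y : Fin 2 → ℕ => ENNReal.ofReal ((1 + (y 1 : ℝ)) ^ k)).comp
        (measurable_observe_comp hlm' (hUX.measurable_noise _))
    refine (lintegral_mono hpt).trans ?_
    have hm12 : Measurable fun ω => ENNReal.ofReal (Real.exp (k * ‖l ω‖)) +
        ENNReal.ofReal ((1 + (observe (l ω) (U (t - 1) ω) 1 : ℝ)) ^ k) := hm1.add hm2
    rw [lintegral_add_left (hm12.const_mul _), lintegral_const_mul _ hm12,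
      lintegral_add_left hm1, hKt]
    set E := ∫⁻ ω, ENNReal.ofReal (Real.exp (k * ‖l ω‖)) ∂P with hE
    have hobs := hUX.lintegral_observe_pow_le (t := t - 1) hr hU hlm k
    calc ENNReal.ofReal (Real.exp (-c)) * (E + ∫⁻ ω, ENNReal.ofReal
          ((1 + (observe (l ω) (U (t - 1) ω) 1 : ℝ)) ^ k) ∂P) + K
        ≤ ENNReal.ofReal (Real.exp (-c)) * (E + ENNReal.ofReal ((2 ^ k * 2) ^ k) * E) + K := by
          gcongr
      _ = ENNReal.ofReal (Real.exp (-c) * R) * E + K := by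
          rw [ENNReal.ofReal_mul (Real.exp_pos _).le, hR, ENNReal.ofReal_add zero_le_one
            (by positivity), ENNReal.ofReal_one]
          ring
      _ ≤ ENNReal.ofReal (1 / 2) * (1 + 2 * K) + K := by
          rw [hcR]
          gcongr
          exact ih (t - 1)
      _ = ENNReal.ofReal (1 / 2) + 2 * K := by
          have : ENNReal.ofReal (1 / 2) * 2 = 1 := by
            rw [← ENNReal.ofReal_ofNat 2, ← ENNReal.ofReal_mul (by norm_num)]
            norm_num
          rw [mul_add, mul_one, ← mul_assoc, this, one_mul, add_assoc, two_mul]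
      _ ≤ 1 + 2 * K := by
          gcongr
          rw [ENNReal.ofReal_le_one]
          norm_num

lemma IsSolution.lintegral_exp_latent_lt_top (hUX : NoiseAssumption P U X)
    (hr : r₀ ∈ Set.Ioo (-1 : ℝ) 1) (hU : P.map (U 0) = gaussianCopula r₀)
    (hX : ∀ r : ℝ, 0 < r → Integrable (fun ω => Real.exp (r * ∑ i, |X 0 ω i|)) P)
    (hρ : specRad (contractionMatrix θ₀) < 1)
    (hnorm : ∀ i, ∑ j, |(absVec (zeroFirstCol θ₀.A) + absVec θ₀.B) i j| < 1)
    (hY : IsSolution P U X θ₀ Y lam) (k : ℕ) (t : ℤ) :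
    ∫⁻ ω, ENNReal.ofReal (Real.exp (k * ‖lam t ω‖)) ∂P < ⊤ := by
  obtain ⟨C, hC, h⟩ := exists_lintegral_exp_iter_le hUX hr hU hX hnorm k
  refine (lintegral_le_of_ae_tendsto (f := fun n ω => ENNReal.ofReal
    (Real.exp (k * ‖iter θ₀ n (fun t => (U t ω, X t ω)) t‖))) (fun n => ?_) ?_
    fun n => h n t).trans_lt hC
  · have hm := (measurable_past_iter (U := U) (X := X) θ₀ n t).mono
      (past_le hUX.measurable_noise hUX.measurable_covariate _) le_rfl
    have : Measurable fun ω => ENNReal.ofReal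
        (Real.exp (k * ‖iter θ₀ n (fun t => (U t ω, X t ω)) t‖)) := by fun_prop
    exact this.aemeasurable
  · filter_upwards [hY.ae_tendsto_iter hUX hr hU hρ t] with ω hω
    exact (ENNReal.continuous_ofReal.tendsto _).comp
      ((Real.continuous_exp.tendsto _).comp (hω.norm.const_mul (k : ℝ)))

/-- All moments of the second observation are finite. -/
lemma IsSolution.lintegral_obs_pow_lt_top (hUX : NoiseAssumption P U X)
    (hr : r₀ ∈ Set.Ioo (-1 : ℝ) 1) (hU : P.map (U 0) = gaussianCopula r₀)
    (hX : ∀ r : ℝ, 0 < r → Integrable (fun ω => Real.exp (r * ∑ i, |X 0 ω i|)) P)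
    (hρ : specRad (contractionMatrix θ₀) < 1)
    (hnorm : ∀ i, ∑ j, |(absVec (zeroFirstCol θ₀.A) + absVec θ₀.B) i j| < 1)
    (hY : IsSolution P U X θ₀ Y lam) (k : ℕ) (t : ℤ) :
    ∫⁻ ω, ENNReal.ofReal ((1 + (Y t ω 1 : ℝ)) ^ k) ∂P < ⊤ := by
  have h1 := hUX.lintegral_observe_pow_le hr hU (hY.measurable_past_step t) k
  have h2 : ∫⁻ ω, ENNReal.ofReal ((1 + (Y t ω 1 : ℝ)) ^ k) ∂P =
      ∫⁻ ω, ENNReal.ofReal ((1 + (observe (step θ₀ (lam (t - 1) ω) (Y (t - 1) ω) (X (t - 1) ω))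
        (U t ω) 1 : ℝ)) ^ k) ∂P := by
    refine lintegral_congr_ae ?_
    filter_upwards [hY.latent t, hY.observation t] with ω e1 e2
    rw [e2, e1]
  have h3 : ∫⁻ ω, ENNReal.ofReal (Real.exp (k * ‖step θ₀ (lam (t - 1) ω) (Y (t - 1) ω)
      (X (t - 1) ω)‖)) ∂P = ∫⁻ ω, ENNReal.ofReal (Real.exp (k * ‖lam t ω‖)) ∂P := by
    refine lintegral_congr_ae ?_
    filter_upwards [hY.latent t] with ω e1
    rw [e1]
  rw [h2]
  refine h1.trans_lt (ENNReal.mul_lt_top ENNReal.ofReal_lt_top ?_)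
  rw [h3]
  exact hY.lintegral_exp_latent_lt_top hUX hr hU hX hρ hnorm k t

/-- The size of an observation and of a covariate vector. -/
def obsSize (v : (Fin 2 → ℕ) × (Fin m → ℝ)) : ℝ :=
  1 + (v.1 0 : ℝ) + Real.log (1 + (v.1 1 : ℝ)) + ∑ i, |v.2 i|

lemma log_one_add_natCast_nonneg (n : ℕ) : 0 ≤ Real.log (1 + (n : ℝ)) :=
  Real.log_nonneg (by linarith [n.cast_nonneg (α := ℝ)])

lemma one_le_obsSize (v : (Fin 2 → ℕ) × (Fin m → ℝ)) : 1 ≤ obsSize v := by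
  have h1 := (v.1 0).cast_nonneg (α := ℝ)
  have h2 := log_one_add_natCast_nonneg (v.1 1)
  have h3 : 0 ≤ ∑ i, |v.2 i| := by positivity
  unfold obsSize
  linarith

lemma measurable_obsSize : Measurable (obsSize (m := m)) := by
  have h : Measurable fun v : (Fin 2 → ℕ) × (Fin m → ℝ) =>
      1 + (v.1 0 : ℝ) + Real.log (1 + (v.1 1 : ℝ)) :=
    (measurable_of_countable fun y : Fin 2 → ℕ =>
      1 + (y 0 : ℝ) + Real.log (1 + (y 1 : ℝ))).comp measurable_fst
  have h2 : Measurable fun v : (Fin 2 → ℕ) × (Fin m → ℝ) => ∑ i, |v.2 i| := by fun_prop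
  exact h.add h2

/-- The exponential of a logarithm is a power, so only moments of the count appear. The first
observation is at most 1, and the product with the covariate factor is split by a b ≤ a² + b²,
whence the exponents 2k. The additional 1 keeps the covariate exponent positive. -/
lemma IsSolution.lintegral_exp_obsSize_lt_top (hUX : NoiseAssumption P U X)
    (hr : r₀ ∈ Set.Ioo (-1 : ℝ) 1) (hU : P.map (U 0) = gaussianCopula r₀)
    (hX : ∀ r : ℝ, 0 < r → Integrable (fun ω => Real.exp (r * ∑ i, |X 0 ω i|)) P)
    (hρ : specRad (contractionMatrix θ₀) < 1)
    (hnorm : ∀ i, ∑ j, |(absVec (zeroFirstCol θ₀.A) + absVec θ₀.B) i j| < 1)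
    (hY : IsSolution P U X θ₀ Y lam) (c : ℝ) :
    ∫⁻ ω, ENNReal.ofReal (Real.exp (c * obsSize (Y 0 ω, X 0 ω))) ∂P < ⊤ := by
  obtain ⟨k, hk⟩ := exists_nat_ge c
  have hk1 : (0 : ℝ) < 2 * k + 1 := by positivity
  have h1 := hY.lintegral_obs_pow_lt_top hUX hr hU hX hρ hnorm (2 * k) 0
  have h2 := lintegral_covariate_lt_top hUX hX 0 hk1 0
  have hm : Measurable fun ω => ENNReal.ofReal ((1 + (Y 0 ω 1 : ℝ)) ^ (2 * k)) :=
    (measurable_of_countable fun y : Fin 2 → ℕ => ENNReal.ofReal ((1 + (y 1 : ℝ)) ^ (2 * k))).comp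
      (hY.measurable_obs 0)
  have hpt : ∀ᵐ ω ∂P, ENNReal.ofReal (Real.exp (c * obsSize (Y 0 ω, X 0 ω))) ≤
      ENNReal.ofReal (Real.exp (2 * k)) * (ENNReal.ofReal ((1 + (Y 0 ω 1 : ℝ)) ^ (2 * k)) +
        ENNReal.ofReal (Real.exp ((2 * k + 1) * ∑ i, |X 0 ω i| + 0))) := by
    filter_upwards [hY.observation 0] with ω e
    have hy0 : (Y 0 ω 0 : ℝ) ≤ 1 := by
      rw [e]; exact_mod_cast observe_zero_le _ _
    have hs := one_le_obsSize (Y 0 ω, X 0 ω)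
    have hx0 : 0 ≤ ∑ i, |X 0 ω i| := by positivity
    rw [← ENNReal.ofReal_add (by positivity) (Real.exp_pos _).le,
      ← ENNReal.ofReal_mul (Real.exp_pos _).le]
    refine ENNReal.ofReal_le_ofReal ?_
    have e1 : Real.exp (c * obsSize (Y 0 ω, X 0 ω)) ≤ Real.exp (2 * k) *
        ((1 + (Y 0 ω 1 : ℝ)) ^ k * Real.exp (k * ∑ i, |X 0 ω i|)) := by
      have hb : (0 : ℝ) < 1 + (Y 0 ω 1 : ℝ) := by positivity
      rw [← Real.exp_log hb, ← Real.exp_nat_mul, ← Real.exp_add, ← Real.exp_add, Real.exp_le_exp]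
      have : c * obsSize (Y 0 ω, X 0 ω) ≤ k * obsSize (Y 0 ω, X 0 ω) := by gcongr
      refine this.trans ?_
      simp only [obsSize]
      nlinarith [k.cast_nonneg (α := ℝ)]
    refine e1.trans ?_
    gcongr
    have e2 : (Real.exp (k * ∑ i, |X 0 ω i|)) ^ 2 ≤
        Real.exp ((2 * k + 1) * ∑ i, |X 0 ω i| + 0) := by
      rw [← Real.exp_nat_mul, Real.exp_le_exp]
      push_cast
      nlinarith
    have e3 : ((1 + (Y 0 ω 1 : ℝ)) ^ k) ^ 2 = (1 + (Y 0 ω 1 : ℝ)) ^ (2 * k) := by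
      rw [← pow_mul, mul_comm]
    rw [← e3]
    nlinarith [sq_nonneg ((1 + (Y 0 ω 1 : ℝ)) ^ k - Real.exp (k * ∑ i, |X 0 ω i|)),
      sq_nonneg ((1 + (Y 0 ω 1 : ℝ)) ^ k), sq_nonneg (Real.exp (k * ∑ i, |X 0 ω i|))]
  refine (lintegral_mono_ae hpt).trans_lt ?_
  rw [lintegral_const_mul' _ _ ENNReal.ofReal_ne_top, lintegral_add_left hm]
  exact ENNReal.mul_lt_top ENNReal.ofReal_lt_top (ENNReal.add_lt_top.2 ⟨h1, h2⟩)

end Moments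

/-! ### Geometric moving averages of a stationary process -/

section GeomSum

/-- The geometric moving average `∑_{j ≥ 0} κ^j s_{t-1-j}`. -/
def geomSum (κ : ℝ) (s : ℤ → ℝ) (t : ℤ) : ℝ := ∑' j : ℕ, κ ^ j * s (t - 1 - j)

variable {Ω : Type*} [MeasurableSpace Ω] {P : Measure Ω} {s : ℤ → Ω → ℝ}

lemma ae_summable_geom (hs : IsStationary P s) (hint : Integrable (s 0) P) {κ : ℝ} (hκ0 : 0 ≤ κ)
    (hκ1 : κ < 1) : ∀ᵐ ω ∂P, ∀ t : ℤ, Summable fun j : ℕ => κ ^ j * s (t - 1 - j) ω := by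
  rw [ae_all_iff]
  intro t
  have h0 : 0 ≤ ∫ ω, |s 0 ω| ∂P := integral_nonneg fun ω => abs_nonneg _
  refine ae_summable_of_lintegral_le (f := fun j ω => κ ^ j * s (t - 1 - j) ω)
    (fun j => ((hs.1 _).const_mul _).aemeasurable) hκ0 hκ1 h0 fun j => ?_
  have hm : Measurable fun x : ℝ => ENNReal.ofReal |x| := by fun_prop
  simp_rw [abs_mul, abs_of_nonneg (pow_nonneg hκ0 j), ENNReal.ofReal_mul (pow_nonneg hκ0 j)]
  rw [lintegral_const_mul' _ _ ENNReal.ofReal_ne_top, hs.lintegral_eq hm,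
    ← ofReal_integral_eq_lintegral_ofReal hint.abs (Eventually.of_forall fun ω => abs_nonneg _),
    ← ENNReal.ofReal_mul (pow_nonneg hκ0 j), mul_comm]

/-- The partial sums satisfy S_{n+1}(t) = s_{t-1} + κ S_n(t-1), a convex combination of
s_{t-1}/(1-κ) and S_n(t-1). By convexity of exp and stationarity the bound K, the exponential moment
of s/(1-κ), is preserved from n to n + 1. No independence is involved. -/
lemma lintegral_exp_geomSum_lt_top [IsProbabilityMeasure P] (hs : IsStationary P s) (hs0 : ∀ t ω, 0 ≤ s t ω)
    (hexp : ∀ c : ℝ, ∫⁻ ω, ENNReal.ofReal (Real.exp (c * s 0 ω)) ∂P < ⊤) {κ : ℝ} (hκ0 : 0 ≤ κ)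
    (hκ1 : κ < 1) {c : ℝ} (hc : 0 ≤ c) (t : ℤ) :
    ∫⁻ ω, ENNReal.ofReal (Real.exp (c * geomSum κ (fun t => s t ω) t)) ∂P < ⊤ := by
  have hκ : 0 < 1 - κ := by linarith
  have hint : Integrable (s 0) P := by
    refine ⟨(hs.1 0).aestronglyMeasurable, ?_⟩
    rw [hasFiniteIntegral_iff_ofReal (Eventually.of_forall fun ω => hs0 0 ω)]
    refine (lintegral_mono fun ω => ENNReal.ofReal_le_ofReal ?_).trans_lt (hexp 1)
    rw [one_mul]
    linarith [Real.add_one_le_exp (s 0 ω)]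
  set K : ENNReal := ∫⁻ ω, ENNReal.ofReal (Real.exp (c / (1 - κ) * s 0 ω)) ∂P with hK
  have hm : Measurable fun x : ℝ => ENNReal.ofReal (Real.exp (c / (1 - κ) * x)) := by fun_prop
  have hKt : ∀ t, ∫⁻ ω, ENNReal.ofReal (Real.exp (c / (1 - κ) * s t ω)) ∂P = K :=
    fun t => hs.lintegral_eq hm t
  have hK1 : 1 ≤ K := by
    rw [hK]
    calc (1 : ENNReal) = ∫⁻ _, 1 ∂P := by simp
      _ ≤ _ := by
        refine lintegral_mono fun ω => ?_
        rw [← ENNReal.ofReal_one]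
        exact ENNReal.ofReal_le_ofReal (Real.one_le_exp (mul_nonneg (by positivity) (hs0 0 ω)))
  have hbd : ∀ (n : ℕ) (t : ℤ), ∫⁻ ω, ENNReal.ofReal
      (Real.exp (c * ∑ j ∈ Finset.range n, κ ^ j * s (t - 1 - j) ω)) ∂P ≤ K := by
    intro n
    induction n with
    | zero => intro t; simpa using hK1
    | succ n ih =>
      intro t
      have hmS : Measurable fun ω => ENNReal.ofReal (Real.exp (c / (1 - κ) * s (t - 1) ω)) :=
        hm.comp (hs.1 _)
      have hpt : ∀ ω, ENNReal.ofReal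
          (Real.exp (c * ∑ j ∈ Finset.range (n + 1), κ ^ j * s (t - 1 - j) ω)) ≤
          ENNReal.ofReal (1 - κ) * ENNReal.ofReal (Real.exp (c / (1 - κ) * s (t - 1) ω)) +
          ENNReal.ofReal κ * ENNReal.ofReal
            (Real.exp (c * ∑ j ∈ Finset.range n, κ ^ j * s (t - 1 - 1 - j) ω)) := by
        intro ω
        rw [← ENNReal.ofReal_mul hκ.le, ← ENNReal.ofReal_mul hκ0,
          ← ENNReal.ofReal_add (by positivity) (by positivity)]
        refine ENNReal.ofReal_le_ofReal ?_
        have hcx := convexOn_exp.2 (Set.mem_univ (c / (1 - κ) * s (t - 1) ω))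
          (Set.mem_univ (c * ∑ j ∈ Finset.range n, κ ^ j * s (t - 1 - 1 - j) ω))
          hκ.le hκ0 (by ring)
        simp only [smul_eq_mul] at hcx
        refine le_trans (le_of_eq ?_) hcx
        congr 1
        rw [Finset.sum_range_succ']
        have hsh : ∀ j : ℕ, s (t - 1 - ((j + 1 : ℕ) : ℤ)) ω = s (t - 1 - 1 - j) ω := fun j => by
          congr 1; push_cast; ring
        simp only [hsh, pow_succ', pow_zero, Nat.cast_zero, sub_zero, one_mul, mul_assoc]
        rw [← Finset.mul_sum]
        field_simp
        ring
      refine (lintegral_mono hpt).trans ?_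
      rw [lintegral_add_left (hmS.const_mul _), lintegral_const_mul' _ _ ENNReal.ofReal_ne_top,
        lintegral_const_mul' _ _ ENNReal.ofReal_ne_top, hKt]
      calc _ ≤ ENNReal.ofReal (1 - κ) * K + ENNReal.ofReal κ * K := by
            gcongr
            exact ih (t - 1)
        _ = K := by
            rw [← add_mul, ← ENNReal.ofReal_add hκ.le hκ0, sub_add_cancel, ENNReal.ofReal_one,
              one_mul]
  refine (lintegral_le_of_ae_tendsto (C := K) (f := fun n ω => ENNReal.ofReal
    (Real.exp (c * ∑ j ∈ Finset.range n, κ ^ j * s (t - 1 - j) ω))) (fun n => ?_) ?_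
    fun n => hbd n t).trans_lt (hexp _)
  · have h : Measurable fun ω => ∑ j ∈ Finset.range n, κ ^ j * s (t - 1 - j) ω :=
      Finset.measurable_fun_sum _ fun j _ => (hs.1 _).const_mul _
    have : Measurable fun ω => ENNReal.ofReal
        (Real.exp (c * ∑ j ∈ Finset.range n, κ ^ j * s (t - 1 - j) ω)) := by fun_prop
    exact this.aemeasurable
  · filter_upwards [ae_summable_geom hs hint hκ0 hκ1] with ω hω
    exact (ENNReal.continuous_ofReal.tendsto _).comp ((Real.continuous_exp.tendsto _).comp
      (((hω t).hasSum.tendsto_sum_nat).const_mul c))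

end GeomSum

/-! ### The latent process as a function of the path of the data -/

section Latent

variable {m : ℕ}

/-- The paths of the observations and of the covariates. -/
abbrev DataPath (m : ℕ) : Type := ℤ → (Fin 2 → ℕ) × (Fin m → ℝ)

/-- The innovation `d + A ȳ + Γ x` of the latent recursion. -/
def latentTerm (θ : Param m) (v : (Fin 2 → ℕ) × (Fin m → ℝ)) : Fin 2 → ℝ :=
  θ.d + θ.A.mulVec (transf v.1) + θ.Γ.mulVec v.2

/-- The latent process along a path of the data. -/
def pathLatent (θ : Param m) (z : DataPath m) (t : ℤ) : Fin 2 → ℝ :=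
  latent θ (fun s => (z s).1) (fun s => (z s).2) t

lemma pathLatent_eq (θ : Param m) (z : DataPath m) (t : ℤ) :
    pathLatent θ z t = ∑' j : ℕ, (θ.B ^ j).mulVec (latentTerm θ (z (t - 1 - j))) := rfl

lemma pathLatent_shift_iterate (θ : Param m) (z : DataPath m) (n : ℕ) (t : ℤ) :
    pathLatent θ (shift^[n] z) t = pathLatent θ z (t + n) := by
  simp only [pathLatent_eq, shift_iterate]
  refine tsum_congr fun j => ?_
  congr 3
  ring

lemma step_eq (θ : Param m) (l : Fin 2 → ℝ) (v : (Fin 2 → ℕ) × (Fin m → ℝ)) :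
    step θ l v.1 v.2 = θ.B.mulVec l + latentTerm θ v := by
  simp only [step, latentTerm]
  abel

/-- A uniform geometric bound on the terms of the latent processes of the parameters in `Θ`. -/
structure GeomBound (Θ : Set (Param m)) (C κ : ℝ) : Prop where
  pos : 0 < C
  rate_pos : 0 < κ
  rate_lt_one : κ < 1
  mulVec_le : ∀ θ ∈ Θ, ∀ (j : ℕ) (l : Fin 2 → ℝ), ‖(θ.B ^ j).mulVec l‖ ≤ C * κ ^ j * ‖l‖
  term_le : ∀ θ ∈ Θ, ∀ (j : ℕ) v,
    ‖(θ.B ^ j).mulVec (latentTerm θ v)‖ ≤ C * (κ ^ j * obsSize v)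

lemma norm_mulVec_le {M : Matrix (Fin 2) (Fin 2) ℝ} {c : ℝ} (hM : ∀ i, ∑ k, |M i k| ≤ c)
    (l : Fin 2 → ℝ) : ‖M.mulVec l‖ ≤ c * ‖l‖ := by
  have hc : 0 ≤ c := (Finset.sum_nonneg fun k _ => abs_nonneg _).trans (hM 0)
  refine (pi_norm_le_iff_of_nonneg (by positivity)).2 fun i => ?_
  rw [Matrix.mulVec, dotProduct, Real.norm_eq_abs]
  refine (Finset.abs_sum_le_sum_abs _ _).trans ?_
  refine le_trans ?_ (mul_le_mul_of_nonneg_right (hM i) (norm_nonneg l))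
  rw [Finset.sum_mul]
  refine Finset.sum_le_sum fun k _ => ?_
  rw [abs_mul]
  exact mul_le_mul_of_nonneg_left (norm_le_pi_norm l k) (abs_nonneg _)

lemma norm_latentTerm_le (θ : Param m) (v : (Fin 2 → ℕ) × (Fin m → ℝ)) :
    ‖latentTerm θ v‖ ≤ (∑ i, (|θ.d i| + |θ.A i 0| + |θ.A i 1| + ∑ j, |θ.Γ i j|)) * obsSize v := by
  have hs := one_le_obsSize v
  refine (pi_norm_le_iff_of_nonneg (mul_nonneg (by positivity) (by linarith))).2 fun i => ?_
  have h0 : |θ.d i| + |θ.A i 0| + |θ.A i 1| + ∑ j, |θ.Γ i j| ≤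
      ∑ i, (|θ.d i| + |θ.A i 0| + |θ.A i 1| + ∑ j, |θ.Γ i j|) :=
    Finset.single_le_sum (f := fun i => |θ.d i| + |θ.A i 0| + |θ.A i 1| + ∑ j, |θ.Γ i j|)
      (fun i _ => by positivity) (Finset.mem_univ i)
  refine le_trans ?_ (mul_le_mul_of_nonneg_right h0 (by linarith))
  have hl := log_one_add_natCast_nonneg (v.1 1)
  have hy := (v.1 0).cast_nonneg (α := ℝ)
  have hx : 0 ≤ ∑ j, |v.2 j| := by positivity
  have hG : |∑ j, θ.Γ i j * v.2 j| ≤ (∑ j, |θ.Γ i j|) * obsSize v := by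
    refine (Finset.abs_sum_le_sum_abs _ _).trans ?_
    rw [Finset.sum_mul]
    refine Finset.sum_le_sum fun j _ => ?_
    rw [abs_mul]
    refine mul_le_mul_of_nonneg_left ?_ (abs_nonneg _)
    have := Finset.single_le_sum (f := fun j => |v.2 j|) (fun j _ => abs_nonneg _)
      (Finset.mem_univ j)
    simp only [obsSize]
    linarith
  have e : latentTerm θ v i = θ.d i + (θ.A i 0 * (v.1 0 : ℝ) +
      θ.A i 1 * Real.log (1 + (v.1 1 : ℝ))) + ∑ j, θ.Γ i j * v.2 j := by
    simp only [latentTerm, Pi.add_apply, Matrix.mulVec, dotProduct, Fin.sum_univ_two, transf,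
      Matrix.cons_val_zero, Matrix.cons_val_one]
  have hA0 : |θ.A i 0 * (v.1 0 : ℝ)| ≤ |θ.A i 0| * obsSize v := by
    rw [abs_mul, abs_of_nonneg hy]
    refine mul_le_mul_of_nonneg_left ?_ (abs_nonneg _)
    simp only [obsSize]; linarith
  have hA1 : |θ.A i 1 * Real.log (1 + (v.1 1 : ℝ))| ≤ |θ.A i 1| * obsSize v := by
    rw [abs_mul, abs_of_nonneg hl]
    refine mul_le_mul_of_nonneg_left ?_ (abs_nonneg _)
    simp only [obsSize]; linarith
  have hd : |θ.d i| ≤ |θ.d i| * obsSize v := le_mul_of_one_le_right (abs_nonneg _) hs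
  rw [Real.norm_eq_abs, e]
  calc _ ≤ |θ.d i| + (|θ.A i 0 * (v.1 0 : ℝ)| + |θ.A i 1 * Real.log (1 + (v.1 1 : ℝ))|) +
        |∑ j, θ.Γ i j * v.2 j| :=
      (abs_add_le _ _).trans (add_le_add_left ((abs_add_le _ _).trans
        (add_le_add_right (abs_add_le _ _) _)) _)
    _ ≤ _ := by linarith

lemma continuous_param_d : Continuous fun θ : Param m => θ.d := continuous_fst

lemma continuous_param_Γ : Continuous fun θ : Param m => θ.Γ := continuous_snd.fst

lemma continuous_param_A : Continuous fun θ : Param m => θ.A := continuous_snd.snd.fst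

lemma continuous_param_B : Continuous fun θ : Param m => θ.B := continuous_snd.snd.snd

lemma exists_geomBound {Θ : Set (Param m)} (hΘ : IsCompact Θ)
    (hB : ∀ θ ∈ Θ, specRad θ.B < 1) : ∃ C κ, GeomBound Θ C κ := by
  obtain ⟨C, κ, hC, hκ0, hκ1, h⟩ := exists_rowSum_pow_le (hΘ.image continuous_param_B)
    (by rintro _ ⟨θ, hθ, rfl⟩; exact hB θ hθ)
  have hf : Continuous fun θ : Param m =>
      ∑ i, (|θ.d i| + |θ.A i 0| + |θ.A i 1| + ∑ j, |θ.Γ i j|) := by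
    have h1 := continuous_param_d (m := m)
    have h2 := continuous_param_A (m := m)
    have h3 := continuous_param_Γ (m := m)
    refine continuous_finsetSum _ fun i _ => (((((continuous_apply i).comp h1).abs).add
      (h2.matrix_elem i 0).abs).add (h2.matrix_elem i 1).abs).add
      (continuous_finsetSum _ fun j _ => (h3.matrix_elem i j).abs)
  obtain ⟨D, hD⟩ := hΘ.exists_bound_of_continuousOn hf.continuousOn
  -- The factor |D| + 1 bounds all the coefficients over the compact set and is at least 1, so one
  -- constant serves both estimates of `GeomBound`.
  refine ⟨C * (|D| + 1), κ, by positivity, hκ0, hκ1, fun θ hθ j l => ?_, fun θ hθ j v => ?_⟩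
  · refine (norm_mulVec_le (h _ ⟨θ, hθ, rfl⟩ j) l).trans ?_
    refine mul_le_mul_of_nonneg_right ?_ (norm_nonneg l)
    refine mul_le_mul_of_nonneg_right ?_ (by positivity)
    exact le_mul_of_one_le_right hC.le (by linarith [abs_nonneg D])
  · refine (norm_mulVec_le (h _ ⟨θ, hθ, rfl⟩ j) _).trans ?_
    have h1 : ‖latentTerm θ v‖ ≤ (|D| + 1) * obsSize v := by
      refine (norm_latentTerm_le θ v).trans (mul_le_mul_of_nonneg_right ?_ ?_)
      · linarith [le_abs_self D, (le_abs_self _).trans (hD θ hθ)]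
      · linarith [one_le_obsSize v]
    calc C * κ ^ j * ‖latentTerm θ v‖ ≤ C * κ ^ j * ((|D| + 1) * obsSize v) := by gcongr
      _ = _ := by ring

/-- The paths along which the geometric moving averages of the sizes of the data converge. -/
def Tame (κ : ℝ) (z : DataPath m) : Prop :=
  ∀ t : ℤ, Summable fun j : ℕ => κ ^ j * obsSize (z (t - 1 - j))

variable {Θ : Set (Param m)} {C κ : ℝ} {θ : Param m} {z : DataPath m}

lemma GeomBound.summable (hb : GeomBound Θ C κ) (hθ : θ ∈ Θ) (hz : Tame κ z) (t : ℤ) :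
    Summable fun j : ℕ => (θ.B ^ j).mulVec (latentTerm θ (z (t - 1 - j))) :=
  Summable.of_norm_bounded ((hz t).mul_left C) fun j => hb.term_le θ hθ j _

lemma GeomBound.norm_pathLatent_le (hb : GeomBound Θ C κ) (hθ : θ ∈ Θ) (hz : Tame κ z) (t : ℤ) :
    ‖pathLatent θ z t‖ ≤ C * geomSum κ (fun t => obsSize (z t)) t :=
  tsum_of_norm_bounded ((hz t).hasSum.mul_left C) fun j => hb.term_le θ hθ j _

lemma GeomBound.pathLatent_succ (hb : GeomBound Θ C κ) (hθ : θ ∈ Θ) (hz : Tame κ z) (t : ℤ) :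
    pathLatent θ z (t + 1) = step θ (pathLatent θ z t) (z t).1 (z t).2 := by
  rw [step_eq, pathLatent_eq, (hb.summable hθ hz (t + 1)).tsum_eq_zero_add, add_comm]
  congr 1
  · have hc : Continuous fun l : Fin 2 → ℝ => θ.B.mulVec l :=
      Continuous.matrix_mulVec continuous_const continuous_id
    have h := (hb.summable hθ hz t).map_tsum (Matrix.mulVecLin θ.B) hc
    rw [Matrix.mulVecLin_apply] at h
    rw [pathLatent_eq, h]
    refine tsum_congr fun j => ?_
    rw [Matrix.mulVecLin_apply, Matrix.mulVec_mulVec, ← pow_succ']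
    congr 3
    push_cast
    ring
  · simp

lemma GeomBound.continuousOn_pathLatent (hb : GeomBound Θ C κ) (hz : Tame κ z) (t : ℤ) :
    ContinuousOn (fun θ => pathLatent θ z t) Θ := by
  refine continuousOn_tsum (fun j => Continuous.continuousOn ?_) ((hz t).mul_left C)
    fun j θ hθ => hb.term_le θ hθ j _
  refine Continuous.matrix_mulVec (continuous_param_B.pow j) ?_
  exact (continuous_param_d.add (continuous_param_A.matrix_mulVec continuous_const)).add
    (continuous_param_Γ.matrix_mulVec continuous_const)

/-- The effect of the initial value on the latent process vanishes at a geometric rate. -/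
lemma GeomBound.latentInit_sub (hb : GeomBound Θ C κ) (hθ : θ ∈ Θ) (hz : Tame κ z)
    (l₀ : Fin 2 → ℝ) (t : ℕ) :
    latentInit l₀ θ (fun s => (z s).1) (fun s => (z s).2) t - pathLatent θ z t =
      (θ.B ^ t).mulVec (l₀ - pathLatent θ z 0) := by
  induction t with
  | zero => simp [latentInit]
  | succ t ih =>
    have h1 := hb.pathLatent_succ hθ hz t
    push_cast
    rw [h1, latentInit, step_eq, step_eq θ _ (z t), add_sub_add_right_eq_sub, ← Matrix.mulVec_sub,
      ih, Matrix.mulVec_mulVec, ← pow_succ']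

lemma measurable_latentTerm (θ : Param m) : Measurable (latentTerm θ) := by
  have h2 : Measurable fun v : (Fin 2 → ℕ) × (Fin m → ℝ) => θ.A.mulVec (transf v.1) :=
    (measurable_of_countable fun y : Fin 2 → ℕ => θ.A.mulVec (transf y)).comp measurable_fst
  have h3 : Measurable fun v : (Fin 2 → ℕ) × (Fin m → ℝ) => θ.Γ.mulVec v.2 :=
    (Continuous.matrix_mulVec continuous_const continuous_snd).measurable
  exact (h2.const_add θ.d).add h3

/-- In finite dimension summability is absolute summability, a measurable condition. On that set the
sum is the limit of the partial sums; elsewhere `tsum` is 0 by convention. -/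
lemma measurable_tsum_of_finiteDimensional {α E : Type*} {mα : MeasurableSpace α}
    [NormedAddCommGroup E] [NormedSpace ℝ E] [FiniteDimensional ℝ E] [MeasurableSpace E]
    [BorelSpace E] [SecondCountableTopology E] {f : ℕ → α → E}
    (hf : ∀ j, Measurable (f j)) : Measurable fun a => ∑' j, f j a := by
  classical
  set S : Set α := {a | ∑' j, ENNReal.ofReal ‖f j a‖ < ⊤} with hS
  have hSm : MeasurableSet S :=
    measurableSet_lt (Measurable.tsum fun j => (hf j).norm.ennreal_ofReal) measurable_const
  have hSs : ∀ a, a ∈ S ↔ Summable fun j => f j a := by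
    intro a
    rw [← summable_norm_iff]
    constructor
    · intro h
      have h1 := ENNReal.summable_toReal (show ∑' j, ENNReal.ofReal ‖f j a‖ ≠ ⊤ from h.ne)
      simpa only [ENNReal.toReal_ofReal (norm_nonneg _)] using h1
    · intro h
      exact h.tsum_ofReal_lt_top
  refine measurable_of_tendsto_metrizable
    (f := fun n a => S.indicator (fun a => ∑ j ∈ Finset.range n, f j a) a)
    (fun n => (Finset.measurable_fun_sum _ fun j _ => hf j).indicator hSm) ?_
  rw [tendsto_pi_nhds]
  intro a
  by_cases ha : a ∈ S
  · simp only [Set.indicator_of_mem ha]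
    exact ((hSs a).1 ha).hasSum.tendsto_sum_nat
  · simp only [Set.indicator_of_notMem ha]
    rw [tsum_eq_zero_of_not_summable (fun h => ha ((hSs a).2 h))]
    exact tendsto_const_nhds

lemma measurable_pathLatent (θ : Param m) (t : ℤ) : Measurable fun z => pathLatent θ z t := by
  refine measurable_tsum_of_finiteDimensional fun j => ?_
  have hc : Continuous fun l : Fin 2 → ℝ => (θ.B ^ j).mulVec l :=
    Continuous.matrix_mulVec continuous_const continuous_id
  exact hc.measurable.comp ((measurable_latentTerm θ).comp (measurable_pi_apply (t - 1 - j)))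

end Latent

/-! ### Recovery of the latent process of the solution from the data -/

section LatentSolution

lemma IsStationary.comp {Ω S : Type*} [MeasurableSpace Ω] [MeasurableSpace S] {P : Measure Ω}
    {Z : ℤ → Ω → S} (h : IsStationary P Z) {S' : Type*} [MeasurableSpace S'] {φ : S → S'}
    (hφ : Measurable φ) : IsStationary P fun t ω => φ (Z t ω) := by
  refine ⟨fun t => hφ.comp (h.1 t), measurable_shift, ?_⟩
  have hm : Measurable fun ω t => Z t ω := measurable_pi_lambda _ h.1
  have hψ : Measurable fun (z : ℤ → S) t => φ (z t) :=
    measurable_pi_lambda _ fun t => hφ.comp (measurable_pi_apply t)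
  have hlaw : pathLaw P (fun t ω => φ (Z t ω)) = (pathLaw P Z).map fun z t => φ (z t) := by
    rw [pathLaw, pathLaw, Measure.map_map hψ hm]; rfl
  rw [hlaw, Measure.map_map measurable_shift hψ]
  conv_rhs => rw [← h.2.map_eq, Measure.map_map hψ measurable_shift]
  rfl

variable {Ω : Type*} [MeasurableSpace Ω] {P : Measure Ω} {m : ℕ}
  {U : ℤ → Ω → Fin 2 → ℝ} {X : ℤ → Ω → Fin m → ℝ} {Y : ℤ → Ω → Fin 2 → ℕ}
  {lam : ℤ → Ω → Fin 2 → ℝ} {θ₀ : Param m} {r₀ : ℝ} {Θ : Set (Param m)} {C κ : ℝ}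

/-- The latent process of the solution is the one computed from the data with the true
parameter. -/
lemma IsSolution.ae_eq_pathLatent (hY : IsSolution P U X θ₀ Y lam) (hb : GeomBound Θ C κ)
    (hθ₀ : θ₀ ∈ Θ) (hz : ∀ᵐ ω ∂P, Tame κ fun t => (Y t ω, X t ω)) :
    ∀ᵐ ω ∂P, ∀ t, lam t ω = pathLatent θ₀ (fun t => (Y t ω, X t ω)) t := by
  have hst : IsStationary P fun t ω => ‖lam t ω‖ :=
    hY.stationary.comp (φ := fun p : (Fin 2 → ℕ) × (Fin 2 → ℝ) => ‖p.2‖) measurable_snd.norm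
  filter_upwards [hz, ae_summable_geom hst hY.integrable.norm hb.rate_pos.le hb.rate_lt_one,
    ae_all_iff.2 hY.latent] with ω hz hs hl t
  set v : DataPath m := fun t => (Y t ω, X t ω) with hv
  -- Unrolling the recursion n times leaves the remainder B₀ⁿ λ_{t-n}. Its norm is at most C times a
  -- term of the almost surely convergent geometric moving average of |λ|, so it vanishes.
  have hrec : ∀ n : ℕ, lam t ω - (θ₀.B ^ n).mulVec (lam (t - n) ω) =
      ∑ j ∈ Finset.range n, (θ₀.B ^ j).mulVec (latentTerm θ₀ (v (t - 1 - j))) := by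
    intro n
    induction n with
    | zero => simp
    | succ n ih =>
      have h1 : lam (t - n) ω = θ₀.B.mulVec (lam (t - (n + 1 : ℕ)) ω) +
          latentTerm θ₀ (v (t - 1 - n)) := by
        rw [hl (t - n)]
        have e1 : t - (n : ℤ) - 1 = t - (n + 1 : ℕ) := by push_cast; ring
        have e2 : t - 1 - (n : ℤ) = t - (n + 1 : ℕ) := by push_cast; ring
        rw [e1, e2]
        exact step_eq θ₀ _ (v (t - (n + 1 : ℕ)))
      rw [Finset.sum_range_succ, ← ih, h1, Matrix.mulVec_add, Matrix.mulVec_mulVec, ← pow_succ]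
      abel
  have h0 : Tendsto (fun n : ℕ => (θ₀.B ^ n).mulVec (lam (t - n) ω)) atTop (𝓝 0) := by
    refine squeeze_zero_norm (fun n => hb.mulVec_le θ₀ hθ₀ n _) ?_
    -- The moving average at time t + 1 has the terms κⁿ‖λ_{t-n}‖, with the index that the remainder
    -- needs.
    have h := ((hs (t + 1)).tendsto_atTop_zero).const_mul C
    simp only [add_sub_cancel_right, mul_zero] at h
    simpa only [mul_assoc] using h
  have h1 := (hb.summable hθ₀ hz t).hasSum.tendsto_sum_nat
  simp only [← hrec] at h1
  have h2 := tendsto_nhds_unique h1 (tendsto_const_nhds.sub h0)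
  rw [sub_zero] at h2
  exact h2.symm

end LatentSolution

/-! ### Bounds on the criteria -/

section Bounds

variable {m : ℕ}

lemma natCast_zero_le_exp_obsSize (v : (Fin 2 → ℕ) × (Fin m → ℝ)) :
    (v.1 0 : ℝ) ≤ Real.exp (obsSize v) := by
  have h1 := log_one_add_natCast_nonneg (v.1 1)
  have h3 : 0 ≤ ∑ i, |v.2 i| := by positivity
  have h4 := Real.add_one_le_exp (obsSize v)
  simp only [obsSize] at h4 ⊢
  linarith

lemma one_add_natCast_one_le_exp_obsSize (v : (Fin 2 → ℕ) × (Fin m → ℝ)) :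
    1 + (v.1 1 : ℝ) ≤ Real.exp (obsSize v) := by
  have h : (0 : ℝ) < 1 + (v.1 1 : ℝ) := by positivity
  rw [← Real.log_le_iff_le_exp h]
  have h2 := (v.1 0).cast_nonneg (α := ℝ)
  have h3 : 0 ≤ ∑ i, |v.2 i| := by positivity
  simp only [obsSize]
  linarith

lemma two_le_exp_obsSize (v : (Fin 2 → ℕ) × (Fin m → ℝ)) : 2 ≤ Real.exp (obsSize v) := by
  linarith [Real.add_one_le_exp (obsSize v), one_le_obsSize v]

/-- Follows from 1 + e^a ≤ e^{|a-b|} (1 + e^b). -/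
lemma log_one_add_exp_sub_le (a b : ℝ) :
    |Real.log (1 + Real.exp a) - Real.log (1 + Real.exp b)| ≤ |a - b| := by
  have key : ∀ a b : ℝ, Real.log (1 + Real.exp a) - Real.log (1 + Real.exp b) ≤ |a - b| := by
    intro a b
    rw [sub_le_iff_le_add, Real.log_le_iff_le_exp (by positivity), Real.exp_add,
      Real.exp_log (by positivity), mul_add, mul_one, ← Real.exp_add]
    refine add_le_add (Real.one_le_exp (abs_nonneg _)) (Real.exp_le_exp.2 ?_)
    linarith [le_abs_self (a - b)]
  rw [abs_le]
  have := key b a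
  rw [abs_sub_comm] at this
  exact ⟨by linarith, key a b⟩

lemma abs_exp_sub_exp_le {a b S : ℝ} (ha : a ≤ S) (hb : b ≤ S) :
    |Real.exp a - Real.exp b| ≤ Real.exp S * |a - b| := by
  have key : ∀ a b : ℝ, a ≤ S → Real.exp a - Real.exp b ≤ Real.exp S * |a - b| := by
    intro a b ha
    have h1 : Real.exp a - Real.exp b = Real.exp a * (1 - Real.exp (b - a)) := by
      rw [mul_sub, mul_one, ← Real.exp_add, add_sub_cancel]
    have h2 : 1 - Real.exp (b - a) ≤ |a - b| := by
      linarith [Real.add_one_le_exp (b - a), le_abs_self (a - b)]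
    rw [h1]
    exact (mul_le_mul_of_nonneg_left h2 (Real.exp_pos _).le).trans
      (mul_le_mul_of_nonneg_right (Real.exp_le_exp.2 ha) (abs_nonneg _))
  rw [abs_le]
  have := key b a hb
  rw [abs_sub_comm] at this
  exact ⟨by linarith, key a b ha⟩

/-- The contrast is locally Lipschitz in the latent vector with a constant controlled by the
envelope; this measures the effect of the initial value. -/
lemma abs_contrast_sub_le (v : (Fin 2 → ℕ) × (Fin m → ℝ)) {s s' : Fin 2 → ℝ} {S : ℝ}
    (hs : ‖s‖ ≤ S) (hs' : ‖s'‖ ≤ S) :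
    |contrast v.1 s - contrast v.1 s'| ≤
      3 * Real.exp (obsSize v) * Real.exp S * ‖s - s'‖ := by
  have hS : 0 ≤ S := (norm_nonneg s).trans hs
  set a := Real.exp (obsSize v)
  set b := Real.exp S
  set δ := ‖s - s'‖
  have ha0 : (v.1 0 : ℝ) ≤ a := natCast_zero_le_exp_obsSize v
  have ha1 : 1 + (v.1 1 : ℝ) ≤ a := one_add_natCast_one_le_exp_obsSize v
  have ha2 : 2 ≤ a := two_le_exp_obsSize v
  have hb : 1 ≤ b := Real.one_le_exp hS
  have hδ : 0 ≤ δ := norm_nonneg _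
  have d0 : |s 0 - s' 0| ≤ δ := norm_le_pi_norm (s - s') 0
  have d1 : |s 1 - s' 1| ≤ δ := norm_le_pi_norm (s - s') 1
  have h1 := (log_one_add_exp_sub_le (s 0) (s' 0)).trans d0
  have h2 : |(v.1 0 : ℝ) * (s 0 - s' 0)| ≤ a * δ := by
    rw [abs_mul, Nat.abs_cast]; gcongr
  have h3 : |(v.1 1 : ℝ) * (s 1 - s' 1)| ≤ (a - 1) * δ := by
    rw [abs_mul, Nat.abs_cast]
    refine mul_le_mul (by linarith) d1 (abs_nonneg _) (by linarith)
  have h4 : |Real.exp (s 1) - Real.exp (s' 1)| ≤ b * δ :=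
    (abs_exp_sub_exp_le (S := S) ((le_abs_self _).trans ((norm_le_pi_norm s 1).trans hs))
      ((le_abs_self _).trans ((norm_le_pi_norm s' 1).trans hs'))).trans
      (mul_le_mul_of_nonneg_left d1 (by positivity))
  have e : contrast v.1 s - contrast v.1 s' =
      (Real.log (1 + Real.exp (s 0)) - Real.log (1 + Real.exp (s' 0))) -
        (v.1 0 : ℝ) * (s 0 - s' 0) + (Real.exp (s 1) - Real.exp (s' 1)) -
        (v.1 1 : ℝ) * (s 1 - s' 1) := by
    simp only [contrast]; ring
  rw [e]
  have h5 : |(Real.log (1 + Real.exp (s 0)) - Real.log (1 + Real.exp (s' 0))) -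
        (v.1 0 : ℝ) * (s 0 - s' 0) + (Real.exp (s 1) - Real.exp (s' 1)) -
        (v.1 1 : ℝ) * (s 1 - s' 1)| ≤ δ + a * δ + b * δ + (a - 1) * δ := by
    rw [abs_le] at h1 h2 h3 h4 ⊢
    constructor <;> linarith
  refine h5.trans ?_
  have h6 : 2 * a + b ≤ 3 * a * b := by nlinarith
  calc δ + a * δ + b * δ + (a - 1) * δ = (2 * a + b) * δ := by ring
    _ ≤ 3 * a * b * δ := mul_le_mul_of_nonneg_right h6 hδ

lemma abs_contrast_le (v : (Fin 2 → ℕ) × (Fin m → ℝ)) {s : Fin 2 → ℝ} {S : ℝ} (hs : ‖s‖ ≤ S) :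
    |contrast v.1 s| ≤ 3 * (Real.exp (2 * obsSize v) * Real.exp S) := by
  have hS : 0 ≤ S := (norm_nonneg s).trans hs
  rw [two_mul, Real.exp_add]
  set a := Real.exp (obsSize v)
  set b := Real.exp S
  have ha0 : (v.1 0 : ℝ) ≤ a := natCast_zero_le_exp_obsSize v
  have ha1 : 1 + (v.1 1 : ℝ) ≤ a := one_add_natCast_one_le_exp_obsSize v
  have ha2 : 2 ≤ a := two_le_exp_obsSize v
  have hb : S + 1 ≤ b := Real.add_one_le_exp S
  have d0 : |s 0| ≤ S := (norm_le_pi_norm s 0).trans hs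
  have d1 : |s 1| ≤ S := (norm_le_pi_norm s 1).trans hs
  have h1 : |Real.log (1 + Real.exp (s 0))| ≤ S + 1 := by
    rw [abs_of_nonneg (Real.log_nonneg (by linarith [Real.exp_pos (s 0)]))]
    have := log_one_add_exp_sub_le (s 0) 0
    rw [sub_zero, Real.exp_zero] at this
    have h2 : Real.log (1 + 1) ≤ 1 := by
      have := Real.log_le_sub_one_of_pos (show (0 : ℝ) < 1 + 1 by norm_num)
      linarith
    linarith [(abs_le.1 (this.trans d0)).2]
  have h2 : |(v.1 0 : ℝ) * s 0| ≤ a * S := by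
    rw [abs_mul, Nat.abs_cast]; gcongr
  have h3 : |(v.1 1 : ℝ) * s 1| ≤ (a - 1) * S := by
    rw [abs_mul, Nat.abs_cast]
    exact mul_le_mul (by linarith) d1 (abs_nonneg _) (by linarith)
  have h4 : |Real.exp (s 1)| ≤ b := by
    rw [abs_of_pos (Real.exp_pos _)]
    exact Real.exp_le_exp.2 ((le_abs_self _).trans d1)
  have h5 : |contrast v.1 s| ≤ (S + 1) + a * S + b + (a - 1) * S := by
    simp only [contrast]
    rw [abs_le] at h1 h2 h3 h4 ⊢
    constructor <;> linarith
  refine h5.trans ?_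
  have h6 : b * 1 ≤ b * a := by gcongr; linarith
  have h7 : a * S ≤ a * b := by gcongr; linarith
  have h8 : a * b * 2 ≤ a * b * a := by gcongr
  nlinarith [mul_nonneg hS hS]

/-- The logarithm of the conditional mass is controlled by those of the two marginal masses. The
Bernoulli mass is at least e^{-S}/2; for the Poisson mass, n! ≤ nⁿ ≤ e^{n²} handles the factorial,
and n is exponentially controlled by the size of the data. -/
lemma abs_log_condPmf_le_exp {r : ℝ} (hr : r ∈ Set.Ioo (-1 : ℝ) 1)
    (v : (Fin 2 → ℕ) × (Fin m → ℝ)) (hv : v.1 0 ≤ 1) {s : Fin 2 → ℝ} {S : ℝ} (hs : ‖s‖ ≤ S) :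
    |Real.log (condPmf r v.1 s)| ≤
      (1 + 2 / (1 - r ^ 2)) * (6 * (Real.exp (2 * obsSize v) * Real.exp S)) := by
  have hS : 0 ≤ S := (norm_nonneg s).trans hs
  have hr' := one_sub_sq_pos hr
  have d0 : |s 0| ≤ S := (norm_le_pi_norm s 0).trans hs
  have d1 : |s 1| ≤ S := (norm_le_pi_norm s 1).trans hs
  have hb : S + 1 ≤ Real.exp S := Real.add_one_le_exp S
  have hp0 : (2 * Real.exp S)⁻¹ ≤ margPmf 0 (s 0) (v.1 0) := by
    have e1 : ∀ x : ℝ, |x| ≤ S → (2 * Real.exp S)⁻¹ ≤ 1 / (1 + Real.exp x) := by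
      intro x hx
      rw [inv_eq_one_div]
      refine one_div_le_one_div_of_le (by positivity) ?_
      have := Real.exp_le_exp.2 ((le_abs_self x).trans hx)
      linarith
    have hc : v.1 0 = 0 ∨ v.1 0 = 1 := by omega
    rcases hc with h | h
    · simp only [margPmf, h, if_true, zero_ne_one, if_false]
      rw [one_sub_logistic]
      exact e1 _ d0
    · simp only [margPmf, h, if_true]
      exact e1 _ (by rwa [abs_neg])
  have hp0' : 0 < margPmf 0 (s 0) (v.1 0) := lt_of_lt_of_le (by positivity) hp0
  have hp : ∀ i, 0 < margPmf i (s i) (v.1 i) := fun i => by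
    match i with
    | 0 => exact hp0'
    | 1 => exact margPmf_one_pos _ _
  refine (abs_log_condPmf_le hr hp).trans ?_
  refine mul_le_mul_of_nonneg_left ?_ (by positivity)
  rw [Fin.sum_univ_two]
  have h0 : Real.log (4 / margPmf 0 (s 0) (v.1 0)) ≤ 8 * Real.exp S := by
    refine (Real.log_le_self (by positivity)).trans ?_
    rw [div_le_iff₀ hp0']
    have := mul_le_mul_of_nonneg_left hp0 (show 0 ≤ 8 * Real.exp S by positivity)
    refine le_trans (le_of_eq ?_) this
    field_simp
    norm_num
  set n := v.1 1 with hn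
  have hfac : Real.log (n.factorial : ℝ) ≤ (n : ℝ) ^ 2 := by
    rw [Real.log_le_iff_le_exp (by positivity), sq, Real.exp_nat_mul]
    calc (n.factorial : ℝ) ≤ (n : ℝ) ^ n := by exact_mod_cast Nat.factorial_le_pow n
      _ ≤ _ := by gcongr; linarith [Real.add_one_le_exp (n : ℝ)]
  have h1 : Real.log (4 / margPmf 1 (s 1) n) ≤ 3 + Real.exp S + n * S + (n : ℝ) ^ 2 := by
    rw [Real.log_div (by norm_num) (margPmf_one_pos _ _).ne', margPmf_one,
      Real.log_div (by positivity) (by positivity), ← Real.exp_add, Real.log_exp]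
    have e1 : Real.log 4 ≤ 3 := by
      have := Real.log_le_sub_one_of_pos (show (0 : ℝ) < 4 by norm_num)
      linarith
    have e2 : Real.exp (s 1) ≤ Real.exp S := Real.exp_le_exp.2 ((le_abs_self _).trans d1)
    have e3 : -(n * s 1) ≤ n * S := by
      rw [← mul_neg]
      exact mul_le_mul_of_nonneg_left ((neg_le_abs _).trans d1) n.cast_nonneg
    linarith
  refine (add_le_add h0 h1).trans ?_
  rw [two_mul, Real.exp_add]
  have ha1 : 1 + (n : ℝ) ≤ Real.exp (obsSize v) := one_add_natCast_one_le_exp_obsSize v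
  have ha2 : 2 ≤ Real.exp (obsSize v) := two_le_exp_obsSize v
  set a := Real.exp (obsSize v)
  set b := Real.exp S
  have hn0 : (0 : ℝ) ≤ n := n.cast_nonneg
  have g1 : (n : ℝ) * S ≤ a * b := mul_le_mul (by linarith) (by linarith) hS (by linarith)
  have g2 : (n : ℝ) ^ 2 ≤ a * a * b := by
    have : (n : ℝ) ^ 2 ≤ a * a * 1 := by nlinarith
    refine this.trans ?_
    gcongr
    linarith
  have g3 : 2 * (a * b) ≤ a * a * b := by nlinarith
  have g4 : 2 * b ≤ a * b := by nlinarith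
  linarith

end Bounds

/-! ### The law of the data -/

section DataLaw

variable {m : ℕ}

/-- The envelope of the criteria. -/
def envelope (C κ : ℝ) (z : DataPath m) : ℝ :=
  Real.exp (2 * obsSize (z 0)) * Real.exp (C * geomSum κ (fun t => obsSize (z t)) 0)

lemma measurable_geomSum (κ : ℝ) (t : ℤ) :
    Measurable fun z : DataPath m => geomSum κ (fun t => obsSize (z t)) t :=
  measurable_tsum_of_finiteDimensional fun j =>
    ((measurable_obsSize.comp (measurable_pi_apply (t - 1 - j))).const_mul (κ ^ j))

lemma measurable_envelope (C κ : ℝ) : Measurable (envelope (m := m) C κ) :=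
  ((measurable_obsSize.comp (measurable_pi_apply 0)).const_mul 2).exp.mul
    ((measurable_geomSum κ 0).const_mul C).exp

lemma envelope_nonneg (C κ : ℝ) (z : DataPath m) : 0 ≤ envelope C κ z := by
  unfold envelope; positivity

/-- A law of the data: stationary, ergodic, with exponential moments of the size, and with binary
first observations. -/
structure IsDataLaw (ν : Measure (DataPath m)) : Prop where
  isProbabilityMeasure : IsProbabilityMeasure ν
  ergodic : Ergodic shift ν
  exp_lt_top : ∀ c : ℝ, ∫⁻ z, ENNReal.ofReal (Real.exp (c * obsSize (z 0))) ∂ν < ⊤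
  binary : ∀ᵐ z ∂ν, (z 0).1 0 ≤ 1

variable {ν : Measure (DataPath m)} {C κ : ℝ} {Θ : Set (Param m)}

lemma IsDataLaw.isStationary (h : IsDataLaw ν) : IsStationary ν fun t z => z t := by
  refine ⟨measurable_pi_apply, ?_⟩
  have : pathLaw ν (fun (t : ℤ) (z : DataPath m) => z t) = ν := Measure.map_id
  rw [this]
  exact h.ergodic.toMeasurePreserving

lemma IsDataLaw.isStationary_obsSize (h : IsDataLaw ν) :
    IsStationary ν fun t z => obsSize (z t) :=
  h.isStationary.comp measurable_obsSize

lemma IsDataLaw.integrable_obsSize (h : IsDataLaw ν) :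
    Integrable (fun z => obsSize (z 0)) ν := by
  refine ⟨(h.isStationary_obsSize.1 0).aestronglyMeasurable, ?_⟩
  have h0 : ∀ᵐ z ∂ν, 0 ≤ obsSize (z 0) :=
    Eventually.of_forall fun z => zero_le_one.trans (one_le_obsSize (z 0))
  rw [hasFiniteIntegral_iff_ofReal h0]
  refine (lintegral_mono fun z => ENNReal.ofReal_le_ofReal ?_).trans_lt (h.exp_lt_top 1)
  rw [one_mul]
  linarith [Real.add_one_le_exp (obsSize (z 0))]

lemma IsDataLaw.ae_tame (h : IsDataLaw ν) (hκ0 : 0 ≤ κ) (hκ1 : κ < 1) : ∀ᵐ z ∂ν, Tame κ z := by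
  have := h.isProbabilityMeasure
  exact ae_summable_geom h.isStationary_obsSize h.integrable_obsSize hκ0 hκ1

/-- The current size and the moving average of past sizes are dependent; a b ≤ a² + b² separates
their exponential moments. -/
lemma IsDataLaw.integrable_envelope (h : IsDataLaw ν) (hC : 0 ≤ C) (hκ0 : 0 ≤ κ) (hκ1 : κ < 1) :
    Integrable (envelope C κ) ν := by
  have := h.isProbabilityMeasure
  refine ⟨(measurable_envelope C κ).aestronglyMeasurable, ?_⟩
  rw [hasFiniteIntegral_iff_ofReal (Eventually.of_forall fun z => envelope_nonneg C κ z)]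
  have h1 := lintegral_exp_geomSum_lt_top h.isStationary_obsSize
    (fun t z => zero_le_one.trans (one_le_obsSize (z t))) h.exp_lt_top hκ0 hκ1
    (show 0 ≤ 2 * C by positivity) 0
  have h2 := h.exp_lt_top 4
  have hm : Measurable fun z : DataPath m => ENNReal.ofReal (Real.exp (4 * obsSize (z 0))) :=
    ((measurable_obsSize.comp (measurable_pi_apply 0)).const_mul 4).exp.ennreal_ofReal
  refine (lintegral_mono fun z => ?_).trans_lt
    ((lintegral_add_left hm _).trans_lt (ENNReal.add_lt_top.2 ⟨h2, h1⟩))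
  rw [← ENNReal.ofReal_add (Real.exp_pos _).le (Real.exp_pos _).le]
  refine ENNReal.ofReal_le_ofReal ?_
  have e1 : Real.exp (4 * obsSize (z 0)) = Real.exp (2 * obsSize (z 0)) ^ 2 := by
    rw [← Real.exp_nat_mul]; congr 1; push_cast; ring
  have e2 : Real.exp (2 * C * geomSum κ (fun t => obsSize (z t)) 0) =
      Real.exp (C * geomSum κ (fun t => obsSize (z t)) 0) ^ 2 := by
    rw [← Real.exp_nat_mul]; congr 1; push_cast; ring
  rw [envelope, e1, e2]
  nlinarith [sq_nonneg (Real.exp (2 * obsSize (z 0)) -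
    Real.exp (C * geomSum κ (fun t => obsSize (z t)) 0)), sq_nonneg (Real.exp (2 * obsSize (z 0))),
    sq_nonneg (Real.exp (C * geomSum κ (fun t => obsSize (z t)) 0))]

/-- A uniform law of large numbers for functions of the data. -/
lemma IsDataLaw.tendstoUniformlyOn (h : IsDataLaw ν) {E : Type*} [TopologicalSpace E]
    [TopologicalSpace.PseudoMetrizableSpace E] {K : Set E} (hK : IsCompact K)
    {F : E → DataPath m → ℝ} (hF : ∀ e ∈ K, Measurable (F e))
    (hc : ∀ᵐ z ∂ν, ContinuousOn (fun e => F e z) K) {g : DataPath m → ℝ} (hg : Integrable g ν)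
    (hb : ∀ᵐ z ∂ν, ∀ e ∈ K, |F e z| ≤ g z) :
    ContinuousOn (fun e => ∫ z, F e z ∂ν) K ∧
    ∀ᵐ z ∂ν, TendstoUniformlyOn
      (fun (n : ℕ) e => (n : ℝ)⁻¹ * ∑ t ∈ Finset.Icc 1 n, F e (shift^[t] z))
      (fun e => ∫ z, F e z ∂ν) atTop K := by
  have := h.isProbabilityMeasure
  obtain ⟨h1, h2⟩ := tendstoUniformlyOn_birkhoff h.ergodic hK hF hc hg hb
  refine ⟨h1, ?_⟩
  -- Birkhoff sums run over the times 0 to n - 1 and the criteria over 1 to n; applying the theorem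
  -- at the shifted path removes the offset.
  filter_upwards [h.ergodic.quasiMeasurePreserving.ae h2] with z hz
  refine hz.congr (Eventually.of_forall fun n e _ => ?_)
  simp only [birkhoffSum]
  rw [← Finset.Ico_add_one_right_eq_Icc, Finset.sum_Ico_eq_sum_range]
  simp only [add_tsub_cancel_right, add_comm 1, Function.iterate_succ_apply]

/-- The uniform law of large numbers and the extraction of convergent subsequences take place in
`Param m` and in `Param m × ℝ`, as pseudo-metrizable spaces. -/
instance instMetrizableSpaceMatrix (k : ℕ) :
    TopologicalSpace.MetrizableSpace (Matrix (Fin 2) (Fin k) ℝ) :=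
  inferInstanceAs (TopologicalSpace.MetrizableSpace (Fin 2 → Fin k → ℝ))

/-- The first criterion as a function of the path. -/
def pathContrast (θ : Param m) (z : DataPath m) : ℝ := contrast (z 0).1 (pathLatent θ z 0)

/-- The second criterion as a function of the path. -/
def pathLogPmf (e : Param m × ℝ) (z : DataPath m) : ℝ :=
  Real.log (condPmf e.2 (z 0).1 (pathLatent e.1 z 0))

lemma continuous_contrast (y : Fin 2 → ℕ) : Continuous (contrast y) := by
  unfold contrast
  have h : ∀ s : Fin 2 → ℝ, 1 + Real.exp (s 0) ≠ 0 := fun s => by positivity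
  fun_prop (disch := assumption)

lemma measurable_of_measurable_section {E : Type*} [MeasurableSpace E]
    {f : (Fin 2 → ℕ) → E → ℝ} (hf : ∀ y, Measurable (f y)) :
    Measurable fun p : (Fin 2 → ℕ) × E => f p.1 p.2 :=
  measurable_from_prod_countable_right hf

lemma measurable_pathContrast (θ : Param m) : Measurable (pathContrast θ) := by
  have h := measurable_of_measurable_section fun y => (continuous_contrast y).measurable
  exact h.comp ((measurable_pi_apply 0).fst.prodMk (measurable_pathLatent θ 0))

lemma continuous_condPmf {r : ℝ} (hr : r ∈ Set.Ioo (-1 : ℝ) 1) (y : Fin 2 → ℕ) :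
    Continuous (condPmf r y) := by
  rw [continuous_iff_continuousAt]
  intro s
  have h := continuousAt_condPmf hr y s
  exact h.comp (f := fun s : Fin 2 → ℝ => (r, s))
    (Continuous.prodMk_right r).continuousAt

lemma measurable_condPmf {r : ℝ} (hr : r ∈ Set.Ioo (-1 : ℝ) 1) :
    Measurable fun p : (Fin 2 → ℕ) × (Fin 2 → ℝ) => condPmf r p.1 p.2 :=
  measurable_of_measurable_section fun y => (continuous_condPmf hr y).measurable

lemma measurable_pathLogPmf {e : Param m × ℝ} (he : e.2 ∈ Set.Ioo (-1 : ℝ) 1) :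
    Measurable (pathLogPmf e) :=
  ((measurable_condPmf he).comp
    ((measurable_pi_apply 0).fst.prodMk (measurable_pathLatent e.1 0))).log

lemma GeomBound.abs_pathContrast_le (hb : GeomBound Θ C κ) {z : DataPath m} (hz : Tame κ z)
    {θ : Param m} (hθ : θ ∈ Θ) : |pathContrast θ z| ≤ 3 * envelope C κ z :=
  abs_contrast_le (z 0) (hb.norm_pathLatent_le hθ hz 0)

lemma IsDataLaw.tendstoUniformlyOn_pathContrast (h : IsDataLaw ν) (hΘ : IsCompact Θ)
    (hb : GeomBound Θ C κ) :
    ContinuousOn (fun θ => ∫ z, pathContrast θ z ∂ν) Θ ∧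
    ∀ᵐ z ∂ν, TendstoUniformlyOn
      (fun (n : ℕ) θ => (n : ℝ)⁻¹ * ∑ t ∈ Finset.Icc 1 n, pathContrast θ (shift^[t] z))
      (fun θ => ∫ z, pathContrast θ z ∂ν) atTop Θ := by
  have ht := h.ae_tame hb.rate_pos.le hb.rate_lt_one
  refine h.tendstoUniformlyOn hΘ (fun θ _ => measurable_pathContrast θ) ?_
    ((h.integrable_envelope hb.pos.le hb.rate_pos.le hb.rate_lt_one).const_mul 3) ?_
  · filter_upwards [ht] with z hz
    exact (continuous_contrast _).comp_continuousOn (hb.continuousOn_pathLatent hz 0)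
  · filter_upwards [ht] with z hz θ hθ using hb.abs_pathContrast_le hz hθ

lemma condPmf_pos_of_le_one {r : ℝ} (hr : r ∈ Set.Ioo (-1 : ℝ) 1) {y : Fin 2 → ℕ} (hy : y 0 ≤ 1)
    (s : Fin 2 → ℝ) : 0 < condPmf r y s := by
  refine condPmf_pos hr fun i => ?_
  match i with
  | 0 =>
    have hc : y 0 = 0 ∨ y 0 = 1 := by omega
    rcases hc with h | h
    · simp only [margPmf, h, if_true, zero_ne_one, if_false]
      linarith [logistic_lt_one (s 0)]
    · simp only [margPmf, h, if_true]
      exact logistic_pos _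
  | 1 => exact margPmf_one_pos _ _

/-- The factor 1 + 2/(1 - r²) is bounded because the compact set of correlations stays away from ±1.
-/
lemma IsDataLaw.exists_integrable_bound_pathLogPmf (h : IsDataLaw ν) {G : Set ℝ}
    (hG : IsCompact G) (hG' : G ⊆ Set.Ioo (-1 : ℝ) 1) (hb : GeomBound Θ C κ) :
    ∃ g : DataPath m → ℝ, Integrable g ν ∧ ∀ᵐ z ∂ν, ∀ e ∈ Θ ×ˢ G, |pathLogPmf e z| ≤ g z := by
  obtain ⟨M, hM⟩ := hG.exists_bound_of_continuousOn (f := fun r : ℝ => 1 + 2 / (1 - r ^ 2)) (by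
    refine continuousOn_const.add (continuousOn_const.div (by fun_prop) fun r hr => ?_)
    exact (one_sub_sq_pos (hG' hr)).ne')
  refine ⟨fun z => M * (6 * envelope C κ z),
    ((h.integrable_envelope hb.pos.le hb.rate_pos.le hb.rate_lt_one).const_mul 6).const_mul M, ?_⟩
  filter_upwards [h.ae_tame hb.rate_pos.le hb.rate_lt_one, h.binary] with z hz h0 e he
  refine (abs_log_condPmf_le_exp (hG' he.2) (z 0) h0 (hb.norm_pathLatent_le he.1 hz 0)).trans ?_
  exact mul_le_mul_of_nonneg_right ((le_abs_self _).trans (hM e.2 he.2))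
    (mul_nonneg (by norm_num) (envelope_nonneg C κ z))

lemma IsDataLaw.tendstoUniformlyOn_pathLogPmf (h : IsDataLaw ν) (hΘ : IsCompact Θ) {G : Set ℝ}
    (hG : IsCompact G) (hG' : G ⊆ Set.Ioo (-1 : ℝ) 1) (hb : GeomBound Θ C κ) :
    ContinuousOn (fun e => ∫ z, pathLogPmf e z ∂ν) (Θ ×ˢ G) ∧
    ∀ᵐ z ∂ν, TendstoUniformlyOn
      (fun (n : ℕ) e => (n : ℝ)⁻¹ * ∑ t ∈ Finset.Icc 1 n, pathLogPmf e (shift^[t] z))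
      (fun e => ∫ z, pathLogPmf e z ∂ν) atTop (Θ ×ˢ G) := by
  obtain ⟨g, hg, hgb⟩ := h.exists_integrable_bound_pathLogPmf hG hG' hb
  refine h.tendstoUniformlyOn (hΘ.prod hG) (fun e he => measurable_pathLogPmf (hG' he.2)) ?_ hg hgb
  filter_upwards [h.ae_tame hb.rate_pos.le hb.rate_lt_one, h.binary] with z hz h0 e he
  have h1 : ContinuousWithinAt (fun e : Param m × ℝ => (e.2, pathLatent e.1 z 0)) (Θ ×ˢ G) e :=
    continuous_snd.continuousWithinAt.prodMk
      (((hb.continuousOn_pathLatent hz 0) e.1 he.1).comp continuous_fst.continuousWithinAt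
        fun e he => he.1)
  have h2 := (continuousAt_condPmf (hG' he.2) (z 0).1 (pathLatent e.1 z 0)).comp_continuousWithinAt
    (f := fun e : Param m × ℝ => (e.2, pathLatent e.1 z 0)) h1
  exact h2.log (condPmf_pos_of_le_one (hG' he.2) h0 _).ne'

/-- The effect of the initial value on the first criterion. -/
lemma IsDataLaw.ae_exists_sum_abs_sub_le (h : IsDataLaw ν) (hb : GeomBound Θ C κ)
    (l₀ : Fin 2 → ℝ) :
    ∀ᵐ z ∂ν, ∃ W : ℝ, ∀ θ ∈ Θ, ∀ n : ℕ, ∑ t ∈ Finset.Icc 1 n,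
      |contrast (z t).1 (latentInit l₀ θ (fun s => (z s).1) (fun s => (z s).2) t) -
        pathContrast θ (shift^[t] z)| ≤ W := by
  have := h.isProbabilityMeasure
  have hint := h.integrable_envelope hb.pos.le hb.rate_pos.le hb.rate_lt_one
  -- By stationarity the n-th term has mean κⁿ times the mean of the envelope, so the series
  -- converges almost surely.
  have hsum : ∀ᵐ z ∂ν, Summable fun n : ℕ => κ ^ n * envelope C κ (shift^[n] z) := by
    have hmp : ∀ n : ℕ, MeasurePreserving (shift^[n]) ν ν := h.ergodic.toMeasurePreserving.iterate
    refine ae_summable_of_lintegral_le (C := ∫ z, envelope C κ z ∂ν)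
      (fun n => (((measurable_envelope C κ).comp (hmp n).measurable).const_mul _).aemeasurable)
      hb.rate_pos.le hb.rate_lt_one (integral_nonneg (envelope_nonneg C κ)) fun n => ?_
    have hκn : 0 ≤ κ ^ n := pow_nonneg hb.rate_pos.le n
    simp_rw [abs_of_nonneg (mul_nonneg hκn (envelope_nonneg C κ _)), ENNReal.ofReal_mul hκn]
    rw [lintegral_const_mul' _ _ ENNReal.ofReal_ne_top,
      (hmp n).lintegral_comp (f := fun z => ENNReal.ofReal (envelope C κ z))
        (measurable_envelope C κ).ennreal_ofReal,
      ← ofReal_integral_eq_lintegral_ofReal hint (Eventually.of_forall (envelope_nonneg C κ)),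
      ← ENNReal.ofReal_mul hκn, mul_comm]
  filter_upwards [hsum, h.ae_tame hb.rate_pos.le hb.rate_lt_one] with z hs hz
  -- κ^t w bounds the distance at time t between the two latent processes, and w alone enters the
  -- local Lipschitz constant. Neither depends on θ.
  set w := C * (‖l₀‖ + C * geomSum κ (fun t => obsSize (z t)) 0) with hw
  have hg0 : 0 ≤ C * geomSum κ (fun t => obsSize (z t)) 0 :=
    mul_nonneg hb.pos.le (tsum_nonneg fun j => mul_nonneg (pow_nonneg hb.rate_pos.le j)
      (zero_le_one.trans (one_le_obsSize _)))
  have hw0 : 0 ≤ w := mul_nonneg hb.pos.le (add_nonneg (norm_nonneg _) hg0)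
  refine ⟨3 * Real.exp w * w * ∑' n : ℕ, κ ^ n * envelope C κ (shift^[n] z), fun θ hθ n => ?_⟩
  have hterm : ∀ t : ℕ,
      |contrast (z t).1 (latentInit l₀ θ (fun s => (z s).1) (fun s => (z s).2) t) -
        pathContrast θ (shift^[t] z)| ≤
      3 * Real.exp w * w * (κ ^ t * envelope C κ (shift^[t] z)) := by
    intro t
    set S := C * geomSum κ (fun t => obsSize (z t)) t with hS
    have hκt : κ ^ t ≤ 1 := pow_le_one₀ hb.rate_pos.le hb.rate_lt_one.le
    have hκ0 : 0 ≤ κ ^ t := pow_nonneg hb.rate_pos.le t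
    have h1 : ‖pathLatent θ z t‖ ≤ S := hb.norm_pathLatent_le hθ hz t
    have h2 : ‖latentInit l₀ θ (fun s => (z s).1) (fun s => (z s).2) t - pathLatent θ z t‖ ≤
        κ ^ t * w := by
      rw [hb.latentInit_sub hθ hz l₀ t]
      refine (hb.mulVec_le θ hθ t _).trans ?_
      have h3 : ‖l₀ - pathLatent θ z 0‖ ≤ ‖l₀‖ + C * geomSum κ (fun t => obsSize (z t)) 0 :=
        (norm_sub_le _ _).trans (add_le_add_right (hb.norm_pathLatent_le hθ hz 0) _)
      calc C * κ ^ t * ‖l₀ - pathLatent θ z 0‖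
          ≤ C * κ ^ t * (‖l₀‖ + C * geomSum κ (fun t => obsSize (z t)) 0) :=
            mul_le_mul_of_nonneg_left h3 (mul_nonneg hb.pos.le hκ0)
        _ = κ ^ t * w := by rw [hw]; ring
    have h3 : ‖latentInit l₀ θ (fun s => (z s).1) (fun s => (z s).2) t‖ ≤ S + w := by
      have e : latentInit l₀ θ (fun s => (z s).1) (fun s => (z s).2) t =
          pathLatent θ z t + (latentInit l₀ θ (fun s => (z s).1) (fun s => (z s).2) t -
            pathLatent θ z t) := by abel
      rw [e]
      refine (norm_add_le _ _).trans (add_le_add h1 (h2.trans ?_))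
      exact mul_le_of_le_one_left hw0 hκt
    have h4 : pathContrast θ (shift^[t] z) = contrast (z t).1 (pathLatent θ z t) := by
      rw [pathContrast, pathLatent_shift_iterate, shift_iterate, zero_add]
    have h5 : envelope C κ (shift^[t] z) = Real.exp (2 * obsSize (z t)) * Real.exp S := by
      rw [envelope, shift_iterate, zero_add, hS]
      congr 3
      simp only [geomSum, shift_iterate]
      refine tsum_congr fun j => ?_
      congr 3
      ring
    rw [h4, h5]
    refine (abs_contrast_sub_le (z t) h3 (h1.trans (by linarith))).trans ?_
    have h6 : Real.exp (obsSize (z t)) ≤ Real.exp (2 * obsSize (z t)) :=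
      Real.exp_le_exp.2 (by linarith [one_le_obsSize (z t)])
    calc 3 * Real.exp (obsSize (z t)) * Real.exp (S + w) *
          ‖latentInit l₀ θ (fun s => (z s).1) (fun s => (z s).2) t - pathLatent θ z t‖
        ≤ 3 * Real.exp (2 * obsSize (z t)) * Real.exp (S + w) * (κ ^ t * w) := by gcongr
      _ = _ := by rw [Real.exp_add]; ring
  calc _ ≤ ∑ t ∈ Finset.Icc 1 n, 3 * Real.exp w * w * (κ ^ t * envelope C κ (shift^[t] z)) :=
        Finset.sum_le_sum fun t _ => hterm t
    _ = 3 * Real.exp w * w * ∑ t ∈ Finset.Icc 1 n, κ ^ t * envelope C κ (shift^[t] z) := by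
        rw [Finset.mul_sum]
    _ ≤ _ := by
        refine mul_le_mul_of_nonneg_left (hs.sum_le_tsum _ fun t _ => ?_) (by positivity)
        exact mul_nonneg (pow_nonneg hb.rate_pos.le t) (envelope_nonneg C κ _)

end DataLaw

/-! ### Identification -/

section Contrast

/-- The conditional mean of the contrast at `l` when the true latent vector is `s`. -/
def meanContrast (s l : Fin 2 → ℝ) : ℝ :=
  (Real.log (1 + Real.exp (l 0)) - logistic (s 0) * l 0) +
    (Real.exp (l 1) - Real.exp (s 1) * l 1)

/-- Gibbs' inequality for Bernoulli laws: strict convexity of exp gives e^{p(b-a)} < 1 - p + p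
e^{b-a} with p = `logistic a`, and the right side is (1 + e^b)/(1 + e^a). -/
lemma logistic_mul_lt {a b : ℝ} (h : a ≠ b) :
    Real.log (1 + Real.exp a) - logistic a * a < Real.log (1 + Real.exp b) - logistic a * b := by
  have hp := logistic_pos a
  have hq := logistic_lt_one a
  have h1 := strictConvexOn_exp.2 (Set.mem_univ (0 : ℝ)) (Set.mem_univ (b - a))
    (sub_ne_zero.2 h.symm).symm (sub_pos.2 hq) hp (by ring)
  simp only [smul_eq_mul, mul_zero, zero_add, Real.exp_zero, mul_one] at h1
  have h2 : 1 - logistic a + logistic a * Real.exp (b - a) =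
      (1 + Real.exp b) / (1 + Real.exp a) := by
    rw [one_sub_logistic, logistic_eq, Real.exp_sub]
    field_simp
  rw [h2] at h1
  have h3 := Real.log_lt_log (Real.exp_pos _) h1
  rw [Real.log_exp, Real.log_div (by positivity) (by positivity)] at h3
  linarith

lemma exp_sub_mul_lt {a b : ℝ} (h : a ≠ b) :
    Real.exp a - Real.exp a * a < Real.exp b - Real.exp a * b := by
  have h1 := Real.add_one_lt_exp (sub_ne_zero.2 h.symm)
  have h2 : Real.exp b = Real.exp a * Real.exp (b - a) := by
    rw [← Real.exp_add, add_sub_cancel]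
  rw [h2]
  nlinarith [Real.exp_pos a]

lemma meanContrast_self_le (s l : Fin 2 → ℝ) : meanContrast s s ≤ meanContrast s l := by
  refine add_le_add ?_ ?_
  · by_cases h : s 0 = l 0
    · rw [h]
    · exact (logistic_mul_lt h).le
  · by_cases h : s 1 = l 1
    · rw [h]
    · exact (exp_sub_mul_lt h).le

lemma eq_of_meanContrast_le {s l : Fin 2 → ℝ} (h : meanContrast s l ≤ meanContrast s s) :
    s = l := by
  have h0 : Real.log (1 + Real.exp (s 0)) - logistic (s 0) * s 0 ≤
      Real.log (1 + Real.exp (l 0)) - logistic (s 0) * l 0 := by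
    by_cases h : s 0 = l 0
    · rw [h]
    · exact (logistic_mul_lt h).le
  have h1 : Real.exp (s 1) - Real.exp (s 1) * s 1 ≤ Real.exp (l 1) - Real.exp (s 1) * l 1 := by
    by_cases h : s 1 = l 1
    · rw [h]
    · exact (exp_sub_mul_lt h).le
  simp only [meanContrast] at h
  have e0 : s 0 = l 0 := by
    by_contra hne
    linarith [logistic_mul_lt hne]
  have e1 : s 1 = l 1 := by
    by_contra hne
    linarith [exp_sub_mul_lt hne]
  funext i
  match i with
  | 0 => exact e0
  | 1 => exact e1

/-- The contrast is affine in the observation, so its mean depends only on the marginal means; the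
dependence between the coordinates plays no role in the first step. -/
lemma integral_contrast_observe {r : ℝ} (hr : r ∈ Set.Ioo (-1 : ℝ) 1) (s l : Fin 2 → ℝ) :
    ∫ u, contrast (observe s u) l ∂(gaussianCopula r) = meanContrast s l := by
  have := isProbabilityMeasure_gaussianCopula hr
  have m0 := measurePreserving_eval_gaussianCopula hr 0
  have m1 := measurePreserving_eval_gaussianCopula hr 1
  have i0 : Integrable (fun u => (bernoulliQuantile (s 0) (u 0) : ℝ)) (gaussianCopula r) := by
    have h := m0.integrable_comp_of_integrable (integrable_bernoulliQuantile (s 0))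
    simpa only [Function.comp_def] using h
  have i1 : Integrable (fun u => (poissonQuantile (s 1) (u 1) : ℝ)) (gaussianCopula r) := by
    have h := m1.integrable_comp_of_integrable (integrable_poissonQuantile (s 1))
    simpa only [Function.comp_def] using h
  have e0 : ∫ u, (bernoulliQuantile (s 0) (u 0) : ℝ) ∂(gaussianCopula r) = logistic (s 0) := by
    rw [← integral_bernoulliQuantile, ← m0.map_eq, integral_map m0.measurable.aemeasurable]
    rw [m0.map_eq]
    exact (integrable_bernoulliQuantile (s 0)).aestronglyMeasurable
  have e1 : ∫ u, (poissonQuantile (s 1) (u 1) : ℝ) ∂(gaussianCopula r) = Real.exp (s 1) := by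
    rw [← integral_poissonQuantile, ← m1.map_eq, integral_map m1.measurable.aemeasurable]
    rw [m1.map_eq]
    exact (integrable_poissonQuantile (s 1)).aestronglyMeasurable
  have e : ∀ u, contrast (observe s u) l =
      (Real.log (1 + Real.exp (l 0)) + Real.exp (l 1)) -
        ((bernoulliQuantile (s 0) (u 0) : ℝ) * l 0 + (poissonQuantile (s 1) (u 1) : ℝ) * l 1) := by
    intro u
    simp only [contrast, observe_eq, Matrix.cons_val_zero, Matrix.cons_val_one]
    ring
  have i2 : Integrable (fun u : Fin 2 → ℝ => (bernoulliQuantile (s 0) (u 0) : ℝ) * l 0 +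
      (poissonQuantile (s 1) (u 1) : ℝ) * l 1) (gaussianCopula r) :=
    (i0.mul_const _).add (i1.mul_const _)
  simp_rw [e]
  rw [integral_sub (integrable_const _) i2, integral_add (i0.mul_const _) (i1.mul_const _),
    integral_mul_const, integral_mul_const, e0, e1, integral_const]
  simp only [meanContrast, probReal_univ, smul_eq_mul]
  ring

end Contrast

/-! ### Identification of the latent vector and of the correlation -/

section Identification

variable {Ω : Type*} [MeasurableSpace Ω] {P : Measure Ω} {m : ℕ}
  {U : ℤ → Ω → Fin 2 → ℝ} {X : ℤ → Ω → Fin m → ℝ} {Y : ℤ → Ω → Fin 2 → ℕ}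
  {lam : ℤ → Ω → Fin 2 → ℝ} {θ₀ θ : Param m} {r₀ r : ℝ} {Θ : Set (Param m)} {C κ : ℝ}

/-- The path of the data. -/
def dataPath (Y : ℤ → Ω → Fin 2 → ℕ) (X : ℤ → Ω → Fin m → ℝ) (ω : Ω) : DataPath m :=
  fun t => (Y t ω, X t ω)

lemma IsSolution.measurable_dataPath (hUX : NoiseAssumption P U X)
    (hY : IsSolution P U X θ₀ Y lam) : Measurable (dataPath Y X) :=
  measurable_pi_lambda _ fun t => (hY.measurable_obs t).prodMk (hUX.measurable_covariate t)

/-- The latent vector at time 0 uses the data at times -1 - j only, and is therefore independent of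
`U 0`, whatever the parameter. -/
lemma IsSolution.measurable_past_pathLatent (hY : IsSolution P U X θ₀ Y lam) (θ : Param m) :
    Measurable[past U X (0 - 1)] fun ω => pathLatent θ (dataPath Y X ω) 0 := by
  refine measurable_tsum_of_finiteDimensional fun j => ?_
  have hc : Continuous fun l : Fin 2 → ℝ => (θ.B ^ j).mulVec l :=
    Continuous.matrix_mulVec continuous_const continuous_id
  have hv : Measurable[past U X (0 - 1)] fun ω => dataPath Y X ω (0 - 1 - j) :=
    ((hY.adapted_obs _).mono (past_mono (by omega)) le_rfl).prodMk
      (measurable_past_covariate (by omega))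
  exact hc.measurable.comp ((measurable_latentTerm θ).comp hv)

variable [IsProbabilityMeasure P]

lemma IsSolution.ae_obs_eq (hY : IsSolution P U X θ₀ Y lam) (hb : GeomBound Θ C κ)
    (hθ₀ : θ₀ ∈ Θ) (hz : ∀ᵐ ω ∂P, Tame κ (dataPath Y X ω)) :
    ∀ᵐ ω ∂P, Y 0 ω = observe (pathLatent θ₀ (dataPath Y X ω) 0) (U 0 ω) := by
  filter_upwards [hY.observation 0, hY.ae_eq_pathLatent hb hθ₀ hz] with ω h1 h2
  rw [h1, h2 0]
  rfl

/-- The mean of the contrast, and its integrability, in terms of the latent processes. -/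
lemma IsSolution.integral_pathContrast (hUX : NoiseAssumption P U X)
    (hr : r₀ ∈ Set.Ioo (-1 : ℝ) 1) (hU : P.map (U 0) = gaussianCopula r₀)
    (hY : IsSolution P U X θ₀ Y lam) (hb : GeomBound Θ C κ) (hθ₀ : θ₀ ∈ Θ)
    (hν : IsDataLaw (P.map (dataPath Y X))) (hθ : θ ∈ Θ) :
    Integrable (fun ω => meanContrast (pathLatent θ₀ (dataPath Y X ω) 0)
        (pathLatent θ (dataPath Y X ω) 0)) P ∧
      ∫ z, pathContrast θ z ∂(P.map (dataPath Y X)) =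
        ∫ ω, meanContrast (pathLatent θ₀ (dataPath Y X ω) 0)
          (pathLatent θ (dataPath Y X ω) 0) ∂P := by
  have := isProbabilityMeasure_gaussianCopula hr
  have hpm := hY.measurable_dataPath hUX
  have htame := hν.ae_tame hb.rate_pos.le hb.rate_lt_one
  set W : Ω → (Fin 2 → ℝ) × (Fin 2 → ℝ) := fun ω =>
    (pathLatent θ₀ (dataPath Y X ω) 0, pathLatent θ (dataPath Y X ω) 0) with hW
  have hWp : Measurable[past U X (0 - 1)] W :=
    (hY.measurable_past_pathLatent θ₀).prodMk (hY.measurable_past_pathLatent θ)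
  have hWm : Measurable W :=
    hWp.mono (past_le hUX.measurable_noise hUX.measurable_covariate _) le_rfl
  have hmap := hUX.map_prod hU hWp
  set f : ((Fin 2 → ℝ) × (Fin 2 → ℝ)) × (Fin 2 → ℝ) → ℝ := fun p =>
    contrast (observe p.1.1 p.2) p.1.2 with hf
  have hfm : Measurable f := by
    have h1 := measurable_of_measurable_section fun y => (continuous_contrast y).measurable
    have h2 : Measurable fun p : ((Fin 2 → ℝ) × (Fin 2 → ℝ)) × (Fin 2 → ℝ) =>
        observe p.1.1 p.2 := measurable_observe_comp measurable_fst.fst measurable_snd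
    exact h1.comp (h2.prodMk measurable_fst.snd)
  have hWU : Measurable fun ω => (W ω, U 0 ω) := hWm.prodMk (hUX.measurable_noise 0)
  -- The observation is a function of the true latent vector and of `U 0`, so the contrast becomes a
  -- function of the independent variables `W` and `U 0`, to which Fubini's theorem applies.
  have hae : (fun ω => pathContrast θ (dataPath Y X ω)) =ᵐ[P] fun ω => f (W ω, U 0 ω) := by
    filter_upwards [hY.ae_obs_eq hb hθ₀ (ae_of_ae_map hpm.aemeasurable htame)] with ω h
    simp only [hf, hW, pathContrast, ← h]
    rfl
  have hint0 : Integrable (pathContrast θ) (P.map (dataPath Y X)) := by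
    refine ((hν.integrable_envelope hb.pos.le hb.rate_pos.le hb.rate_lt_one).const_mul 3).mono'
      (measurable_pathContrast θ).aestronglyMeasurable ?_
    filter_upwards [htame] with z hz using hb.abs_pathContrast_le hz hθ
  have hint1 : Integrable f ((P.map W).prod (gaussianCopula r₀)) := by
    rw [← hmap, integrable_map_measure hfm.aestronglyMeasurable hWU.aemeasurable]
    exact ((integrable_map_measure (measurable_pathContrast θ).aestronglyMeasurable
      hpm.aemeasurable).1 hint0).congr hae
  have hinner : ∀ w, ∫ u, f (w, u) ∂(gaussianCopula r₀) = meanContrast w.1 w.2 := fun w =>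
    integral_contrast_observe hr w.1 w.2
  have hint2 := hint1.integral_prod_left
  simp only [hinner] at hint2
  refine ⟨hint2.comp_measurable hWm, ?_⟩
  rw [integral_map hpm.aemeasurable (measurable_pathContrast θ).aestronglyMeasurable,
    integral_congr_ae hae, ← integral_map hWU.aemeasurable hfm.aestronglyMeasurable, hmap,
    integral_prod _ hint1]
  simp only [hinner]
  exact integral_map hWm.aemeasurable hint2.aestronglyMeasurable

/-- A minimizer of the mean contrast produces the true latent vector. -/
lemma IsSolution.ae_pathLatent_eq_of_le (hUX : NoiseAssumption P U X)
    (hr : r₀ ∈ Set.Ioo (-1 : ℝ) 1) (hU : P.map (U 0) = gaussianCopula r₀)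
    (hY : IsSolution P U X θ₀ Y lam) (hb : GeomBound Θ C κ) (hθ₀ : θ₀ ∈ Θ)
    (hν : IsDataLaw (P.map (dataPath Y X))) (hθ : θ ∈ Θ)
    (hle : ∫ z, pathContrast θ z ∂(P.map (dataPath Y X)) ≤
      ∫ z, pathContrast θ₀ z ∂(P.map (dataPath Y X))) :
    ∀ᵐ ω ∂P, pathLatent θ₀ (dataPath Y X ω) 0 = pathLatent θ (dataPath Y X ω) 0 := by
  obtain ⟨i1, e1⟩ := hY.integral_pathContrast hUX hr hU hb hθ₀ hν hθ
  obtain ⟨i0, e0⟩ := hY.integral_pathContrast hUX hr hU hb hθ₀ hν hθ₀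
  rw [e1, e0] at hle
  -- The mean contrasts are ordered pointwise and have equal integrals, hence they are almost surely
  -- equal, and the minimizer is unique.
  have hae := (integral_eq_iff_of_ae_le i0 i1
    (Eventually.of_forall fun ω => meanContrast_self_le _ _)).1
    (le_antisymm (integral_mono i0 i1 fun ω => meanContrast_self_le _ _) hle)
  filter_upwards [hae] with ω h
  exact eq_of_meanContrast_le h.ge

/-- Integration of a function of the current observation and of the current latent vector. -/
lemma IsSolution.lintegral_obs_eq (hUX : NoiseAssumption P U X)
    (hr : r₀ ∈ Set.Ioo (-1 : ℝ) 1) (hU : P.map (U 0) = gaussianCopula r₀)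
    (hY : IsSolution P U X θ₀ Y lam) (hb : GeomBound Θ C κ) (hθ₀ : θ₀ ∈ Θ)
    (hz : ∀ᵐ ω ∂P, Tame κ (dataPath Y X ω)) {φ : (Fin 2 → ℕ) × (Fin 2 → ℝ) → ENNReal}
    (hφ : Measurable φ) :
    ∫⁻ ω, φ (Y 0 ω, pathLatent θ₀ (dataPath Y X ω) 0) ∂P =
      ∫⁻ ω, ∑' y, ENNReal.ofReal (condPmf r₀ y (pathLatent θ₀ (dataPath Y X ω) 0)) *
        φ (y, pathLatent θ₀ (dataPath Y X ω) 0) ∂P := by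
  have hf : Measurable fun p : (Fin 2 → ℝ) × (Fin 2 → ℝ) => φ (observe p.1 p.2, p.1) := by
    have h := hφ.comp (measurable_observe.prodMk measurable_fst)
    simpa only [Function.comp_def] using h
  have h := hUX.lintegral_eq hr hU (hY.measurable_past_pathLatent θ₀) hf
  have h2 : ∫⁻ ω, φ (Y 0 ω, pathLatent θ₀ (dataPath Y X ω) 0) ∂P =
      ∫⁻ ω, φ (observe (pathLatent θ₀ (dataPath Y X ω) 0) (U 0 ω),
        pathLatent θ₀ (dataPath Y X ω) 0) ∂P := by
    refine lintegral_congr_ae ?_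
    filter_upwards [hY.ae_obs_eq hb hθ₀ hz] with ω e
    rw [← e]
  rw [h2]
  refine h.trans (lintegral_congr fun ω => ?_)
  exact lintegral_observe hr _ fun y => φ (y, pathLatent θ₀ (dataPath Y X ω) 0)

/-- The copula parameter is identified by the conditional likelihood. -/
lemma IsSolution.eq_of_integral_pathLogPmf_le (hUX : NoiseAssumption P U X)
    (hr : r₀ ∈ Set.Ioo (-1 : ℝ) 1) (hU : P.map (U 0) = gaussianCopula r₀)
    (hY : IsSolution P U X θ₀ Y lam) (hb : GeomBound Θ C κ) (hθ₀ : θ₀ ∈ Θ)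
    (hν : IsDataLaw (P.map (dataPath Y X))) (hr' : r ∈ Set.Ioo (-1 : ℝ) 1)
    (hle : ∫ z, pathLogPmf (θ₀, r₀) z ∂(P.map (dataPath Y X)) ≤
      ∫ z, pathLogPmf (θ₀, r) z ∂(P.map (dataPath Y X))) : r = r₀ := by
  have hpm := hY.measurable_dataPath hUX
  have htame := ae_of_ae_map hpm.aemeasurable (hν.ae_tame hb.rate_pos.le hb.rate_lt_one)
  have hbin := ae_of_ae_map hpm.aemeasurable hν.binary
  set L : Ω → Fin 2 → ℝ := fun ω => pathLatent θ₀ (dataPath Y X ω) 0 with hL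
  have hLm : Measurable L := (hY.measurable_past_pathLatent θ₀).mono
    (past_le hUX.measurable_noise hUX.measurable_covariate _) le_rfl
  have hYL : Measurable fun ω => (Y 0 ω, L ω) := (hY.measurable_obs 0).prodMk hLm
  have hint : ∀ r ∈ Set.Ioo (-1 : ℝ) 1,
      Integrable (fun ω => Real.log (condPmf r (Y 0 ω) (L ω))) P := by
    intro r hr
    obtain ⟨g, hg, hgb⟩ := hν.exists_integrable_bound_pathLogPmf (G := {r}) isCompact_singleton
      (by simpa using hr) hb
    have h : Integrable (pathLogPmf (θ₀, r)) (P.map (dataPath Y X)) := by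
      refine hg.mono' (measurable_pathLogPmf (e := (θ₀, r)) hr).aestronglyMeasurable ?_
      filter_upwards [hgb] with z hz using hz (θ₀, r) ⟨hθ₀, rfl⟩
    exact h.comp_measurable hpm
  have hI : ∀ r ∈ Set.Ioo (-1 : ℝ) 1, ∫ z, pathLogPmf (θ₀, r) z ∂(P.map (dataPath Y X)) =
      ∫ ω, Real.log (condPmf r (Y 0 ω) (L ω)) ∂P := fun r hr =>
    integral_map hpm.aemeasurable (measurable_pathLogPmf (e := (θ₀, r)) hr).aestronglyMeasurable
  rw [hI r hr', hI r₀ hr] at hle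
  -- The likelihood ratio has mean at most 1, and log R ≤ R - 1 with equality only at R = 1. The
  -- hypothesis on the integrals forces equality almost surely.
  set R : (Fin 2 → ℕ) × (Fin 2 → ℝ) → ℝ := fun p => condPmf r p.1 p.2 / condPmf r₀ p.1 p.2 with hR
  have hRm : Measurable R := (measurable_condPmf hr').div (measurable_condPmf hr)
  have hR0 : ∀ p, 0 ≤ R p := fun p => div_nonneg (condPmf_nonneg _ _ _) (condPmf_nonneg _ _ _)
  have hRl : ∫⁻ ω, ENNReal.ofReal (R (Y 0 ω, L ω)) ∂P ≤ 1 := by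
    rw [hY.lintegral_obs_eq hUX hr hU hb hθ₀ htame hRm.ennreal_ofReal]
    calc _ ≤ ∫⁻ _, 1 ∂P := by
          refine lintegral_mono fun ω => ?_
          rw [← tsum_condPmf hr' (L ω)]
          refine ENNReal.tsum_le_tsum fun y => ?_
          rw [← ENNReal.ofReal_mul (condPmf_nonneg _ _ _)]
          refine ENNReal.ofReal_le_ofReal ?_
          -- Where the denominator vanishes the term is 0, which explains a mean of at most 1 rather
          -- than exactly 1.
          by_cases h : condPmf r₀ y (L ω) = 0
          · rw [show pathLatent θ₀ (dataPath Y X ω) 0 = L ω from rfl, h, zero_mul]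
            exact condPmf_nonneg _ _ _
          · exact (mul_div_cancel₀ _ h).le
      _ = 1 := by simp
  have hRi : Integrable (fun ω => R (Y 0 ω, L ω)) P := by
    refine ⟨(hRm.comp hYL).aestronglyMeasurable, ?_⟩
    have h0 : ∀ᵐ ω ∂P, 0 ≤ R (Y 0 ω, L ω) := Eventually.of_forall fun ω => hR0 _
    rw [hasFiniteIntegral_iff_ofReal h0]
    exact hRl.trans_lt ENNReal.one_lt_top
  have hR1 : ∫ ω, R (Y 0 ω, L ω) ∂P ≤ 1 := by
    have h0 : ∀ᵐ ω ∂P, 0 ≤ R (Y 0 ω, L ω) := Eventually.of_forall fun ω => hR0 _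
    rw [integral_eq_lintegral_of_nonneg_ae h0 hRi.aestronglyMeasurable]
    exact ENNReal.toReal_le_of_le_ofReal zero_le_one (by simpa using hRl)
  have hpos : ∀ᵐ ω ∂P, 0 < condPmf r (Y 0 ω) (L ω) ∧ 0 < condPmf r₀ (Y 0 ω) (L ω) := by
    filter_upwards [hbin] with ω h
    exact ⟨condPmf_pos_of_le_one hr' h _, condPmf_pos_of_le_one hr h _⟩
  have hlog : ∀ᵐ ω ∂P, Real.log (condPmf r (Y 0 ω) (L ω)) - Real.log (condPmf r₀ (Y 0 ω) (L ω)) ≤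
      R (Y 0 ω, L ω) - 1 := by
    filter_upwards [hpos] with ω ⟨h1, h2⟩
    rw [← Real.log_div h1.ne' h2.ne']
    exact Real.log_le_sub_one_of_pos (div_pos h1 h2)
  have hi1 : Integrable (fun ω => Real.log (condPmf r (Y 0 ω) (L ω)) -
      Real.log (condPmf r₀ (Y 0 ω) (L ω))) P := (hint r hr').sub (hint r₀ hr)
  have hi2 : Integrable (fun ω => R (Y 0 ω, L ω) - 1) P := hRi.sub (integrable_const 1)
  have heq : ∫ ω, (Real.log (condPmf r (Y 0 ω) (L ω)) -
      Real.log (condPmf r₀ (Y 0 ω) (L ω))) ∂P = ∫ ω, (R (Y 0 ω, L ω) - 1) ∂P := by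
    refine le_antisymm (integral_mono_ae hi1 hi2 hlog) ?_
    rw [integral_sub (hint r hr') (hint r₀ hr), integral_sub hRi (integrable_const 1),
      integral_const]
    simp only [probReal_univ, smul_eq_mul]
    linarith
  have hae : ∀ᵐ ω ∂P, condPmf r (Y 0 ω) (L ω) = condPmf r₀ (Y 0 ω) (L ω) := by
    filter_upwards [(integral_eq_iff_of_ae_le hi1 hi2 hlog).1 heq, hpos] with ω h ⟨h1, h2⟩
    by_contra hne
    have h3 := Real.log_lt_sub_one_of_pos (div_pos h1 h2) fun h => hne ((div_eq_one_iff_eq h2.ne').1 h)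
    rw [Real.log_div h1.ne' h2.ne'] at h3
    exact absurd h h3.ne
  have hS : MeasurableSet {p : (Fin 2 → ℕ) × (Fin 2 → ℝ) | condPmf r p.1 p.2 ≠ condPmf r₀ p.1 p.2} :=
    (measurableSet_eq_fun (measurable_condPmf hr') (measurable_condPmf hr)).compl
  -- The masses agree at the observed value. Integrating the indicator of disagreement against the
  -- conditional law of `Y 0` transfers the equality to every value y of positive conditional mass.
  have h0 : ∫⁻ ω, Set.indicator
      {p : (Fin 2 → ℕ) × (Fin 2 → ℝ) | condPmf r p.1 p.2 ≠ condPmf r₀ p.1 p.2} 1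
      (Y 0 ω, L ω) ∂P = 0 := by
    refine (lintegral_congr_ae (g := fun _ => 0) ?_).trans lintegral_zero
    filter_upwards [hae] with ω h
    refine Set.indicator_of_notMem ?_ _
    exact fun hn => hn h
  have h1 := (hY.lintegral_obs_eq hUX hr hU hb hθ₀ htame (measurable_one.indicator hS)).symm.trans h0
  have hsm : Measurable fun ω => ∑' y, ENNReal.ofReal (condPmf r₀ y (L ω)) * Set.indicator
      {p : (Fin 2 → ℕ) × (Fin 2 → ℝ) | condPmf r p.1 p.2 ≠ condPmf r₀ p.1 p.2} 1 (y, L ω) := by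
    refine Measurable.tsum fun y => ?_
    exact (((continuous_condPmf hr y).measurable.comp hLm).ennreal_ofReal).mul
      ((measurable_one.indicator hS).comp (measurable_const.prodMk hLm))
  rw [lintegral_eq_zero_iff hsm] at h1
  obtain ⟨ω, hω⟩ := h1.exists
  -- The value y = (0,0) always has positive mass, and there the mass determines the correlation; a
  -- single ω suffices.
  have h2 := ENNReal.tsum_eq_zero.1 hω 0
  have hp0 : 0 < condPmf r₀ 0 (L ω) := condPmf_pos_of_le_one hr (by simp) _
  refine condPmf_zero_injOn (L ω) hr' hr ?_
  by_contra hne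
  rw [Set.indicator_of_mem (show ((0 : Fin 2 → ℕ), L ω) ∈ _ from hne), Pi.one_apply, mul_one,
    ENNReal.ofReal_eq_zero] at h2
  linarith

end Identification

/-! ### Consistency -/

section Consistency

/-- Consistency of a two-step extremum estimator over compact sets. -/
lemma tendsto_of_two_step {E : Type*} [TopologicalSpace E]
    [TopologicalSpace.PseudoMetrizableSpace E] {Θ : Set E} {G : Set ℝ} (hΘ : IsCompact Θ)
    (hG : IsCompact G) {θ₀ : E} {r₀ : ℝ} (hθ₀ : θ₀ ∈ Θ) (hr₀ : r₀ ∈ G)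
    {Mn : ℕ → E → ℝ} {M : E → ℝ} {Qn : ℕ → E × ℝ → ℝ} {Q : E × ℝ → ℝ}
    (hM : ContinuousOn M Θ) (hQ : ContinuousOn Q (Θ ×ˢ G))
    (hMn : TendstoUniformlyOn Mn M atTop Θ) (hQn : TendstoUniformlyOn Qn Q atTop (Θ ×ˢ G))
    {θ : ℕ → E} {r : ℕ → ℝ} (hθ : ∀ n, 1 ≤ n → θ n ∈ Θ ∧ Mn n (θ n) ≤ Mn n θ₀)
    (hr : ∀ n, 1 ≤ n → r n ∈ G ∧ Qn n (θ n, r₀) ≤ Qn n (θ n, r n))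
    (hid : ∀ t ∈ Θ, M t ≤ M θ₀ → ∀ s ∈ G, Q (t, r₀) ≤ Q (t, s) → s = r₀) :
    Tendsto r atTop (𝓝 r₀) := by
  let _ := TopologicalSpace.pseudoMetrizableSpacePseudoMetric E
  -- Every subsequence has a further one along which the two estimators converge jointly, by
  -- compactness. Uniform convergence and continuity pass both optimality inequalities to the limit,
  -- where `hid` forces the second coordinate to be r₀.
  refine tendsto_of_subseq_tendsto fun ns hns => ?_
  have h1 : ∀ᶠ k in atTop, 1 ≤ ns k := hns.eventually_ge_atTop 1
  have hmem : ∀ᶠ k in atTop, (θ (ns k), r (ns k)) ∈ Θ ×ˢ G := by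
    filter_upwards [h1] with k hk using ⟨(hθ _ hk).1, (hr _ hk).1⟩
  obtain ⟨⟨t, s⟩, hts, φ, hφ, hlim⟩ := (hΘ.prod hG).tendsto_subseq' hmem.frequently
  refine ⟨φ, ?_⟩
  have hsub : Tendsto (fun k => ns (φ k)) atTop atTop := hns.comp hφ.tendsto_atTop
  have h1' : ∀ᶠ k in atTop, 1 ≤ ns (φ k) := hsub.eventually_ge_atTop 1
  have hlim1 : Tendsto (fun k => θ (ns (φ k))) atTop (𝓝[Θ] t) :=
    tendsto_nhdsWithin_iff.2 ⟨(continuous_fst.tendsto _).comp hlim,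
      h1'.mono fun k hk => (hθ _ hk).1⟩
  have hlim2 : Tendsto (fun k => (θ (ns (φ k)), r (ns (φ k)))) atTop (𝓝[Θ ×ˢ G] (t, s)) :=
    tendsto_nhdsWithin_iff.2 ⟨hlim, h1'.mono fun k hk => ⟨(hθ _ hk).1, (hr _ hk).1⟩⟩
  have hlim3 : Tendsto (fun k => (θ (ns (φ k)), r₀)) atTop (𝓝[Θ ×ˢ G] (t, r₀)) :=
    tendsto_nhdsWithin_iff.2 ⟨((continuous_fst.tendsto _).comp hlim).prodMk_nhds
      tendsto_const_nhds, h1'.mono fun k hk => ⟨(hθ _ hk).1, hr₀⟩⟩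
  have hMs : TendstoUniformlyOn (fun k => Mn (ns (φ k))) M atTop Θ := fun u hu =>
    hsub.eventually (hMn u hu)
  have hQs : TendstoUniformlyOn (fun k => Qn (ns (φ k))) Q atTop (Θ ×ˢ G) := fun u hu =>
    hsub.eventually (hQn u hu)
  have a1 := hMs.tendsto_comp (hM t hts.1) hlim1
  have a2 : Tendsto (fun k => Mn (ns (φ k)) θ₀) atTop (𝓝 (M θ₀)) := hMs.tendsto_at hθ₀
  have a3 := le_of_tendsto_of_tendsto a1 a2 (h1'.mono fun k hk => (hθ _ hk).2)
  have b1 := hQs.tendsto_comp (hQ (t, s) hts) hlim2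
  have b2 := hQs.tendsto_comp (hQ (t, r₀) ⟨hts.1, hr₀⟩) hlim3
  have b3 := le_of_tendsto_of_tendsto b2 b1 (h1'.mono fun k hk => (hr _ hk).2)
  have hs := hid t hts.1 a3 s hts.2 b3
  rw [← hs]
  exact (continuous_snd.tendsto _).comp hlim

/-- A perturbation of order `1 / n` does not affect the uniform convergence. -/
lemma TendstoUniformlyOn.of_abs_sub_le {E : Type*} {K : Set E} {f g : ℕ → E → ℝ} {F : E → ℝ}
    (hf : TendstoUniformlyOn f F atTop K) {W : ℝ}
    (h : ∀ n, ∀ e ∈ K, |g n e - f n e| ≤ (n : ℝ)⁻¹ * W) : TendstoUniformlyOn g F atTop K := by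
  rw [Metric.tendstoUniformlyOn_iff] at hf ⊢
  intro ε hε
  have hW : Tendsto (fun n : ℕ => (n : ℝ)⁻¹ * W) atTop (𝓝 0) := by
    simpa using (tendsto_inv_atTop_nhds_zero_nat (𝕜 := ℝ)).mul_const W
  filter_upwards [hf (ε / 2) (half_pos hε), hW.eventually_lt_const (half_pos hε)] with n h1 h2 e he
  have h3 := h1 e he
  have h4 := h n e he
  rw [Real.dist_eq] at h3 ⊢
  calc |F e - g n e| ≤ |F e - f n e| + |f n e - g n e| := abs_sub_le _ _ _
    _ < ε := by rw [abs_sub_comm (f n e)]; linarith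

variable {Ω : Type*} [MeasurableSpace Ω] {P : Measure Ω} [IsProbabilityMeasure P] {m : ℕ}
  {U : ℤ → Ω → Fin 2 → ℝ} {X : ℤ → Ω → Fin m → ℝ} {Y : ℤ → Ω → Fin 2 → ℕ}
  {lam : ℤ → Ω → Fin 2 → ℝ} {θ₀ : Param m} {r₀ : ℝ} {Θ : Set (Param m)} {C κ : ℝ}

lemma IsSolution.isDataLaw (hUX : NoiseAssumption P U X)
    (hr : r₀ ∈ Set.Ioo (-1 : ℝ) 1) (hU : P.map (U 0) = gaussianCopula r₀)
    (hX : ∀ r : ℝ, 0 < r → Integrable (fun ω => Real.exp (r * ∑ i, |X 0 ω i|)) P)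
    (hρ : specRad (contractionMatrix θ₀) < 1)
    (hnorm : ∀ i, ∑ j, |(absVec (zeroFirstCol θ₀.A) + absVec θ₀.B) i j| < 1)
    (hY : IsSolution P U X θ₀ Y lam) : IsDataLaw (P.map (dataPath Y X)) := by
  have hpm := hY.measurable_dataPath hUX
  refine ⟨Measure.isProbabilityMeasure_map hpm.aemeasurable,
    (hY.isStationaryErgodic hUX hr hU hρ).2, fun c => ?_, ?_⟩
  · have hm : Measurable fun z : DataPath m => ENNReal.ofReal (Real.exp (c * obsSize (z 0))) :=
      ((measurable_obsSize.comp (measurable_pi_apply 0)).const_mul c).exp.ennreal_ofReal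
    rw [lintegral_map hm hpm]
    exact hY.lintegral_exp_obsSize_lt_top hUX hr hU hX hρ hnorm c
  · have hS : MeasurableSet {z : DataPath m | (z 0).1 0 ≤ 1} :=
      measurableSet_le ((measurable_pi_apply 0).comp (measurable_pi_apply 0).fst) measurable_const
    rw [ae_map_iff hpm.aemeasurable hS]
    filter_upwards [hY.observation 0] with ω h
    change Y 0 ω 0 ≤ 1
    rw [h]
    exact observe_zero_le _ _

/-- The first criterion converges uniformly, whatever the initial value of the latent process. -/
lemma IsDataLaw.tendstoUniformlyOn_criterion {ν : Measure (DataPath m)} (h : IsDataLaw ν)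
    (hΘ : IsCompact Θ) (hb : GeomBound Θ C κ) (init : Option (Fin 2 → ℝ)) :
    ∀ᵐ z ∂ν, TendstoUniformlyOn
      (fun n θ => criterion (fun t => (z t).1) (fun θ t => match init with
          | none => latent θ (fun t => (z t).1) (fun t => (z t).2) t
          | some l₀ => latentInit l₀ θ (fun t => (z t).1) (fun t => (z t).2) t) n θ)
      (fun θ => ∫ z, pathContrast θ z ∂ν) atTop Θ := by
  have h1 := (h.tendstoUniformlyOn_pathContrast hΘ hb).2
  match init with
  | none =>
    filter_upwards [h1] with z hz
    refine hz.congr (Eventually.of_forall fun n θ _ => ?_)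
    simp only [criterion, pathContrast, pathLatent_shift_iterate, shift_iterate, zero_add]
    rfl
  | some l₀ =>
    filter_upwards [h1, h.ae_exists_sum_abs_sub_le hb l₀] with z hz ⟨W, hW⟩
    refine TendstoUniformlyOn.of_abs_sub_le hz (W := W) fun n θ hθ => ?_
    simp only [criterion]
    rw [← mul_sub, ← Finset.sum_sub_distrib, abs_mul, abs_of_nonneg (by positivity)]
    exact mul_le_mul_of_nonneg_left ((Finset.abs_sum_le_sum_abs _ _).trans (hW θ hθ n))
      (by positivity)

end Consistency

end

end BIP

/-! The second criterion depends on `θ` only through the latent process, which the mean of the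
first criterion identifies: a limit point of the first-step estimators produces the true latent
vector, whether or not it is the true parameter. Hence the proof does not need the hypotheses that
identify `θ₀` itself. -/

theorem mainTheorem11 {Ω : Type*} [MeasurableSpace Ω] (P : Measure Ω) [IsProbabilityMeasure P]
    (m : ℕ) (U : ℤ → Ω → Fin 2 → ℝ) (X : ℤ → Ω → Fin m → ℝ)
    (Y : ℤ → Ω → Fin 2 → ℕ) (lam : ℤ → Ω → Fin 2 → ℝ)
    (Θ : Set (BIP.Param m)) (θ₀ : BIP.Param m) (G : Set ℝ) (r₀ : ℝ)
    -- the parameter spaces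
    (hΘ : IsCompact Θ) (hθ₀ : θ₀ ∈ Θ) (hΘB : ∀ θ ∈ Θ, BIP.specRad θ.B < 1)
    (hG : IsCompact G) (hG' : G ⊆ Set.Ioo (-1) 1) (hr₀ : r₀ ∈ G)
    -- the noise and the covariates
    (hUX : BIP.NoiseAssumption P U X)
    (hU : P.map (U 0) = BIP.gaussianCopula r₀)
    (hX : ∀ r : ℝ, 0 < r → Integrable (fun ω => Real.exp (r * ∑ i, |X 0 ω i|)) P)
    -- identification of the autoregressive parameters
    (hId : BIP.CovariateNondegenerate P U X ∨ BIP.StrictlyExogenous P U X)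
    (hLag : BIP.LagIdentifiable Θ θ₀)
    -- stability
    (hρ : BIP.specRad
      (BIP.absVec θ₀.B + BIP.absVec θ₀.A * Matrix.diagonal ![1 / 4, 1]) < 1)
    (hnorm : ∀ i, ∑ j, |(BIP.absVec (BIP.zeroFirstCol θ₀.A) + BIP.absVec θ₀.B) i j| < 1)
    -- the data
    (hY : BIP.IsSolution P U X θ₀ Y lam)
    -- the two-step estimator
    (init : Option (Fin 2 → ℝ)) (θhat : ℕ → Ω → BIP.Param m) (rhat : ℕ → Ω → ℝ)
    (hθhat : ∀ᵐ ω ∂P,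
      BIP.IsPMLE Θ init (fun t => Y t ω) (fun t => X t ω) (fun n => θhat n ω))
    (hrhat : ∀ᵐ ω ∂P,
      BIP.IsCopulaMLE G (fun t => Y t ω) (fun t => X t ω) (fun n => θhat n ω)
        (fun n => rhat n ω)) :
    ∀ᵐ ω ∂P, Tendsto (fun n => rhat n ω) atTop (𝓝 r₀) := by
  have hr : r₀ ∈ Set.Ioo (-1 : ℝ) 1 := hG' hr₀
  have hν := hY.isDataLaw hUX hr hU hX hρ hnorm
  have hpm := hY.measurable_dataPath hUX
  obtain ⟨C, κ, hb⟩ := BIP.exists_geomBound hΘ hΘB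
  obtain ⟨hQ, hQn⟩ := hν.tendstoUniformlyOn_pathLogPmf hΘ hG hG' hb
  have hM := (hν.tendstoUniformlyOn_pathContrast hΘ hb).1
  have hMn := hν.tendstoUniformlyOn_criterion hΘ hb init
  filter_upwards [hθhat, hrhat, ae_of_ae_map hpm.aemeasurable hQn,
    ae_of_ae_map hpm.aemeasurable hMn] with ω h1 h2 h3 h4
  refine BIP.tendsto_of_two_step hΘ hG hθ₀ hr₀ hM hQ h4 h3
    (fun n hn => ⟨(h1 n hn).1, by cases init <;> exact (h1 n hn).2 hθ₀⟩) (fun n hn => ⟨(h2 n hn).1, ?_⟩) ?_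
  · have h5 := (h2 n hn).2 hr₀
    simp only [Set.mem_ofPred_eq, BIP.copulaLogLik] at h5
    simp only [BIP.pathLogPmf, BIP.pathLatent_shift_iterate, BIP.shift_iterate, zero_add]
    exact h5
  · intro θ hθ hle r hrG hQle
    -- A limit point of the first step reproduces the true latent vector almost surely, so it can be
    -- replaced by θ₀ in the limit of the second criterion.
    have hae := hY.ae_pathLatent_eq_of_le hUX hr hU hb hθ₀ hν hθ hle
    refine hY.eq_of_integral_pathLogPmf_le hUX hr hU hb hθ₀ hν (hG' hrG) ?_
    have e : ∀ s ∈ G, ∫ z, BIP.pathLogPmf (θ, s) z ∂(P.map (BIP.dataPath Y X)) =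
        ∫ z, BIP.pathLogPmf (θ₀, s) z ∂(P.map (BIP.dataPath Y X)) := by
      intro s hs
      rw [integral_map hpm.aemeasurable
          (BIP.measurable_pathLogPmf (e := (θ, s)) (hG' hs)).aestronglyMeasurable,
        integral_map hpm.aemeasurable
          (BIP.measurable_pathLogPmf (e := (θ₀, s)) (hG' hs)).aestronglyMeasurable]
      refine integral_congr_ae ?_
      filter_upwards [hae] with ω h
      simp only [BIP.pathLogPmf, h]
    rw [← e r hrG, ← e r₀ hr₀]
    exact hQle
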